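/- Let $\Bbbk$ be a commutative ring. A fusion category over $\Bbbk$ is a $\Bbbk$-linear monoidal category $\mathcal C$ ($\Bbbk$-bilinear tensor product, not necessarily strict) with finite direct sums, in which every object $X$ has a left dual ${}^\vee X$ (with $\mathrm{ev}_X:{}^\vee X\otimes X\to\mathbb 1$, $\mathrm{coev}_X:\mathbb 1\to X\otimes{}^\vee X$) and a right dual $X^\vee$ (with $\widetilde{\mathrm{ev}}_X:X\otimes X^\vee\to\mathbb 1$, $\widetilde{\mathrm{coev}}_X:\mathbb 1\to X^\vee\otimes X$), together with a finite family $(V_i)_{i\in I}$ of objects such that $\mathrm{End}(V_i)=\Bbbk\,\mathrm{id}$ (free of rank one), $\mathrm{Hom}(V_i,V_j)=0$ for $i\ne j$, $\mathbb 1$ is isomorphic to some $V_i$, and every object $Y$ is a finite direct sum of $V_i$'s: there are morphisms $p_Y^{i,\alpha}:Y\to V_i$, $q_Y^{i,\alpha}:V_i\to Y$ ($1\le\alpha\le N_Y^i$) with $\sum_{i,\alpha}q_Y^{i,\alpha}p_Y^{i,\alpha}=\mathrm{id}_Y$ and $p_Y^{i,\alpha}q_Y^{j,\beta}=\delta_{ij}\delta_{\alpha\beta}\mathrm{id}_{V_i}$.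 Associativity, unit and duality isomorphisms are suppressed from the formulas below. A bimonad on $\mathcal C$ is a monad $(T,\mu,\eta)$ with natural $T_2(X,Y):T(X\otimes Y)\to T(X)\otimes T(Y)$ and $T_0:T(\mathbb 1)\to\mathbb 1$ making $T$ comonoidal and $\mu,\eta$ comonoidal transformations. A Hopf monad is a bimonad with natural antipodes $s^l_X:T({}^\vee T(X))\to{}^\vee X$ and $s^r_X:T(T(X)^\vee)\to X^\vee$ satisfying $$T_0T(\mathrm{ev}_X)T({}^\vee\eta_X\otimes\mathrm{id})=\mathrm{ev}_{TX}(s^l_{TX}T({}^\vee\mu_X)\otimes\mathrm{id})T_2({}^\vee T(X),X),\qquad (\eta_X\otimes\mathrm{id})\mathrm{coev}_XT_0=(\mu_X\otimes s^l_X)T_2(T(X),{}^\vee T(X))T(\mathrm{coev}_{TX})$$ and the mirror identities for $s^r$. It is quasitriangular when it carries an R-matrix, i.e. a natural $R_{X,Y}:X\otimes Y\to T(Y)\otimes T(X)$ with $$(\mu_Y\otimes\mu_X)R_{TX,TY}T_2(X,Y)=(\mu_Y\otimes\mu_X)T_2(TY,TX)T(R_{X,Y}),$$ $$(\mathrm{id}\otimes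 T_2(X,Y))R_{X\otimes Y,Z}=(\mu_Z\otimes\mathrm{id})(R_{X,TZ}\otimes\mathrm{id})(\mathrm{id}\otimes R_{Y,Z}),\qquad (T_2(Y,Z)\otimes\mathrm{id})R_{X,Y\otimes Z}=(\mathrm{id}\otimes\mu_X)(\mathrm{id}\otimes R_{TX,Z})(R_{X,Y}\otimes\mathrm{id}).$$ It is ribbon when it also carries a natural $\theta_X:X\to T(X)$ that is invertible for the convolution $(\phi*\psi)_X=\mu_X\phi_{TX}\psi_X$ (with unit $\eta$), central ($\mu_XT(\theta_X)=\mu_X\theta_{TX}$), satisfies $T_2(X,Y)\theta_{X\otimes Y}=(\mu_X\theta_{TX}\mu_X\otimes\mu_Y\theta_{TY}\mu_Y)R_{TY,TX}R_{X,Y}$, and is self-dual (${}^\vee\theta_X=s^l_X\theta_{{}^\vee T(X)}$). The category $T$-$\mathcal C$ of $T$-modules of a bimonad is monoidal with $(M,r)\otimes(N,s)=(M\otimes N,(r\otimes s)T_2(M,N))$ and unit $(\mathbb 1,T_0)$. The center $\mathcal Z(\mathcal C)$ is the braided category of pairs $(M,\sigma)$, $\sigma_Y:M\otimes Y\to Y\otimes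 M$ a natural isomorphism with $\sigma_{Y\otimes W}=(\mathrm{id}_Y\otimes\sigma_W)(\sigma_Y\otimes\mathrm{id}_W)$, with $(M,\sigma)\otimes(N,\gamma)=(M\otimes N,(\sigma\otimes\mathrm{id}_N)(\mathrm{id}_M\otimes\gamma))$ and braiding $\tau_{(M,\sigma),(N,\gamma)}=\sigma_N$. Theorem. Let $\mathcal C$ be a fusion category over $\Bbbk$, with $V_i,p,q$ as above. (1) The trivial Hopf monad $1_{\mathcal C}$ is centralizable: for every $X$ the coend $\int^{Y\in\mathcal C}{}^\vee Y\otimes X\otimes Y$ exists. It is $Z(X)=\bigoplus_{i\in I}{}^\vee V_i\otimes X\otimes V_i$, with universal dinatural transformation $$i_{X,Y}=\sum_{i,\alpha}{}^\vee q_Y^{i,\alpha}\otimes\mathrm{id}_X\otimes p_Y^{i,\alpha}:{}^\vee Y\otimes X\otimes Y\to Z(X)$$ for any choice of the $p,q$, and $i_{X,Y}$ is natural in $X$. (2) The endofunctor $Z$ is a quasitriangular Hopf monad, with structural morphisms given as follows, where $\iota_{i,X}:{}^\vee V_i\otimes X\otimes V_i\to Z(X)$ is the inclusion of the $i$-th summand: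 $$Z_2(X,Y)\iota_{i,X\otimes Y}=(\iota_{i,X}\otimes\iota_{i,Y})(\mathrm{id}_{{}^\vee V_i\otimes X}\otimes\mathrm{coev}_{V_i}\otimes\mathrm{id}_{Y\otimes V_i}),\qquad Z_0\,\iota_{i,\mathbb 1}=\mathrm{ev}_{V_i},$$ $$\mu_X\,\iota_{j,Z(X)}(\mathrm{id}_{{}^\vee V_j}\otimes\iota_{i,X}\otimes\mathrm{id}_{V_j})=i_{X,V_i\otimes V_j},\qquad \eta_X=i_{X,\mathbb 1},$$ $$s^l_X\,i_{{}^\vee Z(X),{}^\vee V_i}=(\mathrm{ev}_{{}^\vee V_i}\otimes\mathrm{id}_{{}^\vee X}\otimes\mathrm{ev}_{{}^\vee V_i})(\mathrm{id}\otimes{}^\vee\iota_{i,X}\otimes\mathrm{id}),\qquad s^r_X\,i_{Z(X)^\vee,V_i^\vee}=(\widetilde{\mathrm{ev}}_{V_i}\otimes\mathrm{id}_{X^\vee}\otimes\widetilde{\mathrm{ev}}_{V_i})(\mathrm{id}\otimes\iota_{i,X}^\vee\otimes\mathrm{id}),$$ $$R_{X,Y}=(\eta_Y\otimes i_{X,Y})(\mathrm{coev}_Y\otimes\mathrm{id}_{X\otimes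 Y}).$$ (3) For $(M,\sigma)\in\mathcal Z(\mathcal C)$ let $r_\sigma:Z(M)\to M$ be given by $r_\sigma\iota_{i,M}=(\mathrm{ev}_{V_i}\otimes\mathrm{id}_M)(\mathrm{id}_{{}^\vee V_i}\otimes\sigma_{V_i})$. The morphisms $\tau_{(M,r),(N,s)}=(s\otimes r)R_{M,N}$ form a braiding on $Z$-$\mathcal C$, and $(M,\sigma)\mapsto(M,r_\sigma)$, $f\mapsto f$, is an isomorphism of categories $\mathcal Z(\mathcal C)\cong Z$-$\mathcal C$ that is strict monoidal and braided. (4) Suppose $\mathcal C$ is spherical, i.e. endowed with a monoidal natural isomorphism $\phi_X:X\to{}^{\vee\vee}X$ such that $\mathrm{ev}_X(\mathrm{id}\otimes f\phi_X^{-1})\mathrm{coev}_{{}^\vee X}=\mathrm{ev}_{{}^\vee X}(\phi_Xf\otimes\mathrm{id})\mathrm{coev}_X$ for every endomorphism $f$ of every object $X$. Then $Z$ is a ribbon Hopf monad, with twist and convolution inverse $$\theta_X=i_{X,X}\bigl((\mathrm{id}_{{}^\vee X}\otimes\phi_X^{-1})\mathrm{coev}_{{}^\vee X}\otimes\mathrm{id}_X\bigr),\qquad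 \theta^{-1}_X=i_{X,{}^\vee X}(\phi_X\otimes\mathrm{coev}_X).$$ Moreover $\mathcal Z(\mathcal C)$ is autonomous, and it is a ribbon category (it has a self-dual twist) with twist $\Theta_{(M,\sigma)}=r_\sigma\theta_M$. -/

import Mathlib

open CategoryTheory MonoidalCategory Limits Opposite

universe w v u

namespace FusionCenter

noncomputable section

/-! ### Duals in an autonomous category

A left dual of `X` is an object `ldual X` with `ev : ldual X ⊗ X ⟶ 𝟙_` and
`coev : 𝟙_ ⟶ X ⊗ ldual X`; a right dual of `X` is an object `rdual X` with
`evr : X ⊗ rdual X ⟶ 𝟙_` and `coevr : 𝟙_ ⟶ rdual X ⊗ X`. Mathlib uses the opposite names: its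
chosen "right" duals are the left duals here. -/

section Duals

variable {C : Type u} [Category.{v} C] [MonoidalCategory C] [RigidCategory C]

/-- The chosen left dual `∨X`. -/
abbrev ldual (X : C) : C :=
  @HasRightDual.rightDual C _ _ X (RightRigidCategory.rightDual X)

/-- The left evaluation `∨X ⊗ X ⟶ 𝟙`. -/
abbrev ev (X : C) : ldual X ⊗ X ⟶ 𝟙_ C :=
  @ExactPairing.evaluation C _ _ X (ldual X) (RightRigidCategory.rightDual X).exact

/-- The left coevaluation `𝟙 ⟶ X ⊗ ∨X`. -/
abbrev coev (X : C) : 𝟙_ C ⟶ X ⊗ ldual X :=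
  @ExactPairing.coevaluation C _ _ X (ldual X) (RightRigidCategory.rightDual X).exact

/-- The left dual `∨f : ∨Y ⟶ ∨X` of a morphism `f : X ⟶ Y`. -/
abbrev ldualMap {X Y : C} (f : X ⟶ Y) : ldual Y ⟶ ldual X :=
  @rightAdjointMate C _ _ X Y (RightRigidCategory.rightDual X) (RightRigidCategory.rightDual Y) f

/-- The chosen right dual `X∨`. -/
abbrev rdual (X : C) : C :=
  @HasLeftDual.leftDual C _ _ X (LeftRigidCategory.leftDual X)

/-- The right evaluation `X ⊗ X∨ ⟶ 𝟙`. -/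
abbrev evr (X : C) : X ⊗ rdual X ⟶ 𝟙_ C :=
  @ExactPairing.evaluation C _ _ (rdual X) X (LeftRigidCategory.leftDual X).exact

/-- The right coevaluation `𝟙 ⟶ X∨ ⊗ X`. -/
abbrev coevr (X : C) : 𝟙_ C ⟶ rdual X ⊗ X :=
  @ExactPairing.coevaluation C _ _ (rdual X) X (LeftRigidCategory.leftDual X).exact

/-- The right dual `f∨ : Y∨ ⟶ X∨` of a morphism `f : X ⟶ Y`. -/
abbrev rdualMap {X Y : C} (f : X ⟶ Y) : rdual Y ⟶ rdual X :=
  @leftAdjointMate C _ _ X Y (LeftRigidCategory.leftDual X) (LeftRigidCategory.leftDual Y) f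

/-- The canonical isomorphism `∨(X ⊗ Y) ≅ ∨Y ⊗ ∨X`. -/
def ldualTensorIso (X Y : C) : ldual (X ⊗ Y) ≅ ldual Y ⊗ ldual X :=
  @rightDualTensorIso C _ _ X Y (RightRigidCategory.rightDual X) (RightRigidCategory.rightDual Y)
    (RightRigidCategory.rightDual (X ⊗ Y))

/-- The canonical isomorphism `(X ⊗ Y)∨ ≅ Y∨ ⊗ X∨`. -/
def rdualTensorIso (X Y : C) : rdual (X ⊗ Y) ≅ rdual Y ⊗ rdual X :=
  @leftDualTensorIso C _ _ X Y (LeftRigidCategory.leftDual X) (LeftRigidCategory.leftDual Y)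
    (LeftRigidCategory.leftDual (X ⊗ Y))

variable (C) in
/-- The canonical (iso)morphism `𝟙 ⟶ ∨𝟙`. -/
def toLdualUnit : 𝟙_ C ⟶ ldual (𝟙_ C) :=
  coev (𝟙_ C) ≫ (λ_ (ldual (𝟙_ C))).hom

/-- The canonical isomorphism `(∨X)∨ ≅ X`: both are right duals of `∨X`. -/
def rdualLdualIso (X : C) : rdual (ldual X) ≅ X :=
  leftDualIso (Y := ldual X) (LeftRigidCategory.leftDual (ldual X)).exact
    (RightRigidCategory.rightDual X).exact

end Duals

/-! ### Sovereign, spherical and ribbon categories -/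

section Sovereign

variable (C : Type u) [Category.{v} C] [MonoidalCategory C] [RigidCategory C]

/-- A sovereign structure: a monoidal natural isomorphism `φ X : X ≅ ∨∨X`, where `∨∨` is strong
monoidal through the canonical isomorphisms. -/
structure SovereignStructure where
  φ : ∀ X : C, X ≅ ldual (ldual X)
  natural : ∀ {X Y : C} (f : X ⟶ Y), f ≫ (φ Y).hom = (φ X).hom ≫ ldualMap (ldualMap f)
  tensor : ∀ X Y : C, (φ (X ⊗ Y)).hom =
    ((φ X).hom ⊗ₘ (φ Y).hom) ≫ (ldualTensorIso (ldual Y) (ldual X)).inv ≫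
      ldualMap (ldualTensorIso X Y).hom
  unit : (φ (𝟙_ C)).hom ≫ ldualMap (toLdualUnit C) = toLdualUnit C

variable {C}

/-- The coevaluation `𝟙 ⟶ ∨X ⊗ X` of a sovereign category. -/
def SovereignStructure.coev' (S : SovereignStructure C) (X : C) : 𝟙_ C ⟶ ldual X ⊗ X :=
  coev (ldual X) ≫ ldual X ◁ (S.φ X).inv

/-- The evaluation `X ⊗ ∨X ⟶ 𝟙` of a sovereign category. -/
def SovereignStructure.ev' (S : SovereignStructure C) (X : C) : X ⊗ ldual X ⟶ 𝟙_ C :=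
  (S.φ X).hom ▷ ldual X ≫ ev (ldual X)

/-- The left trace of an endomorphism. -/
def SovereignStructure.trl (S : SovereignStructure C) {X : C} (f : X ⟶ X) : 𝟙_ C ⟶ 𝟙_ C :=
  S.coev' X ≫ ldual X ◁ f ≫ ev X

/-- The right trace of an endomorphism. -/
def SovereignStructure.trr (S : SovereignStructure C) {X : C} (f : X ⟶ X) : 𝟙_ C ⟶ 𝟙_ C :=
  coev X ≫ f ▷ ldual X ≫ S.ev' X

/-- A sovereign category is spherical when left and right traces coincide. -/
def SovereignStructure.IsSpherical (S : SovereignStructure C) : Prop :=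
  ∀ (X : C) (f : X ⟶ X), S.trl f = S.trr f

end Sovereign

/-- A ribbon structure on a braided autonomous category: a self-dual twist. -/
structure RibbonStructure (B : Type u) [Category.{v} B] [MonoidalCategory B] [BraidedCategory B]
    [RigidCategory B] where
  twist : 𝟭 B ≅ 𝟭 B
  twist_tensor : ∀ X Y : B, twist.hom.app (X ⊗ Y) =
    (β_ X Y).hom ≫ (β_ Y X).hom ≫ (twist.hom.app X ⊗ₘ twist.hom.app Y)
  selfDual : ∀ X : B, ldualMap (twist.hom.app X) = twist.hom.app (ldual X)

/-! ### Bimonads and their modules -/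

section Bimonads

variable {C : Type u} [Category.{v} C] [MonoidalCategory C]

/-- A bimonad structure on an endofunctor `T`. -/
structure BimonadStructure (T : C ⥤ C) where
  μ : T ⋙ T ⟶ T
  η : 𝟭 C ⟶ T
  μ_assoc : ∀ X, T.map (μ.app X) ≫ μ.app X = μ.app (T.obj X) ≫ μ.app X
  η_left : ∀ X, η.app (T.obj X) ≫ μ.app X = 𝟙 (T.obj X)
  η_right : ∀ X, T.map (η.app X) ≫ μ.app X = 𝟙 (T.obj X)
  T₂ : ∀ X Y, T.obj (X ⊗ Y) ⟶ T.obj X ⊗ T.obj Y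
  T₂_natural : ∀ {X X' Y Y' : C} (f : X ⟶ X') (g : Y ⟶ Y'),
    T.map (f ⊗ₘ g) ≫ T₂ X' Y' = T₂ X Y ≫ (T.map f ⊗ₘ T.map g)
  T₀ : T.obj (𝟙_ C) ⟶ 𝟙_ C
  T₂_assoc : ∀ X Y Z, T.map (α_ X Y Z).hom ≫ T₂ X (Y ⊗ Z) ≫ T.obj X ◁ T₂ Y Z =
    T₂ (X ⊗ Y) Z ≫ T₂ X Y ▷ T.obj Z ≫ (α_ _ _ _).hom
  T₂_right_unit : ∀ X, T₂ X (𝟙_ C) ≫ T.obj X ◁ T₀ ≫ (ρ_ (T.obj X)).hom = T.map (ρ_ X).hom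
  T₂_left_unit : ∀ X, T₂ (𝟙_ C) X ≫ T₀ ▷ T.obj X ≫ (λ_ (T.obj X)).hom = T.map (λ_ X).hom
  T₂_μ : ∀ X Y, μ.app (X ⊗ Y) ≫ T₂ X Y =
    T.map (T₂ X Y) ≫ T₂ (T.obj X) (T.obj Y) ≫ (μ.app X ⊗ₘ μ.app Y)
  T₀_μ : μ.app (𝟙_ C) ≫ T₀ = T.map T₀ ≫ T₀
  T₂_η : ∀ X Y, η.app (X ⊗ Y) ≫ T₂ X Y = η.app X ⊗ₘ η.app Y
  T₀_η : η.app (𝟙_ C) ≫ T₀ = 𝟙 (𝟙_ C)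

variable {T : C ⥤ C}

namespace BimonadStructure

/-- The underlying monad. -/
def toMonad (B : BimonadStructure T) : Monad C where
  toFunctor := T
  μ := B.μ
  η := B.η
  assoc := B.μ_assoc
  left_unit := B.η_left
  right_unit := B.η_right

/-- The category of `T`-modules (Eilenberg-Moore algebras). -/
abbrev Modules (B : BimonadStructure T) := B.toMonad.Algebra

/-- A module from an action. -/
@[simps]
def mkModule (B : BimonadStructure T) (M : C) (r : T.obj M ⟶ M) (unit : B.η.app M ≫ r = 𝟙 M)
    (assoc : B.μ.app M ≫ r = T.map r ≫ r) : B.Modules where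
  A := M
  a := r
  unit := unit
  assoc := assoc

/-- The action of a module, as a morphism out of `T.obj`. -/
abbrev act {B : BimonadStructure T} (M : B.Modules) : T.obj M.A ⟶ M.A := M.a

/-- The tensor product of two modules: `(M, r) ⊗ (N, s) = (M ⊗ N, (r ⊗ s) T₂(M, N))`. -/
@[simps!]
def tensorModule (B : BimonadStructure T) (M N : B.Modules) : B.Modules :=
  B.mkModule (M.A ⊗ N.A) (B.T₂ M.A N.A ≫ (act M ⊗ₘ act N))
    (by
      rw [← Category.assoc, B.T₂_η, tensorHom_comp_tensorHom]
      have h1 : B.η.app M.A ≫ act M = 𝟙 _ := M.unit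
      have h2 : B.η.app N.A ≫ act N = 𝟙 _ := N.unit
      erw [h1, h2]
      exact id_tensorHom_id _ _)
    (by
      have h1 : B.μ.app M.A ≫ act M = T.map (act M) ≫ act M := M.assoc
      have h2 : B.μ.app N.A ≫ act N = T.map (act N) ≫ act N := N.assoc
      rw [← Category.assoc, B.T₂_μ, Category.assoc, Category.assoc, tensorHom_comp_tensorHom,
        h1, h2, ← tensorHom_comp_tensorHom, ← Category.assoc (B.T₂ _ _), ← B.T₂_natural]
      simp only [Functor.map_comp, Category.assoc])

/-- The unit module `(𝟙, T₀)`. -/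
@[simps!]
def unitModule (B : BimonadStructure T) : B.Modules :=
  B.mkModule (𝟙_ C) B.T₀ B.T₀_η B.T₀_μ

/-- A morphism of modules from a `T`-linear morphism. -/
@[simps]
def mkHom {B : BimonadStructure T} {M N : B.Modules} (f : M.A ⟶ N.A)
    (h : T.map f ≫ act N = act M ≫ f) : M ⟶ N where
  f := f
  h := h

/-- An isomorphism of modules from a `T`-linear isomorphism. -/
def mkIso {B : BimonadStructure T} {M N : B.Modules} (f : M.A ≅ N.A)
    (h : T.map f.hom ≫ act N = act M ≫ f.hom) : M ≅ N :=
  Monad.Algebra.isoMk f h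

lemma linear {B : BimonadStructure T} {M N : B.Modules} (f : M ⟶ N) :
    T.map f.f ≫ act N = act M ≫ f.f := f.h

/-- The tensor product of `T`-linear morphisms. -/
def tensorModuleHom (B : BimonadStructure T) {M M' N N' : B.Modules} (f : M ⟶ M') (g : N ⟶ N') :
    B.tensorModule M N ⟶ B.tensorModule M' N' :=
  mkHom (f.f ⊗ₘ g.f) (by
    change T.map (f.f ⊗ₘ g.f) ≫ B.T₂ _ _ ≫ (act M' ⊗ₘ act N') =
      (B.T₂ _ _ ≫ (act M ⊗ₘ act N)) ≫ (f.f ⊗ₘ g.f)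
    rw [← Category.assoc, B.T₂_natural, Category.assoc, Category.assoc, tensorHom_comp_tensorHom,
      tensorHom_comp_tensorHom, linear f, linear g])

/-- The monoidal structure on the category of modules for which the forgetful functor is strict. -/
instance (B : BimonadStructure T) : MonoidalCategoryStruct B.Modules where
  tensorObj := B.tensorModule
  tensorUnit := B.unitModule
  tensorHom f g := B.tensorModuleHom f g
  whiskerLeft M _ _ f := B.tensorModuleHom (𝟙 M) f
  whiskerRight f M := B.tensorModuleHom f (𝟙 M)
  associator M N P := mkIso (α_ M.A N.A P.A) (by
    change T.map (α_ _ _ _).hom ≫ B.T₂ _ _ ≫ (act M ⊗ₘ (B.T₂ _ _ ≫ (act N ⊗ₘ act P))) =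
      (B.T₂ _ _ ≫ ((B.T₂ _ _ ≫ (act M ⊗ₘ act N)) ⊗ₘ act P)) ≫ (α_ _ _ _).hom
    have h1 : (act M ⊗ₘ (B.T₂ N.A P.A ≫ (act N ⊗ₘ act P))) =
        T.obj M.A ◁ B.T₂ N.A P.A ≫ (act M ⊗ₘ (act N ⊗ₘ act P)) := by
      rw [← id_tensorHom, tensorHom_comp_tensorHom, Category.id_comp]
    have h2 : ((B.T₂ M.A N.A ≫ (act M ⊗ₘ act N)) ⊗ₘ act P) =
        B.T₂ M.A N.A ▷ T.obj P.A ≫ ((act M ⊗ₘ act N) ⊗ₘ act P) := by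
      rw [← tensorHom_id, tensorHom_comp_tensorHom, Category.id_comp]
    have h3 := B.T₂_assoc M.A N.A P.A
    rw [h1, h2, Category.assoc, Category.assoc, associator_naturality]
    rw [← Category.assoc (B.T₂ _ _), ← Category.assoc (T.map _), h3]
    simp only [Category.assoc])
  leftUnitor M := mkIso (λ_ M.A) (by
    change T.map (λ_ _).hom ≫ act M = (B.T₂ _ _ ≫ (B.T₀ ⊗ₘ act M)) ≫ (λ_ _).hom
    rw [← B.T₂_left_unit, MonoidalCategory.tensorHom_def]
    simp only [Category.assoc, leftUnitor_naturality])
  rightUnitor M := mkIso (ρ_ M.A) (by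
    change T.map (ρ_ _).hom ≫ act M = (B.T₂ _ _ ≫ (act M ⊗ₘ B.T₀)) ≫ (ρ_ _).hom
    rw [← B.T₂_right_unit, MonoidalCategory.tensorHom_def']
    simp only [Category.assoc, rightUnitor_naturality])

instance (B : BimonadStructure T) : MonoidalCategory B.Modules :=
  Monoidal.induced B.toMonad.forget
    { μIso := fun M N => Iso.refl (M.A ⊗ N.A)
      εIso := Iso.refl (𝟙_ C)
      whiskerLeft_eq := fun M _ _ f => by
        change 𝟙 M.A ⊗ₘ f.f = 𝟙 _ ≫ M.A ◁ f.f ≫ 𝟙 _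
        simp
      whiskerRight_eq := fun f M => by
        change f.f ⊗ₘ 𝟙 M.A = 𝟙 _ ≫ f.f ▷ M.A ≫ 𝟙 _
        simp
      tensorHom_eq := fun f g => by
        change f.f ⊗ₘ g.f = 𝟙 _ ≫ (f.f ⊗ₘ g.f) ≫ 𝟙 _
        simp
      associator_eq := fun M N P => by
        change (α_ M.A N.A P.A).hom = (𝟙 _ ≫ (𝟙 _ ⊗ₘ 𝟙 _)) ≫ (α_ M.A N.A P.A).hom ≫
          ((𝟙 _ ⊗ₘ 𝟙 _) ≫ 𝟙 _)
        simp
      leftUnitor_eq := fun M => by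
        change (λ_ M.A).hom = (𝟙 _ ≫ (𝟙 _ ⊗ₘ 𝟙 _)) ≫ (λ_ M.A).hom
        simp
      rightUnitor_eq := fun M => by
        change (ρ_ M.A).hom = (𝟙 _ ≫ (𝟙 _ ⊗ₘ 𝟙 _)) ≫ (ρ_ M.A).hom
        simp }

/-- The convolution product `(φ * ψ)_X = μ_X φ_{T(X)} ψ_X` on natural transformations `𝟭 ⟶ T`. -/
def conv (B : BimonadStructure T) (φ ψ : 𝟭 C ⟶ T) : 𝟭 C ⟶ T where
  app X := ψ.app X ≫ φ.app (T.obj X) ≫ B.μ.app X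
  naturality X Y f := by
    have h1 := ψ.naturality f
    have h2 := φ.naturality (T.map f)
    have h3 := B.μ.naturality f
    simp only [Functor.id_map, Functor.comp_map] at h1 h2 h3 ⊢
    rw [← Category.assoc, h1, Category.assoc, ← Category.assoc (T.map f), h2, Category.assoc, h3]
    simp only [Category.assoc]

/-- An action of the monad `T` on a functor `U : D ⥤ C`: a lift of `U` to `T`-modules. -/
structure ActionOn (B : BimonadStructure T) {D : Type*} [Category* D] (U : D ⥤ C) where
  act : ∀ A : D, T.obj (U.obj A) ⟶ U.obj A
  unit : ∀ A, B.η.app (U.obj A) ≫ act A = 𝟙 (U.obj A)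
  assoc : ∀ A, B.μ.app (U.obj A) ≫ act A = T.map (act A) ≫ act A
  linear : ∀ {A A' : D} (f : A ⟶ A'), T.map (U.map f) ≫ act A' = act A ≫ U.map f

/-- The functor `A ↦ (U(A), act A)` to `T`-modules, strictly commuting with the functors to `C`. -/
def ActionOn.lift {B : BimonadStructure T} {D : Type*} [Category* D] {U : D ⥤ C}
    (ρ : B.ActionOn U) : D ⥤ B.Modules where
  obj A := B.mkModule (U.obj A) (ρ.act A) (ρ.unit A) (ρ.assoc A)
  map f := mkHom (U.map f) (ρ.linear f)
  map_id A := Monad.Algebra.Hom.ext (U.map_id A)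
  map_comp f g := Monad.Algebra.Hom.ext (U.map_comp f g)

end BimonadStructure
end Bimonads

/-! ### Hopf monads, R-matrices and twists -/

section HopfMonads

variable {C : Type u} [Category.{v} C] [MonoidalCategory C] [RigidCategory C]

/-- A Hopf monad structure on an endofunctor `T` of an autonomous category: a bimonad structure
with a left antipode `sl` and a right antipode `sr`. -/
structure HopfMonadStructure (T : C ⥤ C) extends BimonadStructure T where
  sl : ∀ X, T.obj (ldual (T.obj X)) ⟶ ldual X
  sl_natural : ∀ {X Y : C} (f : X ⟶ Y),
    T.map (ldualMap (T.map f)) ≫ sl X = sl Y ≫ ldualMap f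
  sl_ev : ∀ X, T.map (ldualMap (η.app X) ▷ X) ≫ T.map (ev X) ≫ T₀ =
    T₂ (ldual (T.obj X)) X ≫
      ((T.map (ldualMap (μ.app X)) ≫ sl (T.obj X)) ▷ T.obj X) ≫ ev (T.obj X)
  sl_coev : ∀ X, T₀ ≫ coev X ≫ η.app X ▷ ldual X =
    T.map (coev (T.obj X)) ≫ T₂ (T.obj X) (ldual (T.obj X)) ≫ (μ.app X ⊗ₘ sl X)
  sr : ∀ X, T.obj (rdual (T.obj X)) ⟶ rdual X
  sr_natural : ∀ {X Y : C} (f : X ⟶ Y),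
    T.map (rdualMap (T.map f)) ≫ sr X = sr Y ≫ rdualMap f
  sr_ev : ∀ X, T.map (X ◁ rdualMap (η.app X)) ≫ T.map (evr X) ≫ T₀ =
    T₂ X (rdual (T.obj X)) ≫
      (T.obj X ◁ (T.map (rdualMap (μ.app X)) ≫ sr (T.obj X))) ≫ evr (T.obj X)
  sr_coev : ∀ X, T₀ ≫ coevr X ≫ rdual X ◁ η.app X =
    T.map (coevr (T.obj X)) ≫ T₂ (rdual (T.obj X)) (T.obj X) ≫ (sr X ⊗ₘ μ.app X)

/-- A quasitriangular Hopf monad structure on `T`: a Hopf monad structure with an R-matrix. -/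
structure QuasitriangularHopfMonadStructure (T : C ⥤ C) extends HopfMonadStructure T where
  R : ∀ X Y, X ⊗ Y ⟶ T.obj Y ⊗ T.obj X
  R_natural : ∀ {X X' Y Y' : C} (f : X ⟶ X') (g : Y ⟶ Y'),
    (f ⊗ₘ g) ≫ R X' Y' = R X Y ≫ (T.map g ⊗ₘ T.map f)
  R_linear : ∀ X Y, T₂ X Y ≫ R (T.obj X) (T.obj Y) ≫ (μ.app Y ⊗ₘ μ.app X) =
    T.map (R X Y) ≫ T₂ (T.obj Y) (T.obj X) ≫ (μ.app Y ⊗ₘ μ.app X)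
  R_tensor_left : ∀ X Y Z, R (X ⊗ Y) Z ≫ T.obj Z ◁ T₂ X Y =
    (α_ X Y Z).hom ≫ X ◁ R Y Z ≫ (α_ _ _ _).inv ≫ R X (T.obj Z) ▷ T.obj Y ≫
      (α_ _ _ _).hom ≫ μ.app Z ▷ (T.obj X ⊗ T.obj Y)
  R_tensor_right : ∀ X Y Z, R X (Y ⊗ Z) ≫ T₂ Y Z ▷ T.obj X =
    (α_ X Y Z).inv ≫ R X Y ▷ Z ≫ (α_ _ _ _).hom ≫ T.obj Y ◁ R (T.obj X) Z ≫
      (α_ _ _ _).inv ≫ (T.obj Y ⊗ T.obj Z) ◁ μ.app X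

/-- A self-dual twist for a quasitriangular Hopf monad: what makes it a ribbon Hopf monad.
Centrality is the identity `μ_X T(θ_X) = μ_X θ_{T(X)}`, that is, `T`-linearity of the induced
endomorphisms of modules; it implies that `θ` commutes with every element of the convolution
monoid. -/
structure QuasitriangularHopfMonadStructure.SelfDualTwist {T : C ⥤ C}
    (Q : QuasitriangularHopfMonadStructure T) where
  θ : 𝟭 C ⟶ T
  θinv : 𝟭 C ⟶ T
  conv_inv : Q.conv θ θinv = Q.η
  inv_conv : Q.conv θinv θ = Q.η
  central : ∀ X, T.map (θ.app X) ≫ Q.μ.app X = θ.app (T.obj X) ≫ Q.μ.app X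
  twist : ∀ X Y, θ.app (X ⊗ Y) ≫ Q.T₂ X Y =
    Q.R X Y ≫ Q.R (T.obj Y) (T.obj X) ≫
      ((Q.μ.app X ≫ θ.app (T.obj X) ≫ Q.μ.app X) ⊗ₘ (Q.μ.app Y ≫ θ.app (T.obj Y) ≫ Q.μ.app Y))
  selfDual : ∀ X, ldualMap (θ.app X) = θ.app (ldual (T.obj X)) ≫ Q.sl X

end HopfMonads

/-! ### Centralizable endofunctors -/

section Centralizer

variable {C : Type u} [Category.{v} C] [MonoidalCategory C] [RigidCategory C]

/-- The functor `(Y, W) ↦ ∨T(Y) ⊗ X ⊗ W`. -/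
@[simps]
def centralizerDiagram (T : C ⥤ C) (X : C) : Cᵒᵖ ⥤ C ⥤ C where
  obj Y :=
    { obj := fun W => (ldual (T.obj Y.unop) ⊗ X) ⊗ W
      map := fun g => (ldual (T.obj Y.unop) ⊗ X) ◁ g }
  map f :=
    { app := fun W => (ldualMap (T.map f.unop) ▷ X) ▷ W
      naturality := fun _ _ _ => whisker_exchange _ _ }
  map_id Y := by
    ext W
    simp
  map_comp f g := by
    ext W
    simp [comp_rightAdjointMate]

/-- `T` is centralizable: the coends `∫^Y ∨T(Y) ⊗ X ⊗ Y` exist. -/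
def IsCentralizable (T : C ⥤ C) : Prop :=
  ∀ X : C, HasCoend (centralizerDiagram T X)

end Centralizer

/-! ### Fusion categories -/

section Fusion

variable {C : Type u} [Category.{v} C]

/-- A presentation of `X` as a finite direct sum of objects of the family `V`, grouped according
to `i : I`, with multiplicities `N i`. -/
structure Decomposition [Preadditive C] {I : Type w} [Fintype I] (V : I → C) (X : C) where
  N : I → ℕ
  p : ∀ i, Fin (N i) → (X ⟶ V i)
  q : ∀ i, Fin (N i) → (V i ⟶ X)
  q_p_same : ∀ i α β, q i α ≫ p i β = if α = β then 𝟙 (V i) else 0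
  q_p_ne : ∀ i j α β, i ≠ j → q i α ≫ p j β = 0
  total : ∑ i, ∑ α, p i α ≫ q i α = 𝟙 X

/-- A fusion category over `k`: a `k`-linear autonomous category with finite direct sums and a
finite family `V` of objects such that `Hom(V i, V j)` is `k` for `i = j` and `0` otherwise, every
object is a finite direct sum of objects of `V`, and the unit is isomorphic to a member of `V`. -/
structure FusionStructure (k : Type*) [CommRing k] (C : Type u) [Category.{v} C] [Preadditive C]
    [Linear k C] [HasFiniteBiproducts C] [MonoidalCategory C] [MonoidalPreadditive C]
    [MonoidalLinear k C] [RigidCategory C] (I : Type w) [Fintype I] where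
  V : I → C
  end_eq : ∀ i, Function.Bijective (fun r : k => (r • 𝟙 (V i) : V i ⟶ V i))
  hom_eq_zero : ∀ i j, i ≠ j → ∀ f : V i ⟶ V j, f = 0
  exists_decomposition : ∀ X : C, Nonempty (Decomposition V X)
  exists_unit : ∃ i, Nonempty (𝟙_ C ≅ V i)

variable [Preadditive C] [HasFiniteBiproducts C] [MonoidalCategory C] [RigidCategory C]
  {I : Type w} [Fintype I]

/-- The endofunctor `Z(X) = ⨁ i, ∨V i ⊗ X ⊗ V i`. -/
def centralizer (V : I → C) : C ⥤ C where
  obj X := ⨁ fun i => (ldual (V i) ⊗ X) ⊗ V i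
  map f := biproduct.map fun i => (ldual (V i) ◁ f) ▷ V i
  map_id X := by
    ext i
    simp
  map_comp f g := by
    ext i
    simp

/-- The inclusion of the `i`-th summand of `Z(X)`. -/
def incl (V : I → C) (i : I) (X : C) : (ldual (V i) ⊗ X) ⊗ V i ⟶ (centralizer V).obj X :=
  biproduct.ι (fun i => (ldual (V i) ⊗ X) ⊗ V i) i

/-- The morphism `∑ ∨q ⊗ id_X ⊗ p : ∨Y ⊗ X ⊗ Y ⟶ Z(X)` attached to a decomposition of `Y`. -/
def dinat {V : I → C} {Y : C} (D : Decomposition V Y) (X : C) :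
    (ldual Y ⊗ X) ⊗ Y ⟶ (centralizer V).obj X :=
  ∑ i, ∑ α, ((ldualMap (D.q i α) ⊗ₘ 𝟙 X) ⊗ₘ D.p i α) ≫ incl V i X

/-- For `W : C`, the contraction `∨∨W ⊗ ∨(∨W ⊗ X ⊗ W) ⊗ ∨W = ∨∨W ⊗ ∨W ⊗ ∨X ⊗ ∨∨W ⊗ ∨W ⟶ ∨X`. -/
def contractLeft (W X : C) :
    (ldual (ldual W) ⊗ ldual ((ldual W ⊗ X) ⊗ W)) ⊗ ldual W ⟶ ldual X :=
  (ldual (ldual W) ◁ ((ldualTensorIso (ldual W ⊗ X) W).hom ≫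
      ldual W ◁ (ldualTensorIso (ldual W) X).hom)) ▷ ldual W ⊗≫
    ev (ldual W) ▷ ldual X ▷ (ldual (ldual W) ⊗ ldual W) ⊗≫
    ldual X ◁ ev (ldual W) ⊗≫ 𝟙 (ldual X)

/-- For `W : C`, the contraction `∨(W∨) ⊗ (∨W ⊗ X ⊗ W)∨ ⊗ W∨ = ∨(W∨) ⊗ W∨ ⊗ X∨ ⊗ W ⊗ W∨ ⟶ X∨`. -/
def contractRight (W X : C) :
    (ldual (rdual W) ⊗ rdual ((ldual W ⊗ X) ⊗ W)) ⊗ rdual W ⟶ rdual X :=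
  (ldual (rdual W) ◁ ((rdualTensorIso (ldual W ⊗ X) W).hom ≫
      rdual W ◁ ((rdualTensorIso (ldual W) X).hom ≫
        rdual X ◁ (rdualLdualIso W).hom))) ▷ rdual W ⊗≫
    ev (rdual W) ▷ rdual X ▷ (W ⊗ rdual W) ⊗≫
    rdual X ◁ evr W ⊗≫ 𝟙 (rdual X)

/-- The explicit formulas for the structural morphisms of the quasitriangular Hopf monad `Z`, for
a choice `D` of decompositions of the objects of `C`. The morphisms out of a finite direct sum are
given by their restrictions to the summands. -/
structure HasCentralizerFormulas (V : I → C)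
    (Q : QuasitriangularHopfMonadStructure (centralizer V)) (D : ∀ Y : C, Decomposition V Y) :
    Prop where
  T₂_eq : ∀ i X Y, incl V i (X ⊗ Y) ≫ Q.T₂ X Y =
    𝟙 ((ldual (V i) ⊗ (X ⊗ Y)) ⊗ V i) ⊗≫ (ldual (V i) ⊗ X) ◁ coev (V i) ▷ (Y ⊗ V i) ⊗≫
      (incl V i X ⊗ₘ incl V i Y)
  T₀_eq : ∀ i, incl V i (𝟙_ C) ≫ Q.T₀ = (ρ_ (ldual (V i))).hom ▷ V i ≫ ev (V i)
  μ_eq : ∀ i j X,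
    (ldual (V j) ◁ incl V i X) ▷ V j ≫ incl V j ((centralizer V).obj X) ≫ Q.μ.app X =
      𝟙 ((ldual (V j) ⊗ ((ldual (V i) ⊗ X) ⊗ V i)) ⊗ V j) ⊗≫
        ((ldualTensorIso (V i) (V j)).inv ▷ X) ▷ (V i ⊗ V j) ≫ dinat (D (V i ⊗ V j)) X
  η_eq : ∀ X, Q.η.app X =
    (λ_ X).inv ≫ toLdualUnit C ▷ X ≫ (ρ_ (ldual (𝟙_ C) ⊗ X)).inv ≫ dinat (D (𝟙_ C)) X
  sl_eq : ∀ i X,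
    dinat (D (ldual (V i))) (ldual ((centralizer V).obj X)) ≫ Q.sl X =
      (ldual (ldual (V i)) ◁ ldualMap (incl V i X)) ▷ ldual (V i) ≫ contractLeft (V i) X
  sr_eq : ∀ i X,
    dinat (D (rdual (V i))) (rdual ((centralizer V).obj X)) ≫ Q.sr X =
      (ldual (rdual (V i)) ◁ rdualMap (incl V i X)) ▷ rdual (V i) ≫ contractRight (V i) X
  R_eq : ∀ X Y, Q.R X Y =
    (λ_ (X ⊗ Y)).inv ≫ coev Y ▷ (X ⊗ Y) ⊗≫ Y ◁ dinat (D Y) X ≫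
      Q.η.app Y ▷ (centralizer V).obj X

end Fusion

end
end FusionCenter

namespace FusionCenter

noncomputable section

/-! ### Calculus of left duals -/

section DualCalculus

variable {C : Type u} [Category.{v} C] [MonoidalCategory C] [RigidCategory C]

/-! The functor `Z` underlies the left adjoint of the forgetful functor from the center. By duality
a dinatural family `∨Y ⊗ X ⊗ Y ⟶ A` is the same thing as a natural family `X ⊗ Y ⟶ Y ⊗ A`, so the
coend `Z(X)` carries a universal natural family `h_Y : X ⊗ Y ⟶ Y ⊗ Z(X)`. Factoring `h_{Y ⊗ W}`
through `h_Y` gives a half-braiding on `Z(X)`, and `Z(X)` with it is the free object of the center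
on `X` (`UniversalFamily.freeCenter`). The direct sum over the `V i` is this coend because morphisms
among the `V i` are scalars or zero (`incl_comm`) and every `Y` decomposes into them (`comp_dinat`).

The Hopf monad is then formal. A morphism of the center out of a free object is determined by its
composite with the unit (`FreeCenter.ext_f`), and this proves all the axioms. The antipode axioms
say that evaluations and coevaluations of free objects are morphisms of the center, which is
autonomous because half-braidings pass to duals. The R-matrix axioms encode the braiding and its
hexagons. A half-braiding is recovered from its action by `unit_braiding_act`, whence the strict
isomorphism with modules. The explicit formulas come from transposing the half-braiding of a free
object through the duality (the lemmas on `FreeCenter.univ`).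

For the ribbon part, `φ` lifts to the center (`φ_halfBraiding`). In any braided sovereign category
the left partial trace of the self-braiding is natural, invertible and compatible with tensor
products, and it is self-dual once it equals the right partial trace (`twist_selfDual`). Sphericity
of `C` yields this equality: the two partial traces of a half-braiding have the same trace against
every endomorphism (`IsSpherical.trl_halfTwist_eq`), and the trace form is nondegenerate
(`ext_of_trl`, `unit_hom_ext`). -/

lemma coev_ev (X : C) : ldual X ◁ coev X ⊗≫ ev X ▷ ldual X = ⊗𝟙.hom :=
  ExactPairing.coevaluation_evaluation'' X (ldual X)

lemma ev_coev (X : C) : coev X ▷ X ⊗≫ X ◁ ev X = ⊗𝟙.hom :=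
  ExactPairing.evaluation_coevaluation'' X (ldual X)

lemma coevr_evr (X : C) : X ◁ coevr X ⊗≫ evr X ▷ X = ⊗𝟙.hom :=
  ExactPairing.coevaluation_evaluation'' (rdual X) X

lemma evr_coevr (X : C) : coevr X ▷ rdual X ⊗≫ rdual X ◁ evr X = ⊗𝟙.hom :=
  ExactPairing.evaluation_coevaluation'' (rdual X) X

lemma coev_ldualMap {X Y : C} (f : X ⟶ Y) : coev Y ≫ Y ◁ ldualMap f = coev X ≫ f ▷ ldual X :=
  coevaluation_comp_rightAdjointMate f

lemma ldualMap_ev {X Y : C} (f : X ⟶ Y) : ldualMap f ▷ X ≫ ev X = ldual Y ◁ f ≫ ev Y :=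
  rightAdjointMate_comp_evaluation f

lemma rdualMap_evr {X Y : C} (f : X ⟶ Y) : X ◁ rdualMap f ≫ evr X = f ▷ rdual Y ≫ evr Y :=
  leftAdjointMate_comp_evaluation f

lemma coevr_rdualMap {X Y : C} (f : X ⟶ Y) : coevr Y ≫ rdualMap f ▷ Y = coevr X ≫ rdual X ◁ f :=
  coevaluation_comp_leftAdjointMate f

lemma ldualMap_comp {X Y W : C} (f : X ⟶ Y) (g : Y ⟶ W) :
    ldualMap (f ≫ g) = ldualMap g ≫ ldualMap f := comp_rightAdjointMate

lemma ldualMap_id (X : C) : ldualMap (𝟙 X) = 𝟙 _ := rightAdjointMate_id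

lemma rdualMap_comp {X Y W : C} (f : X ⟶ Y) (g : Y ⟶ W) :
    rdualMap (f ≫ g) = rdualMap g ≫ rdualMap f := comp_leftAdjointMate

lemma rdualMap_id (X : C) : rdualMap (𝟙 X) = 𝟙 _ := leftAdjointMate_id

/-- The canonical isomorphism is the mate of the identity between two left duals of `X ⊗ Y`, so it
carries the chosen coevaluation to the nested one. -/
lemma coev_ldualTensorIso (X Y : C) : coev (X ⊗ Y) ≫ (X ⊗ Y) ◁ (ldualTensorIso X Y).hom =
    coev X ⊗≫ (X ◁ coev Y) ▷ ldual X ⊗≫ 𝟙 _ := by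
  have h := @coevaluation_comp_rightAdjointMate C _ _ (X ⊗ Y) (X ⊗ Y)
    ⟨ldual Y ⊗ ldual X⟩ (RightRigidCategory.rightDual (X ⊗ Y)) (𝟙 _)
  rw [id_whiskerRight, Category.comp_id] at h
  exact h

lemma ldualTensorIso_ev (X Y : C) : (ldualTensorIso X Y).hom ▷ (X ⊗ Y) ⊗≫
    ldual Y ◁ (ev X ▷ Y) ⊗≫ ev Y = ev (X ⊗ Y) := by
  have h := @rightAdjointMate_comp_evaluation C _ _ (X ⊗ Y) (X ⊗ Y)
    ⟨ldual Y ⊗ ldual X⟩ (RightRigidCategory.rightDual (X ⊗ Y)) (𝟙 _)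
  rw [whiskerLeft_id, Category.id_comp] at h
  refine Eq.trans ?_ h
  simp only [ExactPairing.tensor_evaluation]
  change _ = (ldualTensorIso X Y).hom ▷ (X ⊗ Y) ≫ _
  monoidal

/-- A morphism out of `∨X` is determined by its composite with the coevaluation. -/
lemma coev_injective {A X : C} {f g : ldual X ⟶ A} (h : coev X ≫ X ◁ f = coev X ≫ X ◁ g) :
    f = g := by
  -- The zigzag identity rebuilds `f` from its composite with `coev X`; the other extensionality
  -- lemmas for duals follow the same pattern.
  have key : ∀ f : ldual X ⟶ A, f = 𝟙 _ ⊗≫ ldual X ◁ (coev X ≫ X ◁ f) ⊗≫ ev X ▷ A ⊗≫ 𝟙 _ := by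
    intro f
    symm
    calc _ = 𝟙 _ ⊗≫ ldual X ◁ coev X ⊗≫ ((ldual X ⊗ X) ◁ f ≫ ev X ▷ A) ⊗≫ 𝟙 _ := by monoidal
      _ = 𝟙 _ ⊗≫ (ldual X ◁ coev X ⊗≫ ev X ▷ ldual X) ⊗≫ f ⊗≫ 𝟙 _ := by
        rw [whisker_exchange]; monoidal
      _ = _ := by rw [coev_ev]; monoidal
  rw [key f, h, ← key g]

/-- A morphism into `∨X` is determined by its pairing with `X`. -/
lemma ldual_hom_ext {A X : C} {f g : A ⟶ ldual X} (h : f ▷ X ≫ ev X = g ▷ X ≫ ev X) : f = g := by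
  have key : ∀ f : A ⟶ ldual X, f = 𝟙 _ ⊗≫ A ◁ coev X ⊗≫ (f ▷ X ≫ ev X) ▷ ldual X ⊗≫ 𝟙 _ := by
    intro f
    symm
    calc _ = 𝟙 _ ⊗≫ (A ◁ coev X ≫ f ▷ (X ⊗ ldual X)) ⊗≫ ev X ▷ ldual X ⊗≫ 𝟙 _ := by monoidal
      _ = f ⊗≫ (ldual X ◁ coev X ⊗≫ ev X ▷ ldual X) ⊗≫ 𝟙 _ := by
        rw [whisker_exchange]; monoidal
      _ = _ := by rw [coev_ev]; monoidal
  rw [key f, h, ← key g]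

/-- A morphism into `X∨` is determined by its pairing with `X`. -/
lemma rdual_hom_ext {A X : C} {f g : A ⟶ rdual X} (h : X ◁ f ≫ evr X = X ◁ g ≫ evr X) :
    f = g := by
  have key : ∀ f : A ⟶ rdual X,
      f = 𝟙 _ ⊗≫ coevr X ▷ A ⊗≫ rdual X ◁ (X ◁ f ≫ evr X) ⊗≫ 𝟙 _ := by
    intro f
    symm
    calc _ = 𝟙 _ ⊗≫ (coevr X ▷ A ≫ (rdual X ⊗ X) ◁ f) ⊗≫ rdual X ◁ evr X ⊗≫ 𝟙 _ := by monoidal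
      _ = f ⊗≫ (coevr X ▷ rdual X ⊗≫ rdual X ◁ evr X) ⊗≫ 𝟙 _ := by
        rw [← whisker_exchange]; monoidal
      _ = _ := by rw [evr_coevr]; monoidal
  rw [key f, h, ← key g]

end DualCalculus

/-! ### Calculus in sovereign categories -/

section SovereignCalculus

variable {C : Type u} [Category.{v} C] [MonoidalCategory C] [RigidCategory C]

namespace SovereignStructure

variable (S : SovereignStructure C)

/-- Sliding `φ` past the cup leaves the zigzag identity for `∨X` and `∨∨X`, conjugated by `φ`.
Together with `ev'_coev'` this makes `∨X` a right dual of `X` as well. -/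
lemma coev'_ev' (X : C) : X ◁ S.coev' X ⊗≫ S.ev' X ▷ X = ⊗𝟙.hom := by
  calc _ = 𝟙 _ ⊗≫ X ◁ coev (ldual X) ⊗≫ (X ⊗ ldual X) ◁ (S.φ X).inv ⊗≫
        ((S.φ X).hom ▷ ldual X ≫ ev (ldual X)) ▷ X ⊗≫ 𝟙 _ := by
        simp only [coev', ev']; monoidal
    _ = 𝟙 _ ⊗≫ X ◁ coev (ldual X) ⊗≫ ((X ⊗ ldual X) ◁ (S.φ X).inv ≫
        ((S.φ X).hom ▷ ldual X ≫ ev (ldual X)) ▷ X) ⊗≫ 𝟙 _ := by monoidal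
    _ = 𝟙 _ ⊗≫ (X ◁ coev (ldual X) ≫ (S.φ X).hom ▷ (ldual X ⊗ ldual (ldual X))) ⊗≫
        ev (ldual X) ▷ ldual (ldual X) ⊗≫ (S.φ X).inv ⊗≫ 𝟙 _ := by
        rw [whisker_exchange]; monoidal
    _ = 𝟙 _ ⊗≫ (S.φ X).hom ⊗≫ (ldual (ldual X) ◁ coev (ldual X) ⊗≫
        ev (ldual X) ▷ ldual (ldual X)) ⊗≫ (S.φ X).inv ⊗≫ 𝟙 _ := by
        rw [whisker_exchange]; monoidal
    _ = 𝟙 _ ⊗≫ ((S.φ X).hom ≫ (S.φ X).inv) ⊗≫ 𝟙 _ := by rw [coev_ev]; monoidal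
    _ = _ := by rw [Iso.hom_inv_id]; monoidal

lemma ev'_coev' (X : C) : S.coev' X ▷ ldual X ⊗≫ ldual X ◁ S.ev' X = ⊗𝟙.hom := by
  calc _ = coev (ldual X) ▷ ldual X ⊗≫ ldual X ◁ ((S.φ X).inv ≫ (S.φ X).hom) ▷ ldual X ⊗≫
        ldual X ◁ ev (ldual X) := by
        simp only [coev', ev']; monoidal
    _ = coev (ldual X) ▷ ldual X ⊗≫ ldual X ◁ ev (ldual X) := by
        rw [Iso.inv_hom_id]; monoidal
    _ = _ := ev_coev _

lemma inv_natural {X Y : C} (f : X ⟶ Y) :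
    ldualMap (ldualMap f) ≫ (S.φ Y).inv = (S.φ X).inv ≫ f := by
  rw [Iso.comp_inv_eq, Category.assoc, S.natural, Iso.inv_hom_id_assoc]

lemma coev'_natural {X Y : C} (f : X ⟶ Y) :
    S.coev' X ≫ ldual X ◁ f = S.coev' Y ≫ ldualMap f ▷ Y := by
  simp only [coev', Category.assoc]
  rw [← MonoidalCategory.whiskerLeft_comp, ← S.inv_natural, MonoidalCategory.whiskerLeft_comp,
    reassoc_of% coev_ldualMap, whisker_exchange]

lemma ev'_natural {X Y : C} (f : X ⟶ Y) :
    X ◁ ldualMap f ≫ S.ev' X = f ▷ ldual Y ≫ S.ev' Y := by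
  simp only [ev']
  rw [← comp_whiskerRight_assoc, S.natural, whisker_exchange_assoc, ← ldualMap_ev,
    comp_whiskerRight_assoc]

lemma inv_tensor (X Y : C) : ldualMap (ldualTensorIso X Y).hom ≫ (S.φ (X ⊗ Y)).inv =
    (ldualTensorIso (ldual Y) (ldual X)).hom ≫ ((S.φ X).inv ⊗ₘ (S.φ Y).inv) := by
  rw [Iso.comp_inv_eq, S.tensor, Category.assoc, ← Category.assoc (_ ⊗ₘ _) (_ ⊗ₘ _),
    tensorHom_comp_tensorHom]
  simp

/-- Monoidality of `φ` turns the cup on `X ⊗ Y` into two nested cups, so that a trace over `X ⊗ Y`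
can be taken one factor at a time. -/
lemma coev'_tensor (X Y : C) : S.coev' (X ⊗ Y) ≫ (ldualTensorIso X Y).hom ▷ (X ⊗ Y) =
    S.coev' Y ⊗≫ ldual Y ◁ S.coev' X ▷ Y ⊗≫ 𝟙 _ := by
  calc _ = (coev (ldual (X ⊗ Y)) ≫ (ldualTensorIso X Y).hom ▷ _) ≫ _ ◁ (S.φ (X ⊗ Y)).inv := by
        simp only [coev', Category.assoc, whisker_exchange]
    _ = coev (ldual Y ⊗ ldual X) ≫ _ ◁ (ldualMap (ldualTensorIso X Y).hom ≫
        (S.φ (X ⊗ Y)).inv) := by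
        rw [← coev_ldualMap]; simp
    _ = coev (ldual Y) ⊗≫ (ldual Y ◁ (coev (ldual X) ≫ ldual X ◁ (S.φ X).inv)) ▷ ldual (ldual Y) ⊗≫
        (ldual Y ⊗ ldual X ⊗ X) ◁ (S.φ Y).inv ⊗≫ 𝟙 _ := by
        rw [inv_tensor, MonoidalCategory.whiskerLeft_comp, reassoc_of% coev_ldualTensorIso,
          MonoidalCategory.tensorHom_def]
        monoidal
    _ = coev (ldual Y) ⊗≫ ((ldual Y ◁ S.coev' X) ▷ ldual (ldual Y) ≫
        (ldual Y ⊗ ldual X ⊗ X) ◁ (S.φ Y).inv) ⊗≫ 𝟙 _ := by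
        simp only [coev']; monoidal
    _ = _ := by rw [← whisker_exchange]; simp only [coev']; monoidal

lemma tensor_ev' (X Y : C) : (X ⊗ Y) ◁ (ldualTensorIso X Y).inv ≫ S.ev' (X ⊗ Y) =
    𝟙 _ ⊗≫ X ◁ S.ev' Y ▷ ldual X ⊗≫ S.ev' X := by
  have h1 : (S.φ (X ⊗ Y)).hom ≫ ldualMap (ldualTensorIso X Y).inv =
      ((S.φ X).hom ⊗ₘ (S.φ Y).hom) ≫ (ldualTensorIso (ldual Y) (ldual X)).inv := by
    rw [S.tensor, Category.assoc, Category.assoc, ← ldualMap_comp, Iso.inv_hom_id, ldualMap_id,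
      Category.comp_id]
  calc _ = ((S.φ (X ⊗ Y)).hom ≫ ldualMap (ldualTensorIso X Y).inv) ▷ _ ≫ ev _ := by
        simp only [ev']
        rw [whisker_exchange_assoc, ← ldualMap_ev, comp_whiskerRight_assoc]
    _ = 𝟙 _ ⊗≫ ((X ◁ (S.φ Y).hom ≫ (S.φ X).hom ▷ _) ▷ (ldual Y ⊗ ldual X)) ⊗≫
        (ldual (ldual X) ◁ ev (ldual Y)) ▷ ldual X ⊗≫ ev (ldual X) := by
        rw [h1, ← ldualTensorIso_ev, MonoidalCategory.tensorHom_def']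
        have : (ldualTensorIso (ldual Y) (ldual X)).inv ▷ (ldual Y ⊗ ldual X) ≫
          (ldualTensorIso (ldual Y) (ldual X)).hom ▷ (ldual Y ⊗ ldual X) = 𝟙 _ := by
          rw [← comp_whiskerRight, Iso.inv_hom_id, id_whiskerRight]
        simp only [comp_whiskerRight, Category.assoc, monoidalComp]
        rw [reassoc_of% this]
        monoidal
    _ = 𝟙 _ ⊗≫ X ◁ (S.φ Y).hom ▷ (ldual Y ⊗ ldual X) ⊗≫
        ((S.φ X).hom ▷ _ ≫ (ldual (ldual X) ◁ ev (ldual Y))) ▷ ldual X ⊗≫ ev (ldual X) := by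
        monoidal
    _ = _ := by rw [← whisker_exchange]; simp only [ev']; monoidal

/-- A morphism is determined by its composite with `coev'`. -/
lemma coev'_injective {X Y : C} {f g : X ⟶ Y}
    (h : S.coev' X ≫ ldual X ◁ f = S.coev' X ≫ ldual X ◁ g) : f = g := by
  have key : ∀ f : X ⟶ Y, f = 𝟙 X ⊗≫ X ◁ (S.coev' X ≫ ldual X ◁ f) ⊗≫ S.ev' X ▷ Y ⊗≫ 𝟙 Y := by
    intro f
    symm
    calc _ = 𝟙 X ⊗≫ X ◁ S.coev' X ⊗≫ ((X ⊗ ldual X) ◁ f ≫ S.ev' X ▷ Y) ⊗≫ 𝟙 Y := by monoidal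
      _ = 𝟙 X ⊗≫ (X ◁ S.coev' X ⊗≫ S.ev' X ▷ X) ⊗≫ f := by rw [whisker_exchange]; monoidal
      _ = _ := by rw [coev'_ev']; monoidal
  rw [key f, h, ← key g]

/-- The exact pairing that makes `∨X` a right dual of `X`. -/
@[reducible]
def exactPairing (X : C) : ExactPairing (ldual X) X where
  coevaluation' := S.coev' X
  evaluation' := S.ev' X
  coevaluation_evaluation' := by
    have h := S.coev'_ev' X
    calc _ = X ◁ S.coev' X ⊗≫ S.ev' X ▷ X := by simp [monoidalComp]
      _ = _ := by rw [h]; monoidal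
  evaluation_coevaluation' := by
    have h := S.ev'_coev' X
    calc _ = S.coev' X ▷ ldual X ⊗≫ ldual X ◁ S.ev' X := by simp [monoidalComp]
      _ = _ := by rw [h]; monoidal

end SovereignStructure
end SovereignCalculus
end
end FusionCenter

namespace FusionCenter

noncomputable section

/-! ### Twists of braided sovereign categories -/

section BraidedSovereign

variable {B : Type u} [Category.{v} B] [MonoidalCategory B] [BraidedCategory B] [RigidCategory B]

namespace SovereignStructure

variable (S : SovereignStructure B)

/-- The left partial trace of the braiding of `X` with itself. -/
def twistHom (X : B) : X ⟶ X :=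
  𝟙 X ⊗≫ S.coev' X ▷ X ⊗≫ ldual X ◁ (β_ X X).hom ⊗≫ ev X ▷ X ⊗≫ 𝟙 X

/-- The right partial trace of the braiding of `X` with itself. -/
def twistHom' (X : B) : X ⟶ X :=
  𝟙 X ⊗≫ X ◁ coev X ⊗≫ (β_ X X).hom ▷ ldual X ⊗≫ X ◁ S.ev' X ⊗≫ 𝟙 X

/-- The right partial trace of the inverse braiding of `X` with itself. -/
def twistInv (X : B) : X ⟶ X :=
  𝟙 X ⊗≫ X ◁ (coev X ≫ (β_ X (ldual X)).hom) ⊗≫ S.ev' X ▷ X ⊗≫ 𝟙 X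

/-- The morphism `f` travels once around the loop: through the crossing, the cup, the cap and the
crossing again. -/
lemma twistHom_natural {X Y : B} (f : X ⟶ Y) : f ≫ S.twistHom Y = S.twistHom X ≫ f := by
  symm
  calc _ = 𝟙 X ⊗≫ S.coev' X ▷ X ⊗≫ ldual X ◁ (β_ X X).hom ⊗≫ (ev X ▷ X ≫ _ ◁ f) ⊗≫ 𝟙 Y := by
        simp only [twistHom]; monoidal
    _ = 𝟙 X ⊗≫ S.coev' X ▷ X ⊗≫ ldual X ◁ ((β_ X X).hom ≫ X ◁ f) ⊗≫ ev X ▷ Y ⊗≫ 𝟙 Y := by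
        rw [← whisker_exchange]; monoidal
    _ = 𝟙 X ⊗≫ (S.coev' X ≫ ldual X ◁ f) ▷ X ⊗≫ ldual X ◁ (β_ Y X).hom ⊗≫ ev X ▷ Y ⊗≫ 𝟙 Y := by
        rw [← BraidedCategory.braiding_naturality_left]; monoidal
    _ = 𝟙 X ⊗≫ S.coev' Y ▷ X ⊗≫ (ldualMap f ▷ (Y ⊗ X) ≫ ldual X ◁ (β_ Y X).hom) ⊗≫
          ev X ▷ Y ⊗≫ 𝟙 Y := by
        rw [coev'_natural]; monoidal
    _ = 𝟙 X ⊗≫ S.coev' Y ▷ X ⊗≫ ldual Y ◁ (β_ Y X).hom ⊗≫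
          (ldualMap f ▷ X ≫ ev X) ▷ Y ⊗≫ 𝟙 Y := by
        rw [← whisker_exchange]; monoidal
    _ = 𝟙 X ⊗≫ S.coev' Y ▷ X ⊗≫ ldual Y ◁ ((β_ Y X).hom ≫ f ▷ Y) ⊗≫ ev Y ▷ Y ⊗≫ 𝟙 Y := by
        rw [ldualMap_ev]; monoidal
    _ = 𝟙 X ⊗≫ (S.coev' Y ▷ X ≫ (ldual Y ⊗ Y) ◁ f) ⊗≫ ldual Y ◁ (β_ Y Y).hom ⊗≫
          ev Y ▷ Y ⊗≫ 𝟙 Y := by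
        rw [← BraidedCategory.braiding_naturality_right]; monoidal
    _ = _ := by rw [← whisker_exchange]; simp only [twistHom]; monoidal

lemma twistInv_natural {X Y : B} (f : X ⟶ Y) : f ≫ S.twistInv Y = S.twistInv X ≫ f := by
  symm
  calc _ = 𝟙 X ⊗≫ X ◁ (coev X ≫ (β_ X (ldual X)).hom) ⊗≫ (S.ev' X ▷ X ≫ _ ◁ f) ⊗≫ 𝟙 Y := by
        simp only [twistInv]; monoidal
    _ = 𝟙 X ⊗≫ X ◁ (coev X ≫ (β_ X (ldual X)).hom ≫ _ ◁ f) ⊗≫ S.ev' X ▷ Y ⊗≫ 𝟙 Y := by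
        rw [← whisker_exchange]; monoidal
    _ = 𝟙 X ⊗≫ X ◁ (coev Y ≫ (β_ Y (ldual Y)).hom ≫ ldualMap f ▷ Y) ⊗≫ S.ev' X ▷ Y ⊗≫ 𝟙 Y := by
        rw [← BraidedCategory.braiding_naturality_left, ← reassoc_of% coev_ldualMap,
          BraidedCategory.braiding_naturality_right]
    _ = 𝟙 X ⊗≫ X ◁ (coev Y ≫ (β_ Y (ldual Y)).hom) ⊗≫ (X ◁ ldualMap f ≫ S.ev' X) ▷ Y ⊗≫ 𝟙 Y := by
        monoidal
    _ = 𝟙 X ⊗≫ (X ◁ (coev Y ≫ (β_ Y (ldual Y)).hom) ≫ f ▷ _) ⊗≫ S.ev' Y ▷ Y ⊗≫ 𝟙 Y := by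
        rw [ev'_natural]; monoidal
    _ = _ := by rw [whisker_exchange]; simp only [twistInv]; monoidal

/-- The crossing inside the twist and the outer one combine into the braiding of `X` with `X ⊗ ∨X`,
which slides off `coev X`; a zigzag remains. -/
lemma coev_twist_braiding (X : B) :
    coev X ≫ S.twistHom X ▷ ldual X ≫ (β_ X (ldual X)).hom = S.coev' X := by
  calc _ = coev X ⊗≫ S.coev' X ▷ (X ⊗ ldual X) ⊗≫ ldual X ◁ (β_ X X).hom ▷ ldual X ⊗≫
        (ev X ▷ (X ⊗ ldual X) ≫ 𝟙_ B ◁ (β_ X (ldual X)).hom) ⊗≫ 𝟙 _ := by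
        simp only [twistHom]; monoidal
    _ = (coev X ⊗≫ S.coev' X ▷ (X ⊗ ldual X)) ⊗≫ ldual X ◁ ((β_ X X).hom ▷ ldual X ⊗≫
        X ◁ (β_ X (ldual X)).hom) ⊗≫ ev X ▷ (ldual X ⊗ X) ⊗≫ 𝟙 _ := by
        rw [← whisker_exchange]; monoidal
    _ = 𝟙 _ ⊗≫ (𝟙_ B ◁ coev X ≫ S.coev' X ▷ (X ⊗ ldual X)) ⊗≫
        ldual X ◁ (β_ X (X ⊗ ldual X)).hom ⊗≫ ev X ▷ (ldual X ⊗ X) ⊗≫ 𝟙 _ := by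
        rw [BraidedCategory.braiding_tensor_right_hom]; monoidal
    _ = S.coev' X ⊗≫ ldual X ◁ (X ◁ coev X ≫ (β_ X (X ⊗ ldual X)).hom) ⊗≫
        ev X ▷ (ldual X ⊗ X) ⊗≫ 𝟙 _ := by
        rw [whisker_exchange]; monoidal
    _ = S.coev' X ⊗≫ (ldual X ◁ coev X ⊗≫ ev X ▷ ldual X) ▷ X ⊗≫ 𝟙 _ := by
        rw [BraidedCategory.braiding_naturality_right, braiding_tensorUnit_right]; monoidal
    _ = _ := by rw [coev_ev]; monoidal

lemma coev'_twistInv (X : B) :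
    S.coev' X ≫ ldual X ◁ S.twistInv X = coev X ≫ (β_ X (ldual X)).hom := by
  calc _ = 𝟙 _ ⊗≫ (S.coev' X ▷ 𝟙_ B ≫ (ldual X ⊗ X) ◁ (coev X ≫ (β_ X (ldual X)).hom)) ⊗≫
        ldual X ◁ S.ev' X ▷ X ⊗≫ 𝟙 _ := by simp only [twistInv]; monoidal
    _ = (coev X ≫ (β_ X (ldual X)).hom) ⊗≫ (S.coev' X ▷ ldual X ⊗≫ ldual X ◁ S.ev' X) ▷ X ⊗≫
        𝟙 _ := by rw [← whisker_exchange]; monoidal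
    _ = _ := by rw [ev'_coev']; monoidal

/-- Both sides are tested against `coev'`: the inverse twist produces `coev` followed by a crossing,
and `coev_twist_braiding` undoes this. -/
lemma twistInv_twistHom (X : B) : S.twistInv X ≫ S.twistHom X = 𝟙 X := by
  apply S.coev'_injective
  rw [MonoidalCategory.whiskerLeft_comp, reassoc_of% S.coev'_twistInv X,
    ← BraidedCategory.braiding_naturality_left, coev_twist_braiding]
  simp

lemma twistHom_twistInv (X : B) : S.twistHom X ≫ S.twistInv X = 𝟙 X := by
  -- Naturality of the inverse twist with respect to the twist itself makes the two commute.
  rw [S.twistInv_natural, twistInv_twistHom]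

/-- The trace over `X ⊗ Y` is two nested loops around four crossings. The inner loop closes to a
twist of `X`, which slides out; a Yang–Baxter move then frees the loop of `Y`. -/
lemma twistHom_tensor_aux (X Y : B) :
    S.twistHom (X ⊗ Y) = S.twistHom X ▷ Y ≫ (β_ X Y).hom ≫ S.twistHom Y ▷ X ≫ (β_ Y X).hom := by
  have hc : (β_ (X ⊗ Y) (X ⊗ Y)).hom = 𝟙 _ ⊗≫ X ◁ (β_ Y X).hom ▷ Y ⊗≫ (X ⊗ X) ◁ (β_ Y Y).hom ⊗≫
      (β_ X X).hom ▷ (Y ⊗ Y) ⊗≫ X ◁ (β_ X Y).hom ▷ Y ⊗≫ 𝟙 _ := by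
    rw [BraidedCategory.braiding_tensor_left_hom, BraidedCategory.braiding_tensor_right_hom,
      BraidedCategory.braiding_tensor_right_hom]
    monoidal
  have hy : (β_ Y X).hom ▷ Y ⊗≫ X ◁ (β_ Y Y).hom ⊗≫ (β_ X Y).hom ▷ Y ⊗≫ 𝟙 (Y ⊗ X ⊗ Y) =
      𝟙 _ ⊗≫ Y ◁ (β_ X Y).hom ⊗≫ (β_ Y Y).hom ▷ X ⊗≫ Y ◁ (β_ Y X).hom ⊗≫ 𝟙 (Y ⊗ X ⊗ Y) := by
    have h := BraidedCategory.yang_baxter Y X Y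
    calc _ = (α_ Y X Y).hom ≫ ((α_ Y X Y).inv ≫ (β_ Y X).hom ▷ Y ≫ (α_ X Y Y).hom ≫
          X ◁ (β_ Y Y).hom ≫ (α_ X Y Y).inv ≫ (β_ X Y).hom ▷ Y ≫ (α_ Y X Y).hom) := by monoidal
      _ = _ := by rw [h]; monoidal
  calc _ = 𝟙 _ ⊗≫ S.coev' (X ⊗ Y) ▷ (X ⊗ Y) ⊗≫ (ldual (X ⊗ Y) ◁ (β_ (X ⊗ Y) (X ⊗ Y)).hom ≫
        (ldualTensorIso X Y).hom ▷ ((X ⊗ Y) ⊗ (X ⊗ Y))) ⊗≫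
        (ldual Y ◁ (ev X ▷ Y)) ▷ (X ⊗ Y) ⊗≫ ev Y ▷ (X ⊗ Y) ⊗≫ 𝟙 _ := by
        simp only [twistHom, ← ldualTensorIso_ev]; monoidal
    _ = 𝟙 _ ⊗≫ (S.coev' (X ⊗ Y) ≫ (ldualTensorIso X Y).hom ▷ (X ⊗ Y)) ▷ (X ⊗ Y) ⊗≫
        (ldual Y ⊗ ldual X) ◁ (β_ (X ⊗ Y) (X ⊗ Y)).hom ⊗≫
        (ldual Y ◁ (ev X ▷ Y)) ▷ (X ⊗ Y) ⊗≫ ev Y ▷ (X ⊗ Y) ⊗≫ 𝟙 _ := by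
        rw [whisker_exchange]; monoidal
    _ = 𝟙 _ ⊗≫ S.coev' Y ▷ (X ⊗ Y) ⊗≫
        ldual Y ◁ (S.coev' X ▷ (Y ⊗ X) ≫ (ldual X ⊗ X) ◁ (β_ Y X).hom) ▷ Y ⊗≫
        (ldual Y ⊗ ldual X) ◁ ((X ⊗ X) ◁ (β_ Y Y).hom ≫ (β_ X X).hom ▷ (Y ⊗ Y)) ⊗≫
        ldual Y ◁ ((ldual X ⊗ X) ◁ (β_ X Y).hom ≫ ev X ▷ (Y ⊗ X)) ▷ Y ⊗≫
        ev Y ▷ (X ⊗ Y) ⊗≫ 𝟙 _ := by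
        rw [coev'_tensor, hc]; monoidal
    _ = 𝟙 _ ⊗≫ S.coev' Y ▷ (X ⊗ Y) ⊗≫
        ldual Y ◁ (β_ Y X).hom ▷ Y ⊗≫ ldual Y ◁ S.coev' X ▷ (X ⊗ Y ⊗ Y) ⊗≫
        (ldual Y ⊗ ldual X) ◁ (β_ X X).hom ▷ (Y ⊗ Y) ⊗≫
        ldual Y ◁ ((ldual X ⊗ X) ◁ (X ◁ (β_ Y Y).hom) ≫ ev X ▷ (X ⊗ Y ⊗ Y)) ⊗≫
        ldual Y ◁ (β_ X Y).hom ▷ Y ⊗≫ ev Y ▷ (X ⊗ Y) ⊗≫ 𝟙 _ := by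
        rw [← whisker_exchange, whisker_exchange (β_ X X).hom,
          whisker_exchange (ev X) (β_ X Y).hom]; monoidal
    -- The crossings that do not involve the inner strand have been pulled out, so what is left of
    -- the loop of `X` is exactly `twistHom X`.
    _ = 𝟙 _ ⊗≫ S.coev' Y ▷ (X ⊗ Y) ⊗≫
        ldual Y ◁ ((β_ Y X).hom ≫ S.twistHom X ▷ Y) ▷ Y ⊗≫
        (ldual Y ⊗ X) ◁ (β_ Y Y).hom ⊗≫
        ldual Y ◁ (β_ X Y).hom ▷ Y ⊗≫ ev Y ▷ (X ⊗ Y) ⊗≫ 𝟙 _ := by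
        rw [whisker_exchange]; simp only [twistHom]; monoidal
    _ = 𝟙 _ ⊗≫ (S.coev' Y ▷ X ≫ (ldual Y ⊗ Y) ◁ S.twistHom X) ▷ Y ⊗≫ ldual Y ◁
        ((β_ Y X).hom ▷ Y ⊗≫ X ◁ (β_ Y Y).hom ⊗≫ (β_ X Y).hom ▷ Y ⊗≫ 𝟙 (Y ⊗ X ⊗ Y)) ⊗≫
        ev Y ▷ (X ⊗ Y) ⊗≫ 𝟙 _ := by
        rw [← BraidedCategory.braiding_naturality_right]; monoidal
    _ = 𝟙 _ ⊗≫ (S.coev' Y ▷ X ≫ (ldual Y ⊗ Y) ◁ S.twistHom X) ▷ Y ⊗≫ ldual Y ◁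
        (𝟙 _ ⊗≫ Y ◁ (β_ X Y).hom ⊗≫ (β_ Y Y).hom ▷ X ⊗≫ Y ◁ (β_ Y X).hom ⊗≫ 𝟙 (Y ⊗ X ⊗ Y)) ⊗≫
        ev Y ▷ (X ⊗ Y) ⊗≫ 𝟙 _ := by
        rw [hy]
    _ = 𝟙 _ ⊗≫ S.twistHom X ▷ Y ⊗≫ (S.coev' Y ▷ (X ⊗ Y) ≫ (ldual Y ⊗ Y) ◁ (β_ X Y).hom) ⊗≫
        ldual Y ◁ (β_ Y Y).hom ▷ X ⊗≫ ((ldual Y ⊗ Y) ◁ (β_ Y X).hom ≫ 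
        ev Y ▷ (X ⊗ Y)) ⊗≫ 𝟙 _ := by
        rw [← whisker_exchange]; monoidal
    _ = _ := by
        rw [← whisker_exchange, whisker_exchange (ev Y)]; simp only [twistHom]; monoidal

lemma twistHom_tensor (X Y : B) : S.twistHom (X ⊗ Y) =
    (β_ X Y).hom ≫ (β_ Y X).hom ≫ (S.twistHom X ⊗ₘ S.twistHom Y) := by
  rw [twistHom_tensor_aux, BraidedCategory.braiding_naturality_left,
    BraidedCategory.braiding_naturality_left_assoc, 
    BraidedCategory.braiding_naturality_right_assoc, MonoidalCategory.tensorHom_def]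

/-- Braidings with the unit are trivial, so the tensor formula makes the twist of the unit
idempotent; being invertible, it is the identity. -/
lemma twistHom_unit : S.twistHom (𝟙_ B) = 𝟙 _ := by
  have h := S.twistHom_tensor (𝟙_ B) (𝟙_ B)
  have h2 := S.twistHom_natural (λ_ (𝟙_ B)).hom
  have h3 : S.twistHom (𝟙_ B) ≫ S.twistHom (𝟙_ B) = S.twistHom (𝟙_ B) := by
    rw [← cancel_epi (λ_ (𝟙_ B)).hom, h2, h, MonoidalCategory.tensorHom_def]
    simp [braiding_tensorUnit_right, ← unitors_equal, ← unitors_inv_equal]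
  calc _ = S.twistHom (𝟙_ B) ≫ S.twistHom (𝟙_ B) ≫ S.twistInv (𝟙_ B) := by
        rw [twistHom_twistInv, Category.comp_id]
    _ = _ := by rw [← Category.assoc, h3, twistHom_twistInv]

/-- Naturality of the braiding at the cap: pulling a strand across one leg is the inverse of pulling
it across the other. -/
lemma braiding_ev' (X Y : B) : (β_ X Y).hom ▷ ldual X ⊗≫ Y ◁ S.ev' X =
    𝟙 _ ⊗≫ X ◁ (β_ (ldual X) Y).inv ⊗≫ S.ev' X ▷ Y ⊗≫ 𝟙 _ := by
  have h := BraidedCategory.braiding_naturality_left (S.ev' X) Y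
  calc _ = 𝟙 _ ⊗≫ X ◁ ((β_ (ldual X) Y).inv ≫ (β_ (ldual X) Y).hom) ⊗≫
        (β_ X Y).hom ▷ ldual X ⊗≫ Y ◁ S.ev' X := by rw [Iso.inv_hom_id]; monoidal
    _ = 𝟙 _ ⊗≫ X ◁ (β_ (ldual X) Y).inv ⊗≫ ((β_ (X ⊗ ldual X) Y).hom ≫ Y ◁ S.ev' X) := by
        rw [BraidedCategory.braiding_tensor_left_hom]; monoidal
    _ = _ := by rw [← h, braiding_tensorUnit_left]; monoidal

lemma braiding_ev (X Y : B) : ldual X ◁ (β_ Y X).hom ⊗≫ ev X ▷ Y =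
    𝟙 _ ⊗≫ (β_ Y (ldual X)).inv ▷ X ⊗≫ Y ◁ ev X ⊗≫ 𝟙 _ := by
  have h := BraidedCategory.braiding_naturality_right Y (ev X)
  calc _ = 𝟙 _ ⊗≫ ((β_ Y (ldual X)).inv ≫ (β_ Y (ldual X)).hom) ▷ X ⊗≫
        ldual X ◁ (β_ Y X).hom ⊗≫ ev X ▷ Y := by rw [Iso.inv_hom_id]; monoidal
    _ = 𝟙 _ ⊗≫ (β_ Y (ldual X)).inv ▷ X ⊗≫ ((β_ Y (ldual X ⊗ X)).hom ≫ ev X ▷ Y) := by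
        rw [BraidedCategory.braiding_tensor_right_hom]; monoidal
    _ = _ := by rw [← h, braiding_tensorUnit_right]; monoidal

/-- Composing the duality with the braiding gives another exact pairing, in the opposite order
(`BraidedCategory.exactPairing_swap`); its zigzag identity straightens the loop. -/
lemma twistHom'_braiding_ev (X : B) :
    S.twistHom' X ▷ ldual X ≫ (β_ X (ldual X)).hom ≫ ev X = S.ev' X := by
  have h := @ExactPairing.evaluation_coevaluation'' B _ _ (ldual X) X
    (BraidedCategory.exactPairing_swap X (ldual X))
  change (coev X ≫ (β_ (ldual X) X).inv) ▷ _ ⊗≫ _ ◁ ((β_ X (ldual X)).hom ≫ ev X) = _ at h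
  calc _ = 𝟙 _ ⊗≫ X ◁ coev X ▷ ldual X ⊗≫ ((β_ X X).hom ▷ ldual X ⊗≫ X ◁ S.ev' X) ▷ ldual X ⊗≫
        ((β_ X (ldual X)).hom ≫ ev X) := by simp only [twistHom']; monoidal
    _ = 𝟙 _ ⊗≫ X ◁ (coev X ≫ (β_ (ldual X) X).inv) ▷ ldual X ⊗≫ (S.ev' X ▷ (X ⊗ ldual X) ≫
        𝟙_ B ◁ ((β_ X (ldual X)).hom ≫ ev X)) ⊗≫ 𝟙 _ := by rw [braiding_ev']; monoidal
    _ = 𝟙 _ ⊗≫ X ◁ ((coev X ≫ (β_ (ldual X) X).inv) ▷ ldual X ⊗≫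
        ldual X ◁ ((β_ X (ldual X)).hom ≫ ev X)) ⊗≫ S.ev' X := by
        rw [← whisker_exchange]; monoidal
    _ = _ := by rw [h]; monoidal

lemma braiding_twistHom_ev' (X : B) :
    (β_ (ldual X) X).hom ≫ S.twistHom X ▷ ldual X ≫ S.ev' X = ev X := by
  let := S.exactPairing X
  have h := @ExactPairing.coevaluation_evaluation'' B _ _ X (ldual X)
    (BraidedCategory.exactPairing_swap (ldual X) X)
  change _ ◁ (S.coev' X ≫ (β_ X (ldual X)).inv) ⊗≫ ((β_ (ldual X) X).hom ≫ S.ev' X) ▷ _ = _ at h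
  calc _ = ldual X ◁ S.twistHom X ≫ (β_ (ldual X) X).hom ≫ S.ev' X := by
        rw [BraidedCategory.braiding_naturality_right_assoc]
    _ = 𝟙 _ ⊗≫ ldual X ◁ S.coev' X ▷ X ⊗≫ ldual X ◁ (ldual X ◁ (β_ X X).hom ⊗≫ ev X ▷ X) ⊗≫
        ((β_ (ldual X) X).hom ≫ S.ev' X) := by simp only [twistHom]; monoidal
    _ = 𝟙 _ ⊗≫ ldual X ◁ (S.coev' X ≫ (β_ X (ldual X)).inv) ▷ X ⊗≫ ((ldual X ⊗ X) ◁ ev X ≫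
        ((β_ (ldual X) X).hom ≫ S.ev' X) ▷ 𝟙_ B) ⊗≫ 𝟙 _ := by rw [braiding_ev]; monoidal
    _ = 𝟙 _ ⊗≫ (ldual X ◁ (S.coev' X ≫ (β_ X (ldual X)).inv) ⊗≫
        ((β_ (ldual X) X).hom ≫ S.ev' X) ▷ ldual X) ▷ X ⊗≫ ev X := by
        rw [whisker_exchange]; monoidal
    _ = _ := by rw [h]; monoidal

/-- The double braiding of `∨X` with `X` followed by `ev X` can be undone in two ways: by the square
of the twist of `X`, or by the twists of `∨X` and `X` together. Comparing the two identifies the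
twist of `∨X` with the dual of that of `X`. -/
lemma twist_selfDual (X : B) (hX : S.twistHom X = S.twistHom' X) :
    ldualMap (S.twistHom X) = S.twistHom (ldual X) := by
  have h1 : (β_ (ldual X) X).hom ≫ (β_ X (ldual X)).hom ≫
      ldual X ◁ (S.twistHom X ≫ S.twistHom X) ≫ ev X = ev X := by
    rw [MonoidalCategory.whiskerLeft_comp, Category.assoc,
      ← BraidedCategory.braiding_naturality_left_assoc,
      ← BraidedCategory.braiding_naturality_left_assoc]
    -- Of the two twists, one must be read as a right partial trace to turn `ev` into `ev'`, the
    -- other as a left one to turn it back.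
    nth_rw 2 [hX]
    rw [twistHom'_braiding_ev, braiding_twistHom_ev']
  have h2 : (β_ (ldual X) X).hom ≫ (β_ X (ldual X)).hom ≫
      S.twistHom (ldual X) ▷ X ≫ ldual X ◁ S.twistHom X ≫ ev X = ev X := by
    -- Naturality at the cap, with trivial twist on the unit and the tensor formula on `∨X ⊗ X`.
    have h := S.twistHom_natural (ev X)
    rw [twistHom_unit, Category.comp_id, twistHom_tensor, MonoidalCategory.tensorHom_def] at h
    simpa using h.symm
  apply ldual_hom_ext
  rw [ldualMap_ev]
  have h3 := h1.trans h2.symm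
  rw [cancel_epi, cancel_epi, MonoidalCategory.whiskerLeft_comp, Category.assoc,
    ← whisker_exchange_assoc] at h3
  have : IsIso (S.twistHom X) := ⟨S.twistInv X, S.twistHom_twistInv X, S.twistInv_twistHom X⟩
  rwa [cancel_epi] at h3

end SovereignStructure
end BraidedSovereign
end
end FusionCenter

namespace FusionCenter

noncomputable section

/-! ### Half-braidings in autonomous categories -/

section HalfBraidings

variable {C : Type u} [Category.{v} C] [MonoidalCategory C]

/-- Multiplicativity at `𝟙 ⊗ 𝟙` makes the induced endomorphism of `M` idempotent; it is invertible,
hence the identity. -/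
lemma halfBraiding_unit {M : C} (b : HalfBraiding M) :
    (b.β (𝟙_ C)).hom = (ρ_ M).hom ≫ (λ_ M).inv := by
  let e : M ⟶ M := (ρ_ M).inv ≫ (b.β (𝟙_ C)).hom ≫ (λ_ M).hom
  have h1 : e ≫ e = e := by
    have h2 := b.naturality (λ_ (𝟙_ C)).hom
    rw [b.monoidal] at h2
    calc e ≫ e = (ρ_ M).inv ≫ M ◁ (λ_ (𝟙_ C)).inv ≫ (((α_ _ _ _).inv ≫
          ((b.β _).hom ▷ _) ≫ (α_ _ _ _).hom ≫ (_ ◁ (b.β _).hom) ≫ (α_ _ _ _).inv) ≫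
            (λ_ (𝟙_ C)).hom ▷ M) ≫ (λ_ M).hom := by simp only [e]; monoidal
      _ = _ := by rw [← h2]; simp only [e]; monoidal
  have h2 : e = 𝟙 M := by
    have : IsIso e := by dsimp only [e]; infer_instance
    rwa [← cancel_epi e, Category.comp_id]
  calc _ = (ρ_ M).hom ≫ e ≫ (λ_ M).inv := by simp [e]
    _ = _ := by rw [h2, Category.id_comp]

lemma halfBraiding_inv_naturality {M : C} (b : HalfBraiding M) {U U' : C} (f : U ⟶ U') :
    f ▷ M ≫ (b.β U').inv = (b.β U).inv ≫ M ◁ f := by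
  rw [Iso.comp_inv_eq, Category.assoc, b.naturality, Iso.inv_hom_id_assoc]

lemma halfBraiding_inv_monoidal {M : C} (b : HalfBraiding M) (U U' : C) :
    (b.β (U ⊗ U')).inv = (α_ _ _ _).hom ≫ U ◁ (b.β U').inv ≫ (α_ _ _ _).inv ≫
      (b.β U).inv ▷ U' ≫ (α_ _ _ _).hom := by
  rw [← cancel_epi (b.β _).hom, Iso.hom_inv_id, b.monoidal]
  simp

@[ext]
lemma halfBraiding_ext {M : C} {b b' : HalfBraiding M} (h : ∀ U, (b.β U).hom = (b'.β U).hom) :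
    b = b' := by
  have h' : b.β = b'.β := by
    funext U
    ext
    exact h U
  cases b; cases b'; cases h'; rfl

variable [RigidCategory C]

/-- In an autonomous category a lax half-braiding is invertible. -/
@[simps]
def HalfBraiding.ofLax {M : C} (σ : ∀ Y, M ⊗ Y ⟶ Y ⊗ M)
    (nat : ∀ {U U' : C} (f : U ⟶ U'), M ◁ f ≫ σ U' = σ U ≫ f ▷ M)
    (mon : ∀ U U', σ (U ⊗ U') = (α_ _ _ _).inv ≫ σ U ▷ U' ≫ (α_ _ _ _).hom ≫ U ◁ σ U' ≫
      (α_ _ _ _).inv)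
    (unit : σ (𝟙_ C) = (ρ_ M).hom ≫ (λ_ M).inv) : HalfBraiding M where
  β Y :=
    { hom := σ Y
      -- The inverse is the mate of `σ` at the right dual of `Y`: multiplicativity merges the two
      -- into `σ` at `Y ⊗ Y∨` or `Y∨ ⊗ Y`, which naturality moves past `evr` or `coevr`.
      inv := 𝟙 _ ⊗≫ Y ◁ M ◁ coevr Y ⊗≫ Y ◁ σ (rdual Y) ▷ Y ⊗≫ evr Y ▷ (M ⊗ Y) ⊗≫ 𝟙 _
      hom_inv_id := by
        calc _ = 𝟙 _ ⊗≫ (σ Y ▷ 𝟙_ C ≫ (Y ⊗ M) ◁ coevr Y) ⊗≫ Y ◁ σ (rdual Y) ▷ Y ⊗≫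
              evr Y ▷ (M ⊗ Y) ⊗≫ 𝟙 _ := by monoidal
          _ = 𝟙 _ ⊗≫ (M ⊗ Y) ◁ coevr Y ⊗≫ (σ (Y ⊗ rdual Y) ≫ evr Y ▷ M) ▷ Y ⊗≫ 𝟙 _ := by
              rw [← whisker_exchange, mon]; monoidal
          _ = 𝟙 _ ⊗≫ M ◁ (Y ◁ coevr Y ⊗≫ evr Y ▷ Y) ⊗≫ 𝟙 _ := by
              rw [← nat, unit]; monoidal
          _ = _ := by rw [coevr_evr]; monoidal
      inv_hom_id := by
        calc _ = 𝟙 _ ⊗≫ Y ◁ M ◁ coevr Y ⊗≫ Y ◁ σ (rdual Y) ▷ Y ⊗≫ (evr Y ▷ (M ⊗ Y) ≫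
              _ ◁ σ Y) ⊗≫ 𝟙 _ := by monoidal
          _ = 𝟙 _ ⊗≫ Y ◁ (M ◁ coevr Y ≫ σ (rdual Y ⊗ Y)) ⊗≫ evr Y ▷ (Y ⊗ M) ⊗≫ 𝟙 _ := by
              rw [← whisker_exchange, mon]; monoidal
          _ = 𝟙 _ ⊗≫ (Y ◁ coevr Y ⊗≫ evr Y ▷ Y) ▷ M ⊗≫ 𝟙 _ := by
              rw [nat, unit]; monoidal
          _ = _ := by rw [coevr_evr]; monoidal }
  monoidal := mon
  naturality := nat

/-- In an autonomous category an oplax half-braiding, written from right to left, is invertible. -/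
@[simps]
def HalfBraiding.oplaxIso {N : C} (κ : ∀ Y, Y ⊗ N ⟶ N ⊗ Y)
    (nat : ∀ {U U' : C} (f : U ⟶ U'), f ▷ N ≫ κ U' = κ U ≫ N ◁ f)
    (mon : ∀ U U', κ (U ⊗ U') = (α_ _ _ _).hom ≫ U ◁ κ U' ≫ (α_ _ _ _).inv ≫ κ U ▷ U' ≫
      (α_ _ _ _).hom)
    (unit : κ (𝟙_ C) = (λ_ N).hom ≫ (ρ_ N).inv) (Y : C) : N ⊗ Y ≅ Y ⊗ N where
  inv := κ Y
  hom := 𝟙 _ ⊗≫ coev Y ▷ (N ⊗ Y) ⊗≫ Y ◁ κ (ldual Y) ▷ Y ⊗≫ (Y ⊗ N) ◁ ev Y ⊗≫ 𝟙 _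
  hom_inv_id := by
    calc _ = 𝟙 _ ⊗≫ coev Y ▷ (N ⊗ Y) ⊗≫ Y ◁ κ (ldual Y) ▷ Y ⊗≫ ((Y ⊗ N) ◁ ev Y ≫
          κ Y ▷ _) ⊗≫ 𝟙 _ := by monoidal
      _ = 𝟙 _ ⊗≫ (coev Y ▷ N ≫ κ (Y ⊗ ldual Y)) ▷ Y ⊗≫ (N ⊗ Y) ◁ ev Y ⊗≫ 𝟙 _ := by
          rw [whisker_exchange, mon]; monoidal
      _ = 𝟙 _ ⊗≫ N ◁ (coev Y ▷ Y ⊗≫ Y ◁ ev Y) ⊗≫ 𝟙 _ := by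
          rw [nat, unit]; monoidal
      _ = _ := by rw [ev_coev]; monoidal
  inv_hom_id := by
    calc _ = 𝟙 _ ⊗≫ (𝟙_ C ◁ κ Y ≫ coev Y ▷ (N ⊗ Y)) ⊗≫ Y ◁ κ (ldual Y) ▷ Y ⊗≫
          (Y ⊗ N) ◁ ev Y ⊗≫ 𝟙 _ := by monoidal
      _ = 𝟙 _ ⊗≫ coev Y ▷ (Y ⊗ N) ⊗≫ Y ◁ (κ (ldual Y ⊗ Y) ≫ N ◁ ev Y) ⊗≫ 𝟙 _ := by
          rw [whisker_exchange, mon]; monoidal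
      _ = 𝟙 _ ⊗≫ (coev Y ▷ Y ⊗≫ Y ◁ ev Y) ▷ N ⊗≫ 𝟙 _ := by
          rw [← nat, unit]; monoidal
      _ = _ := by rw [ev_coev]; monoidal

/-- The half-braiding given by an oplax half-braiding written from right to left. -/
@[simps]
def HalfBraiding.ofOplax {N : C} (κ : ∀ Y, Y ⊗ N ⟶ N ⊗ Y)
    (nat : ∀ {U U' : C} (f : U ⟶ U'), f ▷ N ≫ κ U' = κ U ≫ N ◁ f)
    (mon : ∀ U U', κ (U ⊗ U') = (α_ _ _ _).hom ≫ U ◁ κ U' ≫ (α_ _ _ _).inv ≫ κ U ▷ U' ≫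
      (α_ _ _ _).hom)
    (unit : κ (𝟙_ C) = (λ_ N).hom ≫ (ρ_ N).inv) : HalfBraiding N where
  β := HalfBraiding.oplaxIso κ nat mon unit
  monoidal U U' := by
    set b := HalfBraiding.oplaxIso κ nat mon unit with hb
    have h0 : ∀ Y, (b Y).inv = κ Y := fun _ => rfl
    have h1 : (b U).hom ≫ κ U = 𝟙 _ := (b U).hom_inv_id
    have h2 : (b U').hom ≫ κ U' = 𝟙 _ := (b U').hom_inv_id
    rw [← cancel_mono (b (U ⊗ U')).inv, Iso.hom_inv_id, h0, mon]
    symm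
    calc _ = 𝟙 _ ⊗≫ (b U).hom ▷ U' ⊗≫ U ◁ ((b U').hom ≫ κ U') ⊗≫ κ U ▷ U' ⊗≫ 𝟙 _ := by monoidal
      _ = 𝟙 _ ⊗≫ ((b U).hom ≫ κ U) ▷ U' ⊗≫ 𝟙 _ := by rw [h2]; monoidal
      _ = _ := by rw [h1]; monoidal
  naturality {U U'} f := by
    set b := HalfBraiding.oplaxIso κ nat mon unit with hb
    have h0 : ∀ Y, (b Y).inv = κ Y := fun _ => rfl
    rw [← cancel_mono (b U').inv, Category.assoc, Category.assoc, Iso.hom_inv_id, h0, nat, ← h0]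
    simp

/-- A morphism into `Y ⊗ ∨M` is determined by its pairing with `M`. -/
lemma tensor_ldual_hom_ext {A Y M : C} {f g : A ⟶ Y ⊗ ldual M}
    (h : f ▷ M ⊗≫ Y ◁ ev M = g ▷ M ⊗≫ Y ◁ ev M) : f = g := by
  have key : ∀ f : A ⟶ Y ⊗ ldual M, f =
      𝟙 _ ⊗≫ A ◁ coev M ⊗≫ (f ▷ M ⊗≫ Y ◁ ev M) ▷ ldual M ⊗≫ 𝟙 _ := by
    intro f
    symm
    calc _ = 𝟙 _ ⊗≫ (A ◁ coev M ≫ f ▷ (M ⊗ ldual M)) ⊗≫ Y ◁ ev M ▷ ldual M ⊗≫ 𝟙 _ := by monoidal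
      _ = f ⊗≫ Y ◁ (ldual M ◁ coev M ⊗≫ ev M ▷ ldual M) ⊗≫ 𝟙 _ := by
        rw [whisker_exchange]; monoidal
      _ = _ := by rw [coev_ev]; monoidal
  rw [key f, h, ← key g]

/-- A morphism into `M∨ ⊗ Y` is determined by its pairing with `M`. -/
lemma rdual_tensor_hom_ext {A Y M : C} {f g : A ⟶ rdual M ⊗ Y}
    (h : M ◁ f ⊗≫ evr M ▷ Y = M ◁ g ⊗≫ evr M ▷ Y) : f = g := by
  have key : ∀ f : A ⟶ rdual M ⊗ Y, f =
      𝟙 _ ⊗≫ coevr M ▷ A ⊗≫ rdual M ◁ (M ◁ f ⊗≫ evr M ▷ Y) ⊗≫ 𝟙 _ := by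
    intro f
    symm
    calc _ = 𝟙 _ ⊗≫ (coevr M ▷ A ≫ (rdual M ⊗ M) ◁ f) ⊗≫ rdual M ◁ evr M ▷ Y ⊗≫ 𝟙 _ := by monoidal
      _ = f ⊗≫ (coevr M ▷ rdual M ⊗≫ rdual M ◁ evr M) ▷ Y ⊗≫ 𝟙 _ := by
        rw [← whisker_exchange]; monoidal
      _ = _ := by rw [evr_coevr]; monoidal
  rw [key f, h, ← key g]

/-- The half-braiding on the left dual: the mate of the inverse half-braiding. -/
def ldualBraiding {M : C} (b : HalfBraiding M) (Y : C) : ldual M ⊗ Y ⟶ Y ⊗ ldual M :=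
  𝟙 _ ⊗≫ (ldual M ⊗ Y) ◁ coev M ⊗≫ ldual M ◁ (b.β Y).inv ▷ ldual M ⊗≫
    ev M ▷ (Y ⊗ ldual M) ⊗≫ 𝟙 _

/-- By `tensor_ldual_hom_ext` this pairing characterizes `ldualBraiding`, so the half-braiding
axioms for `∨M` reduce to those for the inverse of `b`. -/
lemma ldualBraiding_ev {M : C} (b : HalfBraiding M) (Y : C) :
    ldualBraiding b Y ▷ M ⊗≫ Y ◁ ev M = 𝟙 _ ⊗≫ ldual M ◁ (b.β Y).inv ⊗≫ ev M ▷ Y ⊗≫ 𝟙 _ := by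
  calc _ = 𝟙 _ ⊗≫ (ldual M ⊗ Y) ◁ coev M ▷ M ⊗≫ ldual M ◁ (b.β Y).inv ▷ (ldual M ⊗ M) ⊗≫
        (ev M ▷ (Y ⊗ ldual M ⊗ M) ≫ 𝟙_ C ◁ Y ◁ ev M) ⊗≫ 𝟙 _ := by
        simp only [ldualBraiding]; monoidal
    _ = 𝟙 _ ⊗≫ (ldual M ⊗ Y) ◁ coev M ▷ M ⊗≫ ldual M ◁ ((b.β Y).inv ▷ (ldual M ⊗ M) ≫
        (M ⊗ Y) ◁ ev M) ⊗≫ ev M ▷ Y ⊗≫ 𝟙 _ := by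
        rw [← whisker_exchange]; monoidal
    _ = 𝟙 _ ⊗≫ (ldual M ⊗ Y) ◁ (coev M ▷ M ⊗≫ M ◁ ev M) ⊗≫ ldual M ◁ (b.β Y).inv ⊗≫
        ev M ▷ Y ⊗≫ 𝟙 _ := by rw [← whisker_exchange]; monoidal
    _ = _ := by rw [ev_coev]; monoidal

/-- The half-braiding on the left dual of an object with a half-braiding. -/
def ldualHalfBraiding {M : C} (b : HalfBraiding M) : HalfBraiding (ldual M) :=
  HalfBraiding.ofLax (ldualBraiding b)
    (fun {U U'} f => by
      apply tensor_ldual_hom_ext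
      calc _ = 𝟙 _ ⊗≫ ldual M ◁ f ▷ M ⊗≫ (ldualBraiding b U' ▷ M ⊗≫ U' ◁ ev M) := by monoidal
        _ = 𝟙 _ ⊗≫ ldual M ◁ (f ▷ M ≫ (b.β U').inv) ⊗≫ ev M ▷ U' ⊗≫ 𝟙 _ := by
            rw [ldualBraiding_ev]; monoidal
        _ = 𝟙 _ ⊗≫ ldual M ◁ (b.β U).inv ⊗≫ ((ldual M ⊗ M) ◁ f ≫ ev M ▷ U') ⊗≫ 𝟙 _ := by
            rw [halfBraiding_inv_naturality]; monoidal
        _ = (𝟙 _ ⊗≫ ldual M ◁ (b.β U).inv ⊗≫ ev M ▷ U ⊗≫ 𝟙 (U ⊗ 𝟙_ C)) ⊗≫ f ⊗≫ 𝟙 _ := by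
            rw [whisker_exchange]; monoidal
        _ = ldualBraiding b U ▷ M ⊗≫ (U ◁ ev M ≫ f ▷ 𝟙_ C) := by
            rw [← ldualBraiding_ev]; monoidal
        _ = _ := by rw [whisker_exchange]; monoidal)
    (fun U U' => by
      apply tensor_ldual_hom_ext
      symm
      calc _ = 𝟙 _ ⊗≫ ldualBraiding b U ▷ U' ▷ M ⊗≫ U ◁ (ldualBraiding b U' ▷ M ⊗≫
            U' ◁ ev M) ⊗≫ 𝟙 _ := by monoidal
        _ = 𝟙 _ ⊗≫ (ldualBraiding b U ▷ (U' ⊗ M) ≫ (U ⊗ ldual M) ◁ (b.β U').inv) ⊗≫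
            U ◁ ev M ▷ U' ⊗≫ 𝟙 _ := by rw [ldualBraiding_ev]; monoidal
        _ = 𝟙 _ ⊗≫ ldual M ◁ U ◁ (b.β U').inv ⊗≫ (ldualBraiding b U ▷ M ⊗≫ U ◁ ev M) ▷ U' ⊗≫
            𝟙 _ := by rw [← whisker_exchange]; monoidal
        _ = _ := by
            rw [ldualBraiding_ev, ldualBraiding_ev, halfBraiding_inv_monoidal]; monoidal)
    (by
      have h : (b.β (𝟙_ C)).inv = (λ_ M).hom ≫ (ρ_ M).inv := by
        rw [← cancel_epi (b.β _).hom, Iso.hom_inv_id, halfBraiding_unit]; simp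
      apply tensor_ldual_hom_ext
      rw [ldualBraiding_ev, h]
      monoidal)

/-- The mate of a half-braiding with respect to right duals. -/
def rdualBraiding {M : C} (b : HalfBraiding M) (Y : C) : Y ⊗ rdual M ⟶ rdual M ⊗ Y :=
  𝟙 _ ⊗≫ coevr M ▷ (Y ⊗ rdual M) ⊗≫ rdual M ◁ (b.β Y).hom ▷ rdual M ⊗≫
    (rdual M ⊗ Y) ◁ evr M ⊗≫ 𝟙 _

/-- The mate of `b` for right duals runs from `Y ⊗ M∨` to `M∨ ⊗ Y`. It is thus the inverse of the
half-braiding wanted on `M∨`, which is why `HalfBraiding.ofOplax` is used there. -/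
lemma rdualBraiding_evr {M : C} (b : HalfBraiding M) (Y : C) :
    M ◁ rdualBraiding b Y ⊗≫ evr M ▷ Y = 𝟙 _ ⊗≫ (b.β Y).hom ▷ rdual M ⊗≫ Y ◁ evr M ⊗≫ 𝟙 _ := by
  calc _ = 𝟙 _ ⊗≫ M ◁ coevr M ▷ (Y ⊗ rdual M) ⊗≫ (M ⊗ rdual M) ◁ (b.β Y).hom ▷ rdual M ⊗≫
        ((M ⊗ rdual M) ◁ Y ◁ evr M ≫ evr M ▷ (Y ⊗ 𝟙_ C)) ⊗≫ 𝟙 _ := by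
        simp only [rdualBraiding]; monoidal
    _ = 𝟙 _ ⊗≫ M ◁ coevr M ▷ (Y ⊗ rdual M) ⊗≫ ((M ⊗ rdual M) ◁ (b.β Y).hom ≫
        evr M ▷ (Y ⊗ M)) ▷ rdual M ⊗≫ Y ◁ evr M ⊗≫ 𝟙 _ := by
        rw [whisker_exchange]; monoidal
    _ = 𝟙 _ ⊗≫ (M ◁ coevr M ⊗≫ evr M ▷ M) ▷ (Y ⊗ rdual M) ⊗≫ (b.β Y).hom ▷ rdual M ⊗≫
        Y ◁ evr M ⊗≫ 𝟙 _ := by rw [whisker_exchange]; monoidal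
    _ = _ := by rw [coevr_evr]; monoidal

/-- The half-braiding on the right dual of an object with a half-braiding. -/
def rdualHalfBraiding {M : C} (b : HalfBraiding M) : HalfBraiding (rdual M) :=
  HalfBraiding.ofOplax (rdualBraiding b)
    (fun {U U'} f => by
      apply rdual_tensor_hom_ext
      calc _ = 𝟙 _ ⊗≫ M ◁ f ▷ rdual M ⊗≫ (M ◁ rdualBraiding b U' ⊗≫ evr M ▷ U') := by monoidal
        _ = 𝟙 _ ⊗≫ (M ◁ f ≫ (b.β U').hom) ▷ rdual M ⊗≫ U' ◁ evr M ⊗≫ 𝟙 _ := by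
            rw [rdualBraiding_evr]; monoidal
        _ = 𝟙 _ ⊗≫ (b.β U).hom ▷ rdual M ⊗≫ (f ▷ (M ⊗ rdual M) ≫ U' ◁ evr M) ⊗≫ 𝟙 _ := by
            rw [b.naturality]; monoidal
        _ = (𝟙 _ ⊗≫ (b.β U).hom ▷ rdual M ⊗≫ U ◁ evr M ⊗≫ 𝟙 (𝟙_ C ⊗ U)) ⊗≫ f ⊗≫ 𝟙 _ := by
            rw [← whisker_exchange]; monoidal
        _ = M ◁ rdualBraiding b U ⊗≫ (evr M ▷ U ≫ 𝟙_ C ◁ f) ⊗≫ 𝟙 _ := by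
            rw [← rdualBraiding_evr]; monoidal
        _ = _ := by rw [← whisker_exchange]; monoidal)
    (fun U U' => by
      apply rdual_tensor_hom_ext
      symm
      calc _ = 𝟙 _ ⊗≫ M ◁ U ◁ rdualBraiding b U' ⊗≫ (M ◁ rdualBraiding b U ⊗≫
            evr M ▷ U) ▷ U' ⊗≫ 𝟙 _ := by monoidal
        _ = 𝟙 _ ⊗≫ ((M ⊗ U) ◁ rdualBraiding b U' ≫ (b.β U).hom ▷ (rdual M ⊗ U')) ⊗≫
            U ◁ evr M ▷ U' ⊗≫ 𝟙 _ := by rw [rdualBraiding_evr]; monoidal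
        _ = 𝟙 _ ⊗≫ (b.β U).hom ▷ U' ▷ rdual M ⊗≫ U ◁ (M ◁ rdualBraiding b U' ⊗≫ evr M ▷ U') ⊗≫
            𝟙 _ := by rw [whisker_exchange]; monoidal
        _ = _ := by
            rw [rdualBraiding_evr, rdualBraiding_evr, b.monoidal]; monoidal)
    (by
      apply rdual_tensor_hom_ext
      rw [rdualBraiding_evr, halfBraiding_unit]
      monoidal)

end HalfBraidings
end
end FusionCenter

namespace FusionCenter

noncomputable section

/-! ### The center of an autonomous category is autonomous -/

section CenterRigid

variable {C : Type u} [Category.{v} C] [MonoidalCategory C] [RigidCategory C]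

lemma ldualHalfBraiding_hom {M : C} (b : HalfBraiding M) (U : C) :
    ((ldualHalfBraiding b).β U).hom = ldualBraiding b U := rfl

lemma rdualHalfBraiding_inv {M : C} (b : HalfBraiding M) (U : C) :
    ((rdualHalfBraiding b).β U).inv = rdualBraiding b U := rfl

/-- This is the condition for `ev M` to be a morphism of the center. It holds because the
half-braiding of `∨M` is the mate of the inverse of `b`, which cancels `b`. -/
lemma ev_halfBraiding {M : C} (b : HalfBraiding M) (U : C) :
    ev M ▷ U ≫ (λ_ U).hom ≫ (ρ_ U).inv =
      ((α_ _ _ _).hom ≫ ldual M ◁ (b.β U).hom ≫ (α_ _ _ _).inv ≫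
        ((ldualHalfBraiding b).β U).hom ▷ M ≫ (α_ _ _ _).hom) ≫ U ◁ ev M := by
  rw [ldualHalfBraiding_hom]
  symm
  calc _ = 𝟙 _ ⊗≫ ldual M ◁ (b.β U).hom ⊗≫ (ldualBraiding b U ▷ M ⊗≫ U ◁ ev M) := by monoidal
    _ = 𝟙 _ ⊗≫ ldual M ◁ ((b.β U).hom ≫ (b.β U).inv) ⊗≫ ev M ▷ U ⊗≫ 𝟙 _ := by
      rw [ldualBraiding_ev]; monoidal
    _ = _ := by rw [Iso.hom_inv_id]; monoidal

lemma coev_halfBraiding {M : C} (b : HalfBraiding M) (U : C) :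
    coev M ▷ U ≫ (α_ _ _ _).hom ≫ M ◁ ((ldualHalfBraiding b).β U).hom ≫ (α_ _ _ _).inv ≫
        (b.β U).hom ▷ ldual M ≫ (α_ _ _ _).hom =
      ((λ_ U).hom ≫ (ρ_ U).inv) ≫ U ◁ coev M := by
  rw [ldualHalfBraiding_hom, ← cancel_mono (α_ U M (ldual M)).inv]
  apply tensor_ldual_hom_ext
  calc _ = 𝟙 _ ⊗≫ coev M ▷ (U ⊗ M) ⊗≫ M ◁ ldualBraiding b U ▷ M ⊗≫ ((b.β U).hom ▷ (ldual M ⊗ M) ≫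
        (U ⊗ M) ◁ ev M) := by monoidal
    _ = 𝟙 _ ⊗≫ coev M ▷ (U ⊗ M) ⊗≫ M ◁ (ldualBraiding b U ▷ M ⊗≫ U ◁ ev M) ⊗≫ (b.β U).hom ⊗≫ 𝟙 _ :=
        by
      rw [← whisker_exchange]; monoidal
    _ = 𝟙 _ ⊗≫ (coev M ▷ (U ⊗ M) ≫ (M ⊗ ldual M) ◁ (b.β U).inv) ⊗≫ M ◁ ev M ▷ U ⊗≫
        (b.β U).hom ⊗≫ 𝟙 _ := by rw [ldualBraiding_ev]; monoidal
    _ = 𝟙 _ ⊗≫ (b.β U).inv ⊗≫ (coev M ▷ M ⊗≫ M ◁ ev M) ▷ U ⊗≫ (b.β U).hom ⊗≫ 𝟙 _ := by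
      rw [← whisker_exchange]; monoidal
    _ = 𝟙 _ ⊗≫ ((b.β U).inv ≫ (b.β U).hom) ⊗≫ 𝟙 _ := by rw [ev_coev]; monoidal
    _ = 𝟙 _ ⊗≫ U ◁ ((λ_ M).hom ≫ (ρ_ M).inv) ⊗≫ 𝟙 _ := by rw [Iso.inv_hom_id]; monoidal
    _ = 𝟙 _ ⊗≫ U ◁ (coev M ▷ M ⊗≫ M ◁ ev M) ⊗≫ 𝟙 _ := by rw [ev_coev]; monoidal
    _ = _ := by monoidal

lemma evr_halfBraiding {M : C} (b : HalfBraiding M) (U : C) :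
    evr M ▷ U ≫ (λ_ U).hom ≫ (ρ_ U).inv =
      ((α_ _ _ _).hom ≫ M ◁ ((rdualHalfBraiding b).β U).hom ≫ (α_ _ _ _).inv ≫
        (b.β U).hom ▷ rdual M ≫ (α_ _ _ _).hom) ≫ U ◁ evr M := by
  symm
  calc _ = 𝟙 _ ⊗≫ M ◁ ((rdualHalfBraiding b).β U).hom ⊗≫ (𝟙 (M ⊗ U ⊗ rdual M) ⊗≫
        (b.β U).hom ▷ rdual M ⊗≫ U ◁ evr M ⊗≫ 𝟙 (𝟙_ C ⊗ U)) ⊗≫ 𝟙 _ := by monoidal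
    _ = 𝟙 _ ⊗≫ M ◁ (((rdualHalfBraiding b).β U).hom ≫ ((rdualHalfBraiding b).β U).inv) ⊗≫
        evr M ▷ U ⊗≫ 𝟙 _ := by
      rw [← rdualBraiding_evr, rdualHalfBraiding_inv]; monoidal
    _ = _ := by rw [Iso.hom_inv_id]; monoidal

lemma coevr_halfBraiding {M : C} (b : HalfBraiding M) (U : C) :
    coevr M ▷ U ≫ (α_ _ _ _).hom ≫ rdual M ◁ (b.β U).hom ≫ (α_ _ _ _).inv ≫
        ((rdualHalfBraiding b).β U).hom ▷ M ≫ (α_ _ _ _).hom =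
      ((λ_ U).hom ≫ (ρ_ U).inv) ≫ U ◁ coevr M := by
  have h : U ◁ coevr M ⊗≫ rdualBraiding b U ▷ M =
      𝟙 _ ⊗≫ coevr M ▷ U ⊗≫ rdual M ◁ (b.β U).hom ⊗≫ 𝟙 ((rdual M ⊗ U) ⊗ M) := by
    calc _ = 𝟙 _ ⊗≫ (𝟙_ C ◁ (U ◁ coevr M) ≫ coevr M ▷ (U ⊗ rdual M ⊗ M)) ⊗≫
          rdual M ◁ (b.β U).hom ▷ (rdual M ⊗ M) ⊗≫ (rdual M ⊗ U) ◁ (evr M ▷ M) ⊗≫ 𝟙 _ := by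
          simp only [rdualBraiding]; monoidal
      _ = 𝟙 _ ⊗≫ coevr M ▷ U ⊗≫ rdual M ◁ ((M ⊗ U) ◁ coevr M ≫
          (b.β U).hom ▷ (rdual M ⊗ M)) ⊗≫ (rdual M ⊗ U) ◁ (evr M ▷ M) ⊗≫ 𝟙 _ := by
          rw [whisker_exchange]; monoidal
      _ = 𝟙 _ ⊗≫ coevr M ▷ U ⊗≫ rdual M ◁ (b.β U).hom ⊗≫
          (rdual M ⊗ U) ◁ (M ◁ coevr M ⊗≫ evr M ▷ M) ⊗≫ 𝟙 _ := by
          rw [whisker_exchange]; monoidal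
      _ = _ := by rw [coevr_evr]; monoidal
  calc _ = 𝟙 _ ⊗≫ (𝟙 (U ⊗ 𝟙_ C) ⊗≫ coevr M ▷ U ⊗≫ rdual M ◁ (b.β U).hom ⊗≫ 𝟙 ((rdual M ⊗ U) ⊗ M)) ⊗≫
        ((rdualHalfBraiding b).β U).hom ▷ M ⊗≫ 𝟙 _ := by monoidal
    _ = 𝟙 _ ⊗≫ U ◁ coevr M ⊗≫ (((rdualHalfBraiding b).β U).inv ≫
        ((rdualHalfBraiding b).β U).hom) ▷ M ⊗≫ 𝟙 _ := by
        rw [← h, rdualHalfBraiding_inv]; monoidal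
    _ = _ := by rw [Iso.inv_hom_id]; monoidal

/-- The left dual in the center. -/
@[simps]
def ldualCenter (A : Center C) : Center C := ⟨ldual A.1, ldualHalfBraiding A.2⟩

/-- The right dual in the center. -/
@[simps]
def rdualCenter (A : Center C) : Center C := ⟨rdual A.1, rdualHalfBraiding A.2⟩

/-- The pairing of an object of the center with its left dual. -/
@[reducible]
def ldualCenterPairing (A : Center C) : ExactPairing A (ldualCenter A) where
  coevaluation' := ⟨coev A.1, fun U => coev_halfBraiding A.2 U⟩
  evaluation' := ⟨ev A.1, fun U => ev_halfBraiding A.2 U⟩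
  coevaluation_evaluation' := by
    ext
    have h := @ExactPairing.coevaluation_evaluation C _ _ A.1 (ldual A.1) _
    simp
    exact h
  evaluation_coevaluation' := by
    ext
    have h := @ExactPairing.evaluation_coevaluation C _ _ A.1 (ldual A.1) _
    simp
    exact h

/-- The pairing of an object of the center with its right dual. -/
@[reducible]
def rdualCenterPairing (A : Center C) : ExactPairing (rdualCenter A) A where
  coevaluation' := ⟨coevr A.1, fun U => coevr_halfBraiding A.2 U⟩
  evaluation' := ⟨evr A.1, fun U => evr_halfBraiding A.2 U⟩
  coevaluation_evaluation' := by
    ext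
    have h := @ExactPairing.coevaluation_evaluation C _ _ (rdual A.1) A.1 _
    simp
    exact h
  evaluation_coevaluation' := by
    ext
    have h := @ExactPairing.evaluation_coevaluation C _ _ (rdual A.1) A.1 _
    simp
    exact h

/-- Duals in the center are the chosen duals of `C` with a half-braiding, and the evaluations and
coevaluations have those of `C` as underlying morphisms by definition. Identities about duals
therefore transfer along the forgetful functor. -/
instance centerRigid : RigidCategory (Center C) where
  rightDual A := { rightDual := ldualCenter A, exact := ldualCenterPairing A }
  leftDual A := { leftDual := rdualCenter A, exact := rdualCenterPairing A }

lemma center_ldualMap_f {A B : Center C} (f : A ⟶ B) : (ldualMap f).f = ldualMap f.f := by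
  apply ldual_hom_ext
  have h := congrArg Center.Hom.f (ldualMap_ev f)
  exact Eq.trans h (ldualMap_ev f.f).symm

lemma center_rdualMap_f {A B : Center C} (f : A ⟶ B) : (rdualMap f).f = rdualMap f.f := by
  apply rdual_hom_ext
  have h := congrArg Center.Hom.f (rdualMap_evr f)
  exact Eq.trans h (rdualMap_evr f.f).symm

lemma center_ldualTensorIso_hom (A B : Center C) :
    (ldualTensorIso A B).hom.f = (ldualTensorIso A.1 B.1).hom := by
  have h1 := congrArg Center.Hom.f (coev_ldualTensorIso A B)
  have h2 := coev_ldualTensorIso A.1 B.1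
  simp only [monoidalComp] at h1 h2
  simp at h1 h2
  have key : ∀ {W : C} (f g : ldual (A.1 ⊗ B.1) ⟶ W), coev (A.1 ⊗ B.1) ≫ (α_ _ _ _).hom ≫
      A.1 ◁ B.1 ◁ f ≫ (α_ _ _ _).inv = coev (A.1 ⊗ B.1) ≫ (α_ _ _ _).hom ≫
      A.1 ◁ B.1 ◁ g ≫ (α_ _ _ _).inv → f = g := fun f g h => by
    apply coev_injective
    rw [tensor_whiskerLeft, tensor_whiskerLeft]
    exact h
  exact key _ _ (Eq.trans h1 h2.symm)

lemma center_ldualTensorIso_inv (A B : Center C) :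
    (ldualTensorIso A B).inv.f = (ldualTensorIso A.1 B.1).inv := by
  have key : ∀ {X Y : C} (e : X ≅ Y) (f : X ⟶ Y) (g : Y ⟶ X), f = e.hom → f ≫ g = 𝟙 _ →
      g = e.inv := fun e f g h h' => by
    rw [← cancel_epi e.hom, Iso.hom_inv_id, ← h, h']
  exact key (ldualTensorIso A.1 B.1) _ _ (center_ldualTensorIso_hom A B)
    (congrArg Center.Hom.f (ldualTensorIso A B).hom_inv_id)

/-- Naturality of `b` at `ev Y` trades the half-braiding with `Y` for the inverse of the one with
`∨Y`. -/
lemma ev_halfBraiding_natural {M : C} (b : HalfBraiding M) (Y : C) :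
    ldual Y ◁ (b.β Y).hom ⊗≫ ev Y ▷ M =
      𝟙 _ ⊗≫ (b.β (ldual Y)).inv ▷ Y ⊗≫ M ◁ ev Y ⊗≫ 𝟙 _ := by
  have h := b.naturality (ev Y)
  calc _ = 𝟙 _ ⊗≫ ((b.β (ldual Y)).inv ≫ (b.β (ldual Y)).hom) ▷ Y ⊗≫
        ldual Y ◁ (b.β Y).hom ⊗≫ ev Y ▷ M := by rw [Iso.inv_hom_id]; monoidal
    _ = 𝟙 _ ⊗≫ (b.β (ldual Y)).inv ▷ Y ⊗≫ ((b.β (ldual Y ⊗ Y)).hom ≫ ev Y ▷ M) := by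
        rw [b.monoidal]; monoidal
    _ = _ := by rw [← h, halfBraiding_unit]; monoidal

/-- The half-braiding of `∨M` with `∨Y` is the dual of the half-braiding of `M` with `Y`. -/
lemma ldualHalfBraiding_ldual {M : C} (b : HalfBraiding M) (Y : C) :
    ((ldualHalfBraiding b).β (ldual Y)).hom =
      (ldualTensorIso Y M).inv ≫ ldualMap (b.β Y).hom ≫ (ldualTensorIso M Y).hom := by
  rw [ldualHalfBraiding_hom, ← Category.assoc, ← Iso.comp_inv_eq]
  apply ldual_hom_ext
  calc _ = 𝟙 _ ⊗≫ ldualBraiding b (ldual Y) ▷ M ▷ Y ⊗≫ ((ldualTensorIso M Y).inv ▷ (M ⊗ Y) ≫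
        (ldualTensorIso M Y).hom ▷ (M ⊗ Y)) ⊗≫ ldual Y ◁ (ev M ▷ Y) ⊗≫ ev Y := by
        rw [← ldualTensorIso_ev]; monoidal
    _ = 𝟙 _ ⊗≫ (ldualBraiding b (ldual Y) ▷ M ⊗≫ ldual Y ◁ ev M) ▷ Y ⊗≫ ev Y := by
        rw [← comp_whiskerRight (ldualTensorIso M Y).inv, Iso.inv_hom_id]; monoidal
    _ = 𝟙 _ ⊗≫ ldual M ◁ (b.β (ldual Y)).inv ▷ Y ⊗≫ (ev M ▷ (ldual Y ⊗ Y) ≫ 𝟙_ C ◁ ev Y) ⊗≫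
        𝟙 _ := by rw [ldualBraiding_ev]; monoidal
    _ = 𝟙 _ ⊗≫ ldual M ◁ (𝟙 ((ldual Y ⊗ M) ⊗ Y) ⊗≫ (b.β (ldual Y)).inv ▷ Y ⊗≫ M ◁ ev Y ⊗≫
        𝟙 (𝟙_ C ⊗ M)) ⊗≫ ev M := by rw [← whisker_exchange]; monoidal
    _ = 𝟙 _ ⊗≫ ((ldualTensorIso Y M).inv ▷ (M ⊗ Y) ≫ (ldualTensorIso Y M).hom ▷ (M ⊗ Y)) ⊗≫
        ldual M ◁ (ldual Y ◁ (b.β Y).hom ⊗≫ ev Y ▷ M) ⊗≫ ev M := by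
        rw [← comp_whiskerRight (ldualTensorIso Y M).inv, Iso.inv_hom_id,
          ev_halfBraiding_natural]; monoidal
    _ = 𝟙 _ ⊗≫ (ldualTensorIso Y M).inv ▷ (M ⊗ Y) ⊗≫ ((ldualTensorIso Y M).hom ▷ (M ⊗ Y) ≫
        (ldual M ⊗ ldual Y) ◁ (b.β Y).hom) ⊗≫ ldual M ◁ (ev Y ▷ M) ⊗≫ ev M := by monoidal
    _ = (ldualTensorIso Y M).inv ▷ (M ⊗ Y) ≫ (ldual (Y ⊗ M) ◁ (b.β Y).hom ≫
        ((ldualTensorIso Y M).hom ▷ (Y ⊗ M) ⊗≫ ldual M ◁ (ev Y ▷ M) ⊗≫ ev M)) := by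
        rw [← whisker_exchange]; monoidal
    _ = _ := by
        rw [ldualTensorIso_ev, ← ldualMap_ev, comp_whiskerRight_assoc]

namespace SovereignStructure

variable (S : SovereignStructure C)

/-- By `ldualHalfBraiding_ldual` used twice, the half-braiding of `∨∨M` with `∨∨U` is the double
dual of that of `M` with `U`. Naturality of `φ` at the half-braiding and monoidality of `φ` then
show that `φ` is a morphism of the center. -/
lemma φ_halfBraiding {M : C} (b : HalfBraiding M) (U : C) : (S.φ M).hom ▷ U ≫
    ((ldualHalfBraiding (ldualHalfBraiding b)).β U).hom = (b.β U).hom ≫ U ◁ (S.φ M).hom := by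
  have h1 := ldualHalfBraiding_ldual (ldualHalfBraiding b) (ldual U)
  rw [ldualHalfBraiding_ldual b U, ldualMap_comp, ldualMap_comp] at h1
  have h2 := S.tensor M U
  have h3 := S.tensor U M
  have h4 := S.natural (b.β U).hom
  have h5 : ldualMap (ldualTensorIso U M).hom ≫ ldualMap (ldualTensorIso U M).inv = 𝟙 _ := by
    rw [← ldualMap_comp, Iso.inv_hom_id, ldualMap_id]
  rw [← cancel_mono ((S.φ U).hom ▷ _), Category.assoc, ← HalfBraiding.naturality, h1]
  calc _ = ((S.φ M).hom ⊗ₘ (S.φ U).hom) ≫ (ldualTensorIso (ldual U) (ldual M)).inv ≫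
      ldualMap (ldualTensorIso M U).hom ≫ ldualMap (ldualMap (b.β U).hom) ≫
      ldualMap (ldualTensorIso U M).inv ≫ (ldualTensorIso (ldual M) (ldual U)).hom := by
        rw [MonoidalCategory.tensorHom_def]; simp only [Category.assoc]
    _ = ((S.φ (M ⊗ U)).hom ≫ ldualMap (ldualMap (b.β U).hom)) ≫
      ldualMap (ldualTensorIso U M).inv ≫ (ldualTensorIso (ldual M) (ldual U)).hom := by
        rw [h2]; simp only [Category.assoc]
    _ = _ := by
        rw [← h4, h3]
        simp only [Category.assoc]
        rw [reassoc_of% h5, Iso.inv_hom_id, Category.comp_id, MonoidalCategory.tensorHom_def']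

/-- The sovereign structure on the center of a sovereign category. -/
def center : SovereignStructure (Center C) where
  φ A := @Center.isoMk C _ _ A (ldual (ldual A)) ⟨(S.φ A.1).hom, S.φ_halfBraiding A.2⟩
    (inferInstanceAs (IsIso (S.φ A.1).hom))
  natural {A B} f := by
    ext
    exact (S.natural f.f).trans (congrArg (fun g => (S.φ A.1).hom ≫ g)
      ((center_ldualMap_f (ldualMap f)).trans
        (congrArg (fun g => ldualMap g) (center_ldualMap_f f))).symm)
  tensor A B := by
    ext
    exact (S.tensor A.1 B.1).trans (congrArg₂ (fun g h => ((S.φ A.1).hom ⊗ₘ (S.φ B.1).hom) ≫ g ≫ h)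
      (center_ldualTensorIso_inv (ldual B) (ldual A)).symm
      ((center_ldualMap_f _).trans
        (congrArg (fun g => ldualMap g) (center_ldualTensorIso_hom A B))).symm)
  unit := by
    ext
    exact (congrArg (fun g => (S.φ (𝟙_ C)).hom ≫ g)
      (center_ldualMap_f (toLdualUnit (Center C)))).trans S.unit

/-- `Center.isoMk` takes `inv` of the underlying morphism, so the comparison with the inverse of
`S.φ` needs a proof. -/
lemma center_φ_inv_f (A : Center C) : (S.center.φ A).inv.f = (S.φ A.1).inv :=
  IsIso.Iso.inv_hom _

lemma center_coev'_f (A : Center C) : (S.center.coev' A).f = S.coev' A.1 :=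
  congrArg (fun g => coev (ldual A.1) ≫ ldual A.1 ◁ g) (S.center_φ_inv_f A)

end SovereignStructure

end CenterRigid
end
end FusionCenter

namespace FusionCenter

noncomputable section

set_option linter.unusedSectionVars false

/-! ### Free objects of the center -/

section FreeCenter

variable {C : Type u} [Category.{v} C] [MonoidalCategory C] [RigidCategory C]

/-- The object of the center given by a half-braiding. -/
abbrev centerMk {M : C} (b : HalfBraiding M) : Center C := ⟨M, b⟩

/-- The underlying morphism of a morphism of the center. -/
def centerHom {M N : C} {b : HalfBraiding M} {c : HalfBraiding N} (f : centerMk b ⟶ centerMk c) :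
    M ⟶ N := f.f

/-- The half-braiding of a tensor product. -/
def tensorBraiding {M N : C} (b : HalfBraiding M) (c : HalfBraiding N) : HalfBraiding (M ⊗ N) :=
  (centerMk b ⊗ centerMk c).2

variable (C) in
/-- The half-braiding of the unit. -/
def unitBraiding : HalfBraiding (𝟙_ C) := (𝟙_ (Center C)).2

/-- A left adjoint of the forgetful functor from the center, lifting the endofunctor `Z`. -/
structure FreeCenter (Z : C ⥤ C) where
  hb : ∀ X, HalfBraiding (Z.obj X)
  η : 𝟭 C ⟶ Z
  map_comm : ∀ {X Y : C} (f : X ⟶ Y) (U : C),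
    Z.map f ▷ U ≫ ((hb Y).β U).hom = ((hb X).β U).hom ≫ U ◁ Z.map f
  desc : ∀ {X : C} {A : Center C} (_ : X ⟶ A.1), centerMk (hb X) ⟶ A
  η_desc : ∀ {X : C} {A : Center C} (f : X ⟶ A.1), η.app X ≫ (desc f).f = f
  hom_ext : ∀ {X : C} {A : Center C} (g h : centerMk (hb X) ⟶ A),
    η.app X ≫ g.f = η.app X ≫ h.f → g = h

namespace FreeCenter

variable {Z : C ⥤ C} (F : FreeCenter Z)

/-- The free object on `X`. -/
def free (X : C) : Center C := centerMk (F.hb X)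

/-- The functoriality of free objects. -/
def map {X Y : C} (f : X ⟶ Y) : F.free X ⟶ F.free Y := ⟨Z.map f, F.map_comm f⟩

/-- The counit of the adjunction. -/
def counitHom {M : C} (b : HalfBraiding M) : F.free M ⟶ centerMk b := F.desc (𝟙 M)

/-- The comultiplication of the monad, in the center. -/
def comulHom (X Y : C) : F.free (X ⊗ Y) ⟶ F.free X ⊗ F.free Y :=
  F.desc (A := F.free X ⊗ F.free Y) (F.η.app X ⊗ₘ F.η.app Y)

/-- The unit of the monad. -/
def unit (X : C) : X ⟶ Z.obj X := F.η.app X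

/-- The action of the monad on an object with a half-braiding. -/
def act {M : C} (b : HalfBraiding M) : Z.obj M ⟶ M := (F.counitHom b).f

/-- The multiplication of the monad. -/
def mul (X : C) : Z.obj (Z.obj X) ⟶ Z.obj X := F.act (F.hb X)

/-- The comultiplication of the monad. -/
def comul (X Y : C) : Z.obj (X ⊗ Y) ⟶ Z.obj X ⊗ Z.obj Y := (F.comulHom X Y).f

/-- The counit of the monad. -/
def counit : Z.obj (𝟙_ C) ⟶ 𝟙_ C := F.act (unitBraiding C)

/-- The multiplication of the monad, in the center. -/
def mulHom (X : C) : F.free (Z.obj X) ⟶ F.free X := F.counitHom (F.hb X)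

/-- The counit of the monad, in the center. -/
def unitHom : F.free (𝟙_ C) ⟶ 𝟙_ (Center C) := F.counitHom (unitBraiding C)

/-- The universal property in the form used throughout: two morphisms of `C` that lift to the center
agree once they agree on the unit. Each application supplies the two lifts and leaves a computation
in `C`. -/
lemma ext_f {X : C} {A : Center C} (g h : F.free X ⟶ A)
    (w : F.unit X ≫ g.f = F.unit X ≫ h.f) : g.f = h.f :=
  congrArg Center.Hom.f (F.hom_ext g h w)

lemma unit_map {X Y : C} (f : X ⟶ Y) : F.unit X ≫ Z.map f = f ≫ F.unit Y :=
  (F.η.naturality f).symm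

lemma unit_act {M : C} (b : HalfBraiding M) : F.unit M ≫ F.act b = 𝟙 M := F.η_desc (A :=
    centerMk b) _

lemma unit_mul (X : C) : F.unit (Z.obj X) ≫ F.mul X = 𝟙 _ := F.unit_act _

lemma unit_comul (X Y : C) : F.unit (X ⊗ Y) ≫ F.comul X Y = F.unit X ⊗ₘ F.unit Y :=
  F.η_desc (A := F.free X ⊗ F.free Y) _

lemma unit_counit : F.unit (𝟙_ C) ≫ F.counit = 𝟙 _ := F.unit_act _

lemma act_natural {M N : C} {b : HalfBraiding M} {c : HalfBraiding N}
    (f : centerMk b ⟶ centerMk c) : Z.map (centerHom f) ≫ F.act c = F.act b ≫ centerHom f :=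
  F.ext_f (F.map (centerHom f) ≫ F.counitHom c) (F.counitHom b ≫ f) (by
    change F.unit M ≫ Z.map (centerHom f) ≫ F.act c = F.unit M ≫ F.act b ≫ centerHom f
    rw [reassoc_of% unit_map, unit_act, reassoc_of% unit_act, Category.comp_id])

lemma mul_natural {X Y : C} (f : X ⟶ Y) :
    Z.map (Z.map f) ≫ F.mul Y = F.mul X ≫ Z.map f := F.act_natural (F.map f)

lemma mul_act {M : C} (b : HalfBraiding M) : F.mul M ≫ F.act b = Z.map (F.act b) ≫ F.act b :=
  (F.act_natural (F.counitHom b)).symm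

/-- The right side is a morphism of the center that restricts to the identity on the unit, which
characterizes the action. -/
lemma act_tensor {M N : C} (b : HalfBraiding M) (c : HalfBraiding N) :
    F.act (tensorBraiding b c) = F.comul M N ≫ (F.act b ⊗ₘ F.act c) :=
  F.ext_f (F.counitHom (tensorBraiding b c)) (F.comulHom M N ≫ (F.counitHom b ⊗ₘ F.counitHom c)) (by
    change F.unit (M ⊗ N) ≫ F.act (tensorBraiding b c) =
      F.unit (M ⊗ N) ≫ F.comul M N ≫ (F.act b ⊗ₘ F.act c)
    rw [unit_act, reassoc_of% unit_comul, tensorHom_comp_tensorHom, unit_act, unit_act,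
      id_tensorHom_id])

lemma comul_natural {X X' Y Y' : C} (f : X ⟶ X') (g : Y ⟶ Y') :
    Z.map (f ⊗ₘ g) ≫ F.comul X' Y' = F.comul X Y ≫ (Z.map f ⊗ₘ Z.map g) :=
  F.ext_f (F.map (f ⊗ₘ g) ≫ F.comulHom X' Y') (F.comulHom X Y ≫ (F.map f ⊗ₘ F.map g)) (by
    change F.unit _ ≫ Z.map (f ⊗ₘ g) ≫ F.comul X' Y' =
      F.unit _ ≫ F.comul X Y ≫ (Z.map f ⊗ₘ Z.map g)
    rw [reassoc_of% unit_map, unit_comul, reassoc_of% unit_comul, tensorHom_comp_tensorHom,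
      tensorHom_comp_tensorHom, unit_map, unit_map])

/-- The bimonad structure of the free-forgetful adjunction of the center. -/
def bimonad : BimonadStructure Z where
  μ := { app := F.mul, naturality := fun _ _ f => F.mul_natural f }
  η := F.η
  μ_assoc X := (F.mul_act (F.hb X)).symm
  η_left := F.unit_mul
  η_right X := F.ext_f (F.map (F.unit X) ≫ F.mulHom X) (𝟙 _) (by
    change F.unit X ≫ Z.map (F.unit X) ≫ F.mul X = F.unit X ≫ 𝟙 _
    rw [reassoc_of% unit_map, unit_mul])
  T₂ := F.comul
  T₂_natural := F.comul_natural
  T₀ := F.counit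
  T₂_assoc X Y W := F.ext_f
    (F.map (α_ X Y W).hom ≫ F.comulHom X (Y ⊗ W) ≫ (F.free X ◁ F.comulHom Y W))
    (F.comulHom (X ⊗ Y) W ≫ F.comulHom X Y ▷ F.free W ≫ (α_ _ _ _).hom) (by
      change F.unit _ ≫ Z.map (α_ X Y W).hom ≫ F.comul X (Y ⊗ W) ≫ Z.obj X ◁ F.comul Y W =
        F.unit _ ≫ F.comul (X ⊗ Y) W ≫ F.comul X Y ▷ Z.obj W ≫
          (α_ (Z.obj X) (Z.obj Y) (Z.obj W)).hom
      rw [reassoc_of% unit_map, reassoc_of% unit_comul, reassoc_of% unit_comul, ← id_tensorHom,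
        ← tensorHom_id,
        tensorHom_comp_tensorHom, tensorHom_comp_tensorHom_assoc, unit_comul, unit_comul]
      simp)
  T₂_right_unit X := F.ext_f (F.comulHom X (𝟙_ C) ≫ F.free X ◁ F.unitHom ≫ (ρ_ (F.free X)).hom)
    (F.map (ρ_ X).hom) (by
      change F.unit _ ≫ F.comul X (𝟙_ C) ≫ Z.obj X ◁ F.counit ≫ (ρ_ (Z.obj X)).hom =
        F.unit _ ≫ Z.map (ρ_ X).hom
      rw [unit_map, reassoc_of% unit_comul, ← id_tensorHom, tensorHom_comp_tensorHom_assoc,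
        unit_counit]
      simp)
  T₂_left_unit X := F.ext_f (F.comulHom (𝟙_ C) X ≫ F.unitHom ▷ F.free X ≫ (λ_ (F.free X)).hom)
    (F.map (λ_ X).hom) (by
      change F.unit _ ≫ F.comul (𝟙_ C) X ≫ F.counit ▷ Z.obj X ≫ (λ_ (Z.obj X)).hom =
        F.unit _ ≫ Z.map (λ_ X).hom
      rw [unit_map, reassoc_of% unit_comul, ← tensorHom_id, tensorHom_comp_tensorHom_assoc,
        unit_counit]
      simp)
  T₂_μ X Y := F.ext_f (F.mulHom (X ⊗ Y) ≫ F.comulHom X Y)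
    (F.map (F.comul X Y) ≫ F.comulHom (Z.obj X) (Z.obj Y) ≫ (F.mulHom X ⊗ₘ F.mulHom Y)) (by
      change F.unit _ ≫ F.mul (X ⊗ Y) ≫ F.comul X Y = F.unit _ ≫ Z.map (F.comul X Y) ≫
        F.comul (Z.obj X) (Z.obj Y) ≫ (F.mul X ⊗ₘ F.mul Y)
      rw [reassoc_of% unit_mul, reassoc_of% unit_map, reassoc_of% unit_comul,
        tensorHom_comp_tensorHom, unit_mul,
        unit_mul, id_tensorHom_id, Category.comp_id])
  T₀_μ := F.mul_act (unitBraiding C)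
  T₂_η := F.unit_comul
  T₀_η := F.unit_counit

/-! #### Antipodes -/

/-- The left antipode. -/
def sl (X : C) : Z.obj (ldual (Z.obj X)) ⟶ ldual X :=
  F.act (ldualHalfBraiding (F.hb X)) ≫ ldualMap (F.unit X)

/-- The right antipode. -/
def sr (X : C) : Z.obj (rdual (Z.obj X)) ⟶ rdual X :=
  F.act (rdualHalfBraiding (F.hb X)) ≫ rdualMap (F.unit X)

lemma act_ldualMap {M N : C} {b : HalfBraiding M} {c : HalfBraiding N}
    (f : centerMk b ⟶ centerMk c) :
    Z.map (ldualMap (centerHom f)) ≫ F.act (ldualHalfBraiding b) =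
      F.act (ldualHalfBraiding c) ≫ ldualMap (centerHom f) := by
  have h := F.act_natural (b := ldualHalfBraiding c) (c := ldualHalfBraiding b) (ldualMap f)
  have e : centerHom (b := ldualHalfBraiding c) (c := ldualHalfBraiding b) (ldualMap f) =
    ldualMap (centerHom f) := center_ldualMap_f f
  rwa [e] at h

lemma act_rdualMap {M N : C} {b : HalfBraiding M} {c : HalfBraiding N}
    (f : centerMk b ⟶ centerMk c) :
    Z.map (rdualMap (centerHom f)) ≫ F.act (rdualHalfBraiding b) =
      F.act (rdualHalfBraiding c) ≫ rdualMap (centerHom f) := by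
  have h := F.act_natural (b := rdualHalfBraiding c) (c := rdualHalfBraiding b) (rdualMap f)
  have e : centerHom (b := rdualHalfBraiding c) (c := rdualHalfBraiding b) (rdualMap f) =
    rdualMap (centerHom f) := center_rdualMap_f f
  rwa [e] at h

lemma sl_natural {X Y : C} (f : X ⟶ Y) :
    Z.map (ldualMap (Z.map f)) ≫ F.sl X = F.sl Y ≫ ldualMap f := by
  have h := (reassoc_of% F.act_ldualMap (F.map f)) (ldualMap (F.unit X))
  refine h.trans ?_
  change F.act (ldualHalfBraiding (F.hb Y)) ≫ ldualMap (Z.map f) ≫ _ = _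
  rw [← ldualMap_comp, unit_map, ldualMap_comp, sl, Category.assoc]

lemma sr_natural {X Y : C} (f : X ⟶ Y) :
    Z.map (rdualMap (Z.map f)) ≫ F.sr X = F.sr Y ≫ rdualMap f := by
  have h := (reassoc_of% F.act_rdualMap (F.map f)) (rdualMap (F.unit X))
  refine h.trans ?_
  change F.act (rdualHalfBraiding (F.hb Y)) ≫ rdualMap (Z.map f) ≫ _ = _
  rw [← rdualMap_comp, unit_map, rdualMap_comp, sr, Category.assoc]

/-- The unit in the definition of the antipode cancels against the dual of the multiplication,
leaving the action on the dual of the free object, the form in which the antipode enters `sl_ev`. -/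
lemma sl_mul (X : C) : Z.map (ldualMap (F.mul X)) ≫ F.sl (Z.obj X) =
    F.act (ldualHalfBraiding (F.hb X)) := by
  have h := (reassoc_of% F.act_ldualMap (F.mulHom X)) (ldualMap (F.unit (Z.obj X)))
  refine h.trans ?_
  change F.act (ldualHalfBraiding (F.hb X)) ≫ ldualMap (F.mul X) ≫ _ = _
  rw [← ldualMap_comp, unit_mul, ldualMap_id, Category.comp_id]

lemma sr_mul (X : C) : Z.map (rdualMap (F.mul X)) ≫ F.sr (Z.obj X) =
    F.act (rdualHalfBraiding (F.hb X)) := by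
  have h := (reassoc_of% F.act_rdualMap (F.mulHom X)) (rdualMap (F.unit (Z.obj X)))
  refine h.trans ?_
  change F.act (rdualHalfBraiding (F.hb X)) ≫ rdualMap (F.mul X) ≫ _ = _
  rw [← rdualMap_comp, unit_mul, rdualMap_id, Category.comp_id]

/-- After `sl_mul` both sides lift to the center, because the evaluation of the free object does; on
the unit they agree by dinaturality of `ev`. -/
lemma sl_ev (X : C) : Z.map (ldualMap (F.unit X) ▷ X) ≫ Z.map (ev X) ≫ F.counit =
    F.comul (ldual (Z.obj X)) X ≫
      ((Z.map (ldualMap (F.mul X)) ≫ F.sl (Z.obj X)) ▷ Z.obj X) ≫ ev (Z.obj X) := by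
  rw [sl_mul]
  exact F.ext_f (F.map (ldualMap (F.unit X) ▷ X) ≫ F.map (ev X) ≫ F.unitHom)
    (F.comulHom (ldual (Z.obj X)) X ≫
      (F.counitHom (ldualHalfBraiding (F.hb X)) ▷ F.free X) ≫ ev (F.free X)) (by
      change F.unit _ ≫ Z.map (ldualMap (F.unit X) ▷ X) ≫ Z.map (ev X) ≫ F.counit =
        F.unit _ ≫ F.comul (ldual (Z.obj X)) X ≫
          F.act (ldualHalfBraiding (F.hb X)) ▷ Z.obj X ≫ ev (Z.obj X)
      rw [reassoc_of% unit_map, reassoc_of% unit_map, unit_counit, reassoc_of% unit_comul,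
        Category.comp_id,
        ldualMap_ev, ← tensorHom_id, tensorHom_comp_tensorHom_assoc, unit_act, Category.comp_id,
        id_tensorHom])

lemma sr_ev (X : C) : Z.map (X ◁ rdualMap (F.unit X)) ≫ Z.map (evr X) ≫ F.counit =
    F.comul X (rdual (Z.obj X)) ≫
      (Z.obj X ◁ (Z.map (rdualMap (F.mul X)) ≫ F.sr (Z.obj X))) ≫ evr (Z.obj X) := by
  rw [sr_mul]
  exact F.ext_f (F.map (X ◁ rdualMap (F.unit X)) ≫ F.map (evr X) ≫ F.unitHom)
    (F.comulHom X (rdual (Z.obj X)) ≫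
      (F.free X ◁ F.counitHom (rdualHalfBraiding (F.hb X))) ≫ evr (F.free X)) (by
      change F.unit _ ≫ Z.map (X ◁ rdualMap (F.unit X)) ≫ Z.map (evr X) ≫ F.counit =
        F.unit _ ≫ F.comul X (rdual (Z.obj X)) ≫
          Z.obj X ◁ F.act (rdualHalfBraiding (F.hb X)) ≫ evr (Z.obj X)
      rw [reassoc_of% unit_map, reassoc_of% unit_map, unit_counit, reassoc_of% unit_comul,
        Category.comp_id,
        rdualMap_evr, ← id_tensorHom, tensorHom_comp_tensorHom_assoc, unit_act, Category.comp_id,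
        tensorHom_id])

/-- The coevaluation of the free object is a morphism of the center, hence commutes with the
actions; the action on its target is given by `act_tensor`. -/
lemma sl_coev (X : C) : F.counit ≫ coev X ≫ F.unit X ▷ ldual X =
    Z.map (coev (Z.obj X)) ≫ F.comul (Z.obj X) (ldual (Z.obj X)) ≫ (F.mul X ⊗ₘ F.sl X) := by
  have h : Z.map (coev (Z.obj X)) ≫ F.act (tensorBraiding (F.hb X) (ldualHalfBraiding (F.hb X))) =
      F.counit ≫ coev (Z.obj X) :=
    F.act_natural (b := unitBraiding C)
      (c := tensorBraiding (F.hb X) (ldualHalfBraiding (F.hb X))) (coev (F.free X))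
  have h2 : F.mul X ⊗ₘ F.sl X = (F.act (F.hb X) ⊗ₘ F.act (ldualHalfBraiding (F.hb X))) ≫
      Z.obj X ◁ ldualMap (F.unit X) := by
    rw [← id_tensorHom, tensorHom_comp_tensorHom, Category.comp_id]; rfl
  rw [act_tensor] at h
  rw [h2, ← coev_ldualMap, ← Category.assoc, ← Category.assoc, ← Category.assoc, ← h]
  simp only [Category.assoc]

lemma sr_coev (X : C) : F.counit ≫ coevr X ≫ rdual X ◁ F.unit X =
    Z.map (coevr (Z.obj X)) ≫ F.comul (rdual (Z.obj X)) (Z.obj X) ≫ (F.sr X ⊗ₘ F.mul X) := by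
  have h : Z.map (coevr (Z.obj X)) ≫ F.act (tensorBraiding (rdualHalfBraiding (F.hb X)) (F.hb X)) =
      F.counit ≫ coevr (Z.obj X) :=
    F.act_natural (b := unitBraiding C)
      (c := tensorBraiding (rdualHalfBraiding (F.hb X)) (F.hb X)) (coevr (F.free X))
  have h2 : F.sr X ⊗ₘ F.mul X = (F.act (rdualHalfBraiding (F.hb X)) ⊗ₘ F.act (F.hb X)) ≫
      rdualMap (F.unit X) ▷ Z.obj X := by
    rw [← tensorHom_id, tensorHom_comp_tensorHom, Category.comp_id]; rfl
  rw [act_tensor] at h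
  rw [h2, ← coevr_rdualMap, ← Category.assoc, ← Category.assoc, ← Category.assoc, ← h]
  simp only [Category.assoc]

/-- The Hopf monad structure of the free-forgetful adjunction of the center. -/
def hopfMonad : HopfMonadStructure Z where
  toBimonadStructure := F.bimonad
  sl := F.sl
  sl_natural := F.sl_natural
  sl_ev := F.sl_ev
  sl_coev := F.sl_coev
  sr := F.sr
  sr_natural := F.sr_natural
  sr_ev := F.sr_ev
  sr_coev := F.sr_coev

end FreeCenter
end FreeCenter
end
end FusionCenter

namespace FusionCenter

noncomputable section

set_option linter.unusedSectionVars false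

section FreeCenter

variable {C : Type u} [Category.{v} C] [MonoidalCategory C] [RigidCategory C]

lemma tensorBraiding_hom {M N : C} (b : HalfBraiding M) (c : HalfBraiding N) (U : C) :
    ((tensorBraiding b c).β U).hom = (α_ M N U).hom ≫ M ◁ (c.β U).hom ≫ (α_ M U N).inv ≫
      (b.β U).hom ▷ N ≫ (α_ U M N).hom := rfl

lemma centerHom_comm {M N : C} {b : HalfBraiding M} {c : HalfBraiding N}
    (f : centerMk b ⟶ centerMk c) (U : C) :
    centerHom f ▷ U ≫ (c.β U).hom = (b.β U).hom ≫ U ◁ centerHom f := f.comm U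

namespace FreeCenter

variable {Z : C ⥤ C} (F : FreeCenter Z)

/-! #### The R-matrix -/

lemma act_comm {M : C} (b : HalfBraiding M) (U : C) :
    F.act b ▷ U ≫ (b.β U).hom = ((F.hb M).β U).hom ≫ U ◁ F.act b := (F.counitHom b).comm U

lemma mul_comm (X U : C) :
    F.mul X ▷ U ≫ ((F.hb X).β U).hom = ((F.hb (Z.obj X)).β U).hom ≫ U ◁ F.mul X :=
  F.act_comm (F.hb X) U

lemma comul_comm (X Y U : C) :
    F.comul X Y ▷ U ≫ ((tensorBraiding (F.hb X) (F.hb Y)).β U).hom =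
      ((F.hb (X ⊗ Y)).β U).hom ≫ U ◁ F.comul X Y := (F.comulHom X Y).comm U

/-- The action commutes with half-braidings and splits the unit. Hence any half-braiding is
recovered from the free one and the action, which makes the passage to modules invertible. -/
lemma unit_braiding_act {M : C} (b : HalfBraiding M) (U : C) :
    F.unit M ▷ U ≫ ((F.hb M).β U).hom ≫ U ◁ F.act b = (b.β U).hom := by
  rw [← act_comm, ← comp_whiskerRight_assoc, unit_act, id_whiskerRight, Category.id_comp]

/-- The R-matrix. -/
def R (X Y : C) : X ⊗ Y ⟶ Z.obj Y ⊗ Z.obj X :=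
  (F.unit X ⊗ₘ F.unit Y) ≫ ((F.hb X).β (Z.obj Y)).hom

lemma R_eq (X Y : C) : F.R X Y = F.unit X ▷ Y ≫ ((F.hb X).β Y).hom ≫ F.unit Y ▷ Z.obj X := by
  rw [← (F.hb X).naturality, R, MonoidalCategory.tensorHom_def, Category.assoc]

lemma R_act {M N : C} (b : HalfBraiding M) (c : HalfBraiding N) :
    F.R M N ≫ (F.act c ⊗ₘ F.act b) = (b.β N).hom := by
  rw [R_eq, MonoidalCategory.tensorHom_def, Category.assoc, Category.assoc,
    ← comp_whiskerRight_assoc, unit_act, id_whiskerRight, Category.id_comp, unit_braiding_act]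

lemma R_natural {X X' Y Y' : C} (f : X ⟶ X') (g : Y ⟶ Y') :
    (f ⊗ₘ g) ≫ F.R X' Y' = F.R X Y ≫ (Z.map g ⊗ₘ Z.map f) := by
  rw [R, tensorHom_comp_tensorHom_assoc, ← unit_map, ← unit_map, ← tensorHom_comp_tensorHom_assoc,
    R, Category.assoc]
  congr 1
  rw [MonoidalCategory.tensorHom_def', Category.assoc, F.map_comm, ← Category.assoc,
    (F.hb X).naturality, Category.assoc, MonoidalCategory.tensorHom_def]

/-- By `R_act` and `act_tensor`, this says that the braiding of two free objects is a morphism of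
the center. -/
lemma R_linear (X Y : C) : F.comul X Y ≫ F.R (Z.obj X) (Z.obj Y) ≫ (F.mul Y ⊗ₘ F.mul X) =
    Z.map (F.R X Y) ≫ F.comul (Z.obj Y) (Z.obj X) ≫ (F.mul Y ⊗ₘ F.mul X) := by
  have h : F.R (Z.obj X) (Z.obj Y) ≫ (F.mul Y ⊗ₘ F.mul X) = _ := F.R_act (F.hb X) (F.hb Y)
  have h2 : F.comul (Z.obj Y) (Z.obj X) ≫ (F.mul Y ⊗ₘ F.mul X) = _ :=
    (F.act_tensor (F.hb Y) (F.hb X)).symm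
  rw [h, h2]
  exact F.ext_f (F.comulHom X Y ≫ (β_ (F.free X) (F.free Y)).hom)
    (F.map (F.R X Y) ≫ F.counitHom (tensorBraiding (F.hb Y) (F.hb X))) (by
      change F.unit _ ≫ F.comul X Y ≫ ((F.hb X).β (Z.obj Y)).hom =
        F.unit _ ≫ Z.map (F.R X Y) ≫ F.act (tensorBraiding (F.hb Y) (F.hb X))
      rw [reassoc_of% unit_map, unit_act, Category.comp_id, reassoc_of% unit_comul, R])

/-- Since the comultiplication is a morphism of the center, the half-braiding of the free object on
`X ⊗ Y` becomes that of a tensor product, which is defined by the hexagon. -/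
lemma R_tensor_left (X Y W : C) : F.R (X ⊗ Y) W ≫ Z.obj W ◁ F.comul X Y =
    (α_ X Y W).hom ≫ X ◁ F.R Y W ≫ (α_ _ _ _).inv ≫ F.R X (Z.obj W) ▷ Z.obj Y ≫
      (α_ _ _ _).hom ≫ F.mul W ▷ (Z.obj X ⊗ Z.obj Y) := by
  have h : F.R X (Z.obj W) ≫ F.mul W ▷ Z.obj X = F.unit X ▷ Z.obj W ≫ ((F.hb X).β _).hom := by
    rw [R, Category.assoc, ← (F.hb X).naturality, MonoidalCategory.tensorHom_def, Category.assoc,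
      ← MonoidalCategory.whiskerLeft_comp_assoc, unit_mul, MonoidalCategory.whiskerLeft_id,
      Category.id_comp]
  calc _ = (F.unit (X ⊗ Y) ⊗ₘ F.unit W) ≫ F.comul X Y ▷ Z.obj W ≫
        ((tensorBraiding (F.hb X) (F.hb Y)).β (Z.obj W)).hom := by
        rw [comul_comm, R, Category.assoc]
    _ = ((F.unit X ⊗ₘ F.unit Y) ⊗ₘ F.unit W) ≫
        ((tensorBraiding (F.hb X) (F.hb Y)).β (Z.obj W)).hom := by
        rw [← tensorHom_id, tensorHom_comp_tensorHom_assoc, unit_comul, Category.comp_id]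
    _ = (α_ X Y W).hom ≫ X ◁ F.R Y W ≫ (α_ _ _ _).inv ≫
        (F.R X (Z.obj W) ≫ F.mul W ▷ Z.obj X) ▷ Z.obj Y ≫ (α_ _ _ _).hom := by
        rw [h, tensorBraiding_hom, associator_naturality_assoc,
          MonoidalCategory.tensorHom_def' (F.unit X), Category.assoc, ← whisker_exchange_assoc]
        simp [R]
    _ = _ := by
        simp

/-- The other hexagon: multiplicativity of the half-braiding of the free object on `X`. -/
lemma R_tensor_right (X Y W : C) : F.R X (Y ⊗ W) ≫ F.comul Y W ▷ Z.obj X =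
    (α_ X Y W).inv ≫ F.R X Y ▷ W ≫ (α_ _ _ _).hom ≫ Z.obj Y ◁ F.R (Z.obj X) W ≫
      (α_ _ _ _).inv ≫ (Z.obj Y ⊗ Z.obj W) ◁ F.mul X := by
  have h : F.R (Z.obj X) W ≫ Z.obj W ◁ F.mul X = Z.obj X ◁ F.unit W ≫ ((F.hb X).β _).hom := by
    rw [R, Category.assoc, ← mul_comm, MonoidalCategory.tensorHom_def', Category.assoc,
      ← comp_whiskerRight_assoc, unit_mul, id_whiskerRight, Category.id_comp]
  calc _ = (F.unit X ⊗ₘ (F.unit Y ⊗ₘ F.unit W)) ≫ ((F.hb X).β (Z.obj Y ⊗ Z.obj W)).hom := by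
        rw [R, Category.assoc, ← (F.hb X).naturality, ← id_tensorHom,
          tensorHom_comp_tensorHom_assoc, unit_comul, Category.comp_id]
    _ = (α_ X Y W).inv ≫ F.R X Y ▷ W ≫ (α_ _ _ _).hom ≫
        Z.obj Y ◁ (F.R (Z.obj X) W ≫ Z.obj W ◁ F.mul X) ≫ (α_ _ _ _).inv := by
        rw [h, HalfBraiding.monoidal, associator_inv_naturality_assoc,
          MonoidalCategory.tensorHom_def (_ ⊗ₘ _) (F.unit W), Category.assoc,
            whisker_exchange_assoc]
        simp [R, -HalfBraiding.naturality]
    _ = _ := by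
        simp

/-- The quasitriangular Hopf monad of the free-forgetful adjunction of the center. -/
def quasitriangular : QuasitriangularHopfMonadStructure Z where
  toHopfMonadStructure := F.hopfMonad
  R := F.R
  R_natural := F.R_natural
  R_linear := F.R_linear
  R_tensor_left := F.R_tensor_left
  R_tensor_right := F.R_tensor_right

/-! #### Modules -/

/-- The half-braiding of a module. -/
def moduleBraiding {M : C} (r : Z.obj M ⟶ M) (h₁ : F.unit M ≫ r = 𝟙 M)
    (h₂ : F.mul M ≫ r = Z.map r ≫ r) : HalfBraiding M :=
  HalfBraiding.ofLax (fun U => F.unit M ▷ U ≫ ((F.hb M).β U).hom ≫ U ◁ r)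
    (fun {U U'} f => by
      rw [whisker_exchange_assoc, HalfBraiding.naturality_assoc, ← whisker_exchange]
      simp only [Category.assoc])
    (fun U U' => by
      -- The action intertwines the free half-braiding with the new one. This is where associativity
      -- of `r` enters, and it reduces multiplicativity to that of the free half-braiding.
      have h : ∀ W : C, r ▷ W ≫ F.unit M ▷ W ≫ ((F.hb M).β W).hom ≫ W ◁ r =
          ((F.hb M).β W).hom ≫ W ◁ r := fun W => by
        rw [← comp_whiskerRight_assoc, ← unit_map, comp_whiskerRight_assoc,
          ← Category.assoc (Z.map r ▷ W),
          F.map_comm, Category.assoc, ← MonoidalCategory.whiskerLeft_comp, ← h₂,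
          MonoidalCategory.whiskerLeft_comp, ← reassoc_of% mul_comm, ← comp_whiskerRight_assoc,
            unit_mul,
          id_whiskerRight, Category.id_comp]
      calc _ = (α_ M U U').inv ≫ (F.unit M ▷ U ≫ ((F.hb M).β U).hom) ▷ U' ≫ (α_ _ _ _).hom ≫
            U ◁ (((F.hb M).β U').hom ≫ U' ◁ r) ≫ (α_ _ _ _).inv := by
            rw [HalfBraiding.monoidal]; simp
        _ = (α_ M U U').inv ≫ (F.unit M ▷ U ≫ ((F.hb M).β U).hom) ▷ U' ≫ (α_ _ _ _).hom ≫
            U ◁ (r ▷ U' ≫ F.unit M ▷ U' ≫ ((F.hb M).β U').hom ≫ U' ◁ r) ≫ (α_ _ _ _).inv := by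
            rw [h]
        _ = _ := by simp)
    (by
      rw [halfBraiding_unit, Category.assoc, ← leftUnitor_inv_naturality,
        rightUnitor_naturality_assoc,
        reassoc_of% h₁])

lemma moduleBraiding_hom {M : C} (r : Z.obj M ⟶ M) (h₁ : F.unit M ≫ r = 𝟙 M)
    (h₂ : F.mul M ≫ r = Z.map r ≫ r) (U : C) : ((F.moduleBraiding r h₁ h₂).β U).hom =
      F.unit M ▷ U ≫ ((F.hb M).β U).hom ≫ U ◁ r := rfl

lemma moduleBraiding_comm {M : C} (r : Z.obj M ⟶ M) (h₁ : F.unit M ≫ r = 𝟙 M)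
    (h₂ : F.mul M ≫ r = Z.map r ≫ r) (W : C) :
    r ▷ W ≫ ((F.moduleBraiding r h₁ h₂).β W).hom = ((F.hb M).β W).hom ≫ W ◁ r := by
  rw [moduleBraiding_hom, ← comp_whiskerRight_assoc, ← unit_map, comp_whiskerRight_assoc,
    ← Category.assoc (Z.map r ▷ W), F.map_comm, Category.assoc,
    ← MonoidalCategory.whiskerLeft_comp, ← h₂, MonoidalCategory.whiskerLeft_comp,
    ← reassoc_of% mul_comm, ← comp_whiskerRight_assoc, unit_mul, id_whiskerRight, Category.id_comp]

/-- The morphism `r` lifts to the center by `moduleBraiding_comm` and splits the unit, so it is the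
action. -/
lemma act_moduleBraiding {M : C} (r : Z.obj M ⟶ M) (h₁ : F.unit M ≫ r = 𝟙 M)
    (h₂ : F.mul M ≫ r = Z.map r ≫ r) : F.act (F.moduleBraiding r h₁ h₂) = r :=
  F.ext_f (F.counitHom (F.moduleBraiding r h₁ h₂))
    (⟨r, F.moduleBraiding_comm r h₁ h₂⟩ : F.free M ⟶ centerMk (F.moduleBraiding r h₁ h₂))
    ((F.unit_act _).trans h₁.symm)

lemma moduleBraiding_act {M : C} (b : HalfBraiding M) :
    F.moduleBraiding (F.act b) (F.unit_act b) (F.mul_act b) = b := by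
  ext U
  exact F.unit_braiding_act b U

lemma moduleBraiding_natural {M N : C} (r : Z.obj M ⟶ M) (h₁ : F.unit M ≫ r = 𝟙 M)
    (h₂ : F.mul M ≫ r = Z.map r ≫ r) (s : Z.obj N ⟶ N) (h₁' : F.unit N ≫ s = 𝟙 N)
    (h₂' : F.mul N ≫ s = Z.map s ≫ s) (f : M ⟶ N) (hf : Z.map f ≫ s = r ≫ f) (U : C) :
    f ▷ U ≫ ((F.moduleBraiding s h₁' h₂').β U).hom =
      ((F.moduleBraiding r h₁ h₂).β U).hom ≫ U ◁ f := by
  rw [moduleBraiding_hom, moduleBraiding_hom, ← comp_whiskerRight_assoc, ← unit_map,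
    comp_whiskerRight_assoc, ← Category.assoc (Z.map f ▷ U), F.map_comm]
  simp only [Category.assoc, ← MonoidalCategory.whiskerLeft_comp, hf]

/-- The category of modules. -/
abbrev Mod := F.quasitriangular.Modules

lemma unit_module (M : F.Mod) : F.unit M.A ≫ M.a = 𝟙 M.A := M.unit

lemma mul_module (M : F.Mod) : F.mul M.A ≫ M.a = Z.map M.a ≫ M.a := M.assoc

/-- The half-braiding of a module. -/
abbrev modBraiding (M : F.Mod) : HalfBraiding M.A :=
  F.moduleBraiding M.a (F.unit_module M) (F.mul_module M)

lemma act_modBraiding (M : F.Mod) : F.act (F.modBraiding M) = M.a := F.act_moduleBraiding _ _ _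

lemma modBraiding_natural {M N : F.Mod} (f : M ⟶ N) (U : C) :
    f.f ▷ U ≫ ((F.modBraiding N).β U).hom = ((F.modBraiding M).β U).hom ≫ U ◁ f.f :=
  F.moduleBraiding_natural _ _ _ _ _ _ f.f f.h U

/-- The functor from modules to the center. -/
def toCenter : F.Mod ⥤ Center C where
  obj M := centerMk (F.modBraiding M)
  map f := ⟨f.f, F.modBraiding_natural f⟩

/-- The action of the monad on the forgetful functor from the center. -/
def actionOn : F.quasitriangular.ActionOn (Center.forget C) where
  act A := F.act A.2
  unit A := F.unit_act A.2
  assoc A := F.mul_act A.2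
  linear {A A'} f := F.act_natural (b := A.2) (c := A'.2) f

end FreeCenter
end FreeCenter
end
end FusionCenter

/-! ### The isomorphism between the center and the category of modules -/

namespace FusionCenter

noncomputable section

set_option linter.unusedSectionVars false

section FreeCenter

variable {C : Type u} [Category.{v} C] [MonoidalCategory C] [RigidCategory C]

/-- The composites of the comparison functors fix objects only up to a proved equality, so
`Functor.hext` requires their effect on morphisms to be compared heterogeneously. -/
lemma Center.hom_heq {A A' B B' : Center C} (hA : A = A') (hB : B = B') (f : A ⟶ B)
    (g : A' ⟶ B') (h : HEq f.f g.f) : HEq f g := by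
  subst hA hB
  exact heq_of_eq (Center.ext _ _ (eq_of_heq h))

lemma Modules.hom_heq {T : C ⥤ C} {B : BimonadStructure T} {M M' N N' : B.Modules} (hM : M = M')
    (hN : N = N') (f : M ⟶ N) (g : M' ⟶ N') (h : HEq f.f g.f) : HEq f g := by
  subst hM hN
  exact heq_of_eq (Monad.Algebra.Hom.ext (eq_of_heq h))

lemma tensorBraiding_reverse {M N : C} (b : HalfBraiding M) (c : HalfBraiding N) (U : C) :
    (α_ M N U).inv ≫ ((tensorBraiding b c).β U).hom ≫ (α_ U M N).inv =
      M ◁ (c.β U).hom ≫ (α_ M U N).inv ≫ (b.β U).hom ▷ N := by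
  rw [tensorBraiding_hom]
  simp

namespace FreeCenter

variable {Z : C ⥤ C} (F : FreeCenter Z)

lemma lift_toCenter : F.actionOn.lift ⋙ F.toCenter = 𝟭 _ := by
  have h : ∀ A : Center C, (F.actionOn.lift ⋙ F.toCenter).obj A = A := fun A => by
    obtain ⟨M, b⟩ := A
    exact congrArg centerMk (F.moduleBraiding_act b)
  exact Functor.hext h (fun A B f => Center.hom_heq (h A) (h B) _ _ HEq.rfl)

lemma toCenter_lift : F.toCenter ⋙ F.actionOn.lift = 𝟭 _ := by
  have h : ∀ M : F.Mod, (F.toCenter ⋙ F.actionOn.lift).obj M = M := fun M => by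
    obtain ⟨M, r, h₁, h₂⟩ := M
    have e := F.act_moduleBraiding r h₁ h₂
    change F.quasitriangular.mkModule M (F.act (F.moduleBraiding r h₁ h₂)) _ _ = _
    congr 1
  exact Functor.hext h (fun A B f => Modules.hom_heq (h A) (h B) _ _ HEq.rfl)

lemma tensor_a (M N : F.Mod) :
    (M ⊗ N).a = F.act (tensorBraiding (F.modBraiding M) (F.modBraiding N)) := by
  rw [act_tensor, act_modBraiding, act_modBraiding]
  rfl

/-- The action on a tensor product of modules is the one attached to the tensor product
half-braiding, and a half-braiding is determined by its action. -/
lemma modBraiding_tensor (M N : F.Mod) :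
    F.modBraiding (M ⊗ N) = tensorBraiding (F.modBraiding M) (F.modBraiding N) := by
  ext U
  refine Eq.trans ?_ (F.unit_braiding_act (tensorBraiding (F.modBraiding M) (F.modBraiding N)) U)
  rw [← tensor_a]
  rfl

/-- The braiding of modules. -/
def modulesBraiding (M N : F.Mod) : M ⊗ N ≅ N ⊗ M :=
  BimonadStructure.mkIso ((F.modBraiding M).β N.A) (by
    have h := F.act_natural (b := tensorBraiding (F.modBraiding M) (F.modBraiding N))
      (c := tensorBraiding (F.modBraiding N) (F.modBraiding M))
      (β_ (centerMk (F.modBraiding M)) (centerMk (F.modBraiding N))).hom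
    rw [← tensor_a, ← tensor_a] at h
    exact h)

lemma modulesBraiding_f (M N : F.Mod) :
    (F.modulesBraiding M N).hom.f = ((F.modBraiding M).β N.A).hom := rfl

lemma modulesBraiding_eq (M N : F.Mod) :
    (F.modulesBraiding M N).hom.f = F.R M.A N.A ≫ (N.a ⊗ₘ M.a) := by
  rw [modulesBraiding_f, ← F.R_act (F.modBraiding M) (F.modBraiding N), act_modBraiding,
    act_modBraiding]

instance modulesBraided : BraidedCategory F.Mod where
  braiding := F.modulesBraiding
  braiding_naturality_right M N P f := Monad.Algebra.Hom.ext (by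
    change (𝟙 M.A ⊗ₘ f.f) ≫ ((F.modBraiding M).β P.A).hom =
      ((F.modBraiding M).β N.A).hom ≫ (f.f ⊗ₘ 𝟙 M.A)
    rw [id_tensorHom, tensorHom_id, HalfBraiding.naturality])
  braiding_naturality_left {M N} f P := Monad.Algebra.Hom.ext (by
    change (f.f ⊗ₘ 𝟙 P.A) ≫ ((F.modBraiding N).β P.A).hom =
      ((F.modBraiding M).β P.A).hom ≫ (𝟙 P.A ⊗ₘ f.f)
    rw [id_tensorHom, tensorHom_id, modBraiding_natural])
  hexagon_forward M N P := Monad.Algebra.Hom.ext (by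
    change (α_ M.A N.A P.A).hom ≫ ((F.modBraiding M).β (N.A ⊗ P.A)).hom ≫ (α_ N.A P.A M.A).hom =
      (((F.modBraiding M).β N.A).hom ⊗ₘ 𝟙 P.A) ≫ (α_ N.A M.A P.A).hom ≫
        (𝟙 N.A ⊗ₘ ((F.modBraiding M).β P.A).hom)
    rw [HalfBraiding.monoidal]
    simp)
  hexagon_reverse M N P := Monad.Algebra.Hom.ext (by
    change (α_ M.A N.A P.A).inv ≫ ((F.modBraiding (M ⊗ N)).β P.A).hom ≫ (α_ P.A M.A N.A).inv =
      (𝟙 M.A ⊗ₘ ((F.modBraiding N).β P.A).hom) ≫ (α_ M.A P.A N.A).inv ≫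
        (((F.modBraiding M).β P.A).hom ⊗ₘ 𝟙 N.A)
    refine (congrArg (fun b : HalfBraiding (M.A ⊗ N.A) => (α_ M.A N.A P.A).inv ≫ (b.β P.A).hom ≫
      (α_ P.A M.A N.A).inv) (F.modBraiding_tensor M N)).trans ?_
    rw [id_tensorHom, tensorHom_id, tensorBraiding_reverse])

/-- The strict monoidal structure of the comparison functor. -/
def liftCore : F.actionOn.lift.CoreMonoidal where
  εIso := BimonadStructure.mkIso (Iso.refl (𝟙_ C)) (by
    change Z.map (𝟙 _) ≫ F.counit = F.counit ≫ 𝟙 _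
    simp)
  -- The identity serves as structure morphism; that it is linear is precisely `act_tensor`.
  μIso A B := BimonadStructure.mkIso (Iso.refl (A.1 ⊗ B.1)) (by
    change Z.map (𝟙 _) ≫ F.act (tensorBraiding A.2 B.2) =
      (F.comul A.1 B.1 ≫ (F.act A.2 ⊗ₘ F.act B.2)) ≫ 𝟙 _
    rw [act_tensor]
    simp)
  μIso_hom_natural_left {A B} f A' := Monad.Algebra.Hom.ext (by
    change (f.f ⊗ₘ 𝟙 A'.1) ≫ 𝟙 _ = 𝟙 _ ≫ (f.f ▷ A'.1)
    simp)
  μIso_hom_natural_right A' f := Monad.Algebra.Hom.ext (by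
    change (𝟙 A'.1 ⊗ₘ f.f) ≫ 𝟙 _ = 𝟙 _ ≫ (A'.1 ◁ f.f)
    simp)
  associativity X Y W := Monad.Algebra.Hom.ext (by
    change (𝟙 _ ⊗ₘ 𝟙 W.1) ≫ 𝟙 _ ≫ (α_ X.1 Y.1 W.1).hom =
      (α_ X.1 Y.1 W.1).hom ≫ (𝟙 X.1 ⊗ₘ 𝟙 _) ≫ 𝟙 _
    simp)
  left_unitality X := Monad.Algebra.Hom.ext (by
    change (λ_ X.1).hom = (𝟙 _ ⊗ₘ 𝟙 X.1) ≫ 𝟙 _ ≫ (λ_ X.1).hom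
    simp)
  right_unitality X := Monad.Algebra.Hom.ext (by
    change (ρ_ X.1).hom = (𝟙 X.1 ⊗ₘ 𝟙 _) ≫ 𝟙 _ ≫ (ρ_ X.1).hom
    simp)

instance liftMonoidal : F.actionOn.lift.Monoidal := F.liftCore.toMonoidal

instance liftBraided : F.actionOn.lift.Braided where
  braided A B := Monad.Algebra.Hom.ext (by
    change 𝟙 _ ≫ (A.2.β B.1).hom = ((F.moduleBraiding (F.act A.2) (F.unit_act _)
      (F.mul_act _)).β B.1).hom ≫ 𝟙 _
    rw [Category.id_comp]
    refine Eq.trans ?_ (Category.comp_id _).symm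
    exact (F.unit_braiding_act A.2 B.1).symm)

end FreeCenter
end FreeCenter
end
end FusionCenter

/-! ### The twist of the center and of the monad -/

namespace FusionCenter

noncomputable section

set_option linter.unusedSectionVars false

section Braided

variable {B : Type u} [Category.{v} B] [MonoidalCategory B] [BraidedCategory B] [RigidCategory B]
  (S : SovereignStructure B)

lemma SovereignStructure.twistHom_eq (X : B) : S.twistHom X = (λ_ X).inv ≫ S.coev' X ▷ X ≫
    (α_ _ _ _).hom ≫ ldual X ◁ (β_ X X).hom ≫ (α_ _ _ _).inv ≫ ev X ▷ X ≫ (λ_ _).hom := by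
  simp only [twistHom]; monoidal

lemma SovereignStructure.twistHom'_eq (X : B) : S.twistHom' X = (ρ_ X).inv ≫ X ◁ coev X ≫
    (α_ _ _ _).inv ≫ (β_ X X).hom ▷ ldual X ≫ (α_ _ _ _).hom ≫ X ◁ S.ev' X ≫ (ρ_ _).hom := by
  simp only [twistHom']; monoidal

lemma SovereignStructure.twistInv_eq (X : B) : S.twistInv X = (ρ_ X).inv ≫
    X ◁ (coev X ≫ (β_ X (ldual X)).hom) ≫ (α_ _ _ _).inv ≫ S.ev' X ▷ X ≫ (λ_ _).hom := by
  simp only [twistInv]; monoidal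

end Braided

section FreeCenter

variable {C : Type u} [Category.{v} C] [MonoidalCategory C] [RigidCategory C]

namespace SovereignStructure

variable (S : SovereignStructure C) {M : C} (b : HalfBraiding M)

/-- The left partial trace of a half-braiding. -/
def halfTwist : M ⟶ M :=
  (λ_ M).inv ≫ S.coev' M ▷ M ≫ (α_ (ldual M) M M).hom ≫ ldual M ◁ (b.β M).hom ≫
    (α_ (ldual M) M M).inv ≫ ev M ▷ M ≫ (λ_ M).hom

/-- The right partial trace of a half-braiding. -/
def halfTwist' : M ⟶ M :=
  (ρ_ M).inv ≫ M ◁ coev M ≫ (α_ M M (ldual M)).inv ≫ (b.β M).hom ▷ ldual M ≫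
    (α_ M M (ldual M)).hom ≫ M ◁ S.ev' M ≫ (ρ_ M).hom

/-- The inverse of the twist of a half-braiding. -/
def halfTwistInv : M ⟶ M :=
  (ρ_ M).inv ≫ M ◁ (coev M ≫ (b.β (ldual M)).hom) ≫ (α_ M (ldual M) M).inv ≫
    S.ev' M ▷ M ≫ (λ_ M).hom

/-- Brings the twist of the center down to `C`, so that the results for braided sovereign categories
apply to `halfTwist`. The components of the center's inverse unitors and associators are matched by
lemmas, the rest by definition. -/
lemma twistHom_f : (S.center.twistHom (centerMk b)).f = S.halfTwist b := by
  rw [S.center.twistHom_eq]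
  change (λ_ (centerMk b)).inv.f ≫ (S.center.coev' (centerMk b)).f ▷ M ≫ (α_ (ldual M) M M).hom ≫
    ldual M ◁ (b.β M).hom ≫ (α_ (ldual (centerMk b)) (centerMk b) (centerMk b)).inv.f ≫
      ev M ▷ M ≫ (λ_ M).hom = _
  have h1 : (λ_ (centerMk b)).inv.f = (λ_ M).inv := Center.leftUnitor_inv_f _
  have h2 : (S.center.coev' (centerMk b)).f = S.coev' M := S.center_coev'_f _
  have h3 : (α_ (ldual (centerMk b)) (centerMk b) (centerMk b)).inv.f = (α_ (ldual M) M M).inv :=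
    Center.associator_inv_f _ _ _
  exact (congrArg₂ (fun (x : M ⟶ 𝟙_ C ⊗ M) (y : 𝟙_ C ⟶ ldual M ⊗ M) =>
    x ≫ y ▷ M ≫ (α_ (ldual M) M M).hom ≫ ldual M ◁ (b.β M).hom ≫
      (α_ (ldual (centerMk b)) (centerMk b) (centerMk b)).inv.f ≫
      ev M ▷ M ≫ (λ_ M).hom) h1 h2).trans
    (congrArg (fun (z : ldual M ⊗ M ⊗ M ⟶ (ldual M ⊗ M) ⊗ M) => (λ_ M).inv ≫ S.coev' M ▷ M ≫
      (α_ (ldual M) M M).hom ≫ ldual M ◁ (b.β M).hom ≫ z ≫ ev M ▷ M ≫ (λ_ M).hom) h3)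

lemma twistHom'_f : (S.center.twistHom' (centerMk b)).f = S.halfTwist' b := by
  rw [S.center.twistHom'_eq]
  change (ρ_ (centerMk b)).inv.f ≫ M ◁ coev M ≫
    (α_ (centerMk b) (centerMk b) (ldual (centerMk b))).inv.f ≫ (b.β M).hom ▷ ldual M ≫
    (α_ M M (ldual M)).hom ≫ M ◁ S.ev' M ≫ (ρ_ M).hom = _
  have h1 : (ρ_ (centerMk b)).inv.f = (ρ_ M).inv := Center.rightUnitor_inv_f _
  have h3 : (α_ (centerMk b) (centerMk b) (ldual (centerMk b))).inv.f = (α_ M M (ldual M)).inv :=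
    Center.associator_inv_f _ _ _
  exact congrArg₂ (fun (x : M ⟶ M ⊗ 𝟙_ C) (z : M ⊗ M ⊗ ldual M ⟶ (M ⊗ M) ⊗ ldual M) =>
    x ≫ M ◁ coev M ≫ z ≫ (b.β M).hom ▷ ldual M ≫
    (α_ M M (ldual M)).hom ≫ M ◁ S.ev' M ≫ (ρ_ M).hom) h1 h3

lemma twistInv_f : (S.center.twistInv (centerMk b)).f = S.halfTwistInv b := by
  rw [S.center.twistInv_eq]
  change (ρ_ (centerMk b)).inv.f ≫ M ◁ (coev M ≫ (b.β (ldual M)).hom) ≫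
    (α_ (centerMk b) (ldual (centerMk b)) (centerMk b)).inv.f ≫ S.ev' M ▷ M ≫ (λ_ M).hom = _
  have h1 : (ρ_ (centerMk b)).inv.f = (ρ_ M).inv := Center.rightUnitor_inv_f _
  have h3 : (α_ (centerMk b) (ldual (centerMk b)) (centerMk b)).inv.f = (α_ M (ldual M) M).inv :=
    Center.associator_inv_f _ _ _
  exact congrArg₂ (fun (x : M ⟶ M ⊗ 𝟙_ C) (z : M ⊗ ldual M ⊗ M ⟶ (M ⊗ ldual M) ⊗ M) =>
    x ≫ M ◁ (coev M ≫ (b.β (ldual M)).hom) ≫ z ≫ S.ev' M ▷ M ≫ (λ_ M).hom) h1 h3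

lemma halfTwist_natural {M N : C} {b : HalfBraiding M} {c : HalfBraiding N}
    (f : centerMk b ⟶ centerMk c) : centerHom f ≫ S.halfTwist c = S.halfTwist b ≫ centerHom f := by
  rw [← twistHom_f, ← twistHom_f]
  exact congrArg Center.Hom.f (S.center.twistHom_natural f)

lemma halfTwistInv_natural {M N : C} {b : HalfBraiding M} {c : HalfBraiding N}
    (f : centerMk b ⟶ centerMk c) :
    centerHom f ≫ S.halfTwistInv c = S.halfTwistInv b ≫ centerHom f := by
  rw [← twistInv_f, ← twistInv_f]
  exact congrArg Center.Hom.f (S.center.twistInv_natural f)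

lemma halfTwistInv_halfTwist : S.halfTwistInv b ≫ S.halfTwist b = 𝟙 M := by
  rw [← twistHom_f, ← twistInv_f]
  exact congrArg Center.Hom.f (S.center.twistInv_twistHom (centerMk b))

lemma halfTwist_halfTwistInv : S.halfTwist b ≫ S.halfTwistInv b = 𝟙 M := by
  rw [← twistHom_f, ← twistInv_f]
  exact congrArg Center.Hom.f (S.center.twistHom_twistInv (centerMk b))

lemma halfTwist_tensor {N : C} (c : HalfBraiding N) : S.halfTwist (tensorBraiding b c) =
    (b.β N).hom ≫ (c.β M).hom ≫ (S.halfTwist b ⊗ₘ S.halfTwist c) := by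
  rw [← twistHom_f, ← twistHom_f, ← twistHom_f]
  exact congrArg Center.Hom.f (S.center.twistHom_tensor (centerMk b) (centerMk c))

lemma halfTwist_selfDual (h : S.halfTwist b = S.halfTwist' b) :
    ldualMap (S.halfTwist b) = S.halfTwist (ldualHalfBraiding b) := by
  have h' : S.center.twistHom (centerMk b) = S.center.twistHom' (centerMk b) :=
    Center.ext _ _ ((S.twistHom_f b).trans (h.trans (S.twistHom'_f b).symm))
  have h2 := congrArg Center.Hom.f (S.center.twist_selfDual (centerMk b) h')
  rw [← twistHom_f, ← twistHom_f]
  exact (center_ldualMap_f _).symm.trans h2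

/-- The ribbon structure of the center. -/
def centerRibbon (h : ∀ {M : C} (b : HalfBraiding M), S.halfTwist b = S.halfTwist' b) :
    RibbonStructure (Center C) where
  twist := NatIso.ofComponents
    (fun A => ⟨S.center.twistHom A, S.center.twistInv A, S.center.twistHom_twistInv A,
      S.center.twistInv_twistHom A⟩) (fun f => S.center.twistHom_natural f)
  twist_tensor := S.center.twistHom_tensor
  selfDual A := S.center.twist_selfDual A
    (Center.ext _ _ ((S.twistHom_f A.2).trans ((h A.2).trans (S.twistHom'_f A.2).symm)))

end SovereignStructure

namespace FreeCenter

variable {Z : C ⥤ C} (F : FreeCenter Z) (S : SovereignStructure C)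

/-- The twist of the monad. -/
def θ : 𝟭 C ⟶ Z where
  app X := F.unit X ≫ S.halfTwist (F.hb X)
  naturality X Y f := by
    change f ≫ F.unit Y ≫ S.halfTwist (F.hb Y) = (F.unit X ≫ S.halfTwist (F.hb X)) ≫ Z.map f
    rw [← reassoc_of% unit_map, Category.assoc]
    exact congrArg (fun g => F.unit X ≫ g) (S.halfTwist_natural (F.map f))

/-- The inverse twist of the monad. -/
def θinv : 𝟭 C ⟶ Z where
  app X := F.unit X ≫ S.halfTwistInv (F.hb X)
  naturality X Y f := by
    change f ≫ F.unit Y ≫ S.halfTwistInv (F.hb Y) =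
      (F.unit X ≫ S.halfTwistInv (F.hb X)) ≫ Z.map f
    rw [← reassoc_of% unit_map, Category.assoc]
    exact congrArg (fun g => F.unit X ≫ g) (S.halfTwistInv_natural (F.map f))

/-- The twist of the monad. -/
def tw (X : C) : X ⟶ Z.obj X := F.unit X ≫ S.halfTwist (F.hb X)

/-- The inverse twist of the monad. -/
def twI (X : C) : X ⟶ Z.obj X := F.unit X ≫ S.halfTwistInv (F.hb X)

/-- Naturality of the twist at the counit morphism `act b`: the twist of the monad induces on each
object of the center its categorical twist. -/
lemma tw_act {M : C} (b : HalfBraiding M) : F.tw S M ≫ F.act b = S.halfTwist b := by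
  have h : F.act b ≫ S.halfTwist b = S.halfTwist (F.hb M) ≫ F.act b :=
    S.halfTwist_natural (F.counitHom b)
  rw [tw, Category.assoc, ← h, reassoc_of% unit_act]

lemma twI_act {M : C} (b : HalfBraiding M) : F.twI S M ≫ F.act b = S.halfTwistInv b := by
  have h : F.act b ≫ S.halfTwistInv b = S.halfTwistInv (F.hb M) ≫ F.act b :=
    S.halfTwistInv_natural (F.counitHom b)
  rw [twI, Category.assoc, ← h, reassoc_of% unit_act]

lemma tw_mul (X : C) : F.tw S (Z.obj X) ≫ F.mul X = S.halfTwist (F.hb X) := F.tw_act S _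

lemma twI_mul (X : C) : F.twI S (Z.obj X) ≫ F.mul X = S.halfTwistInv (F.hb X) := F.twI_act S _

/-- The self-dual twist of the monad. -/
def selfDualTwist (hS : ∀ {M : C} (b : HalfBraiding M), S.halfTwist b = S.halfTwist' b) :
    F.quasitriangular.SelfDualTwist where
  θ := F.θ S
  θinv := F.θinv S
  conv_inv := by
    ext X
    change F.twI S X ≫ F.tw S (Z.obj X) ≫ F.mul X = F.unit X
    rw [tw_mul, twI, Category.assoc, S.halfTwistInv_halfTwist, Category.comp_id]
  inv_conv := by
    ext X
    change F.tw S X ≫ F.twI S (Z.obj X) ≫ F.mul X = F.unit X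
    rw [twI_mul, tw, Category.assoc, S.halfTwist_halfTwistInv, Category.comp_id]
  central X := by
    change Z.map (F.tw S X) ≫ F.mul X = F.tw S (Z.obj X) ≫ F.mul X
    rw [tw_mul, ← S.twistHom_f]
    exact F.ext_f (F.map (F.tw S X) ≫ F.mulHom X) (S.center.twistHom (F.free X)) (by
      refine Eq.trans ?_ (congrArg (fun g => F.unit X ≫ g) (S.twistHom_f (F.hb X)).symm)
      change F.unit X ≫ Z.map (F.tw S X) ≫ F.mul X = F.unit X ≫ S.halfTwist (F.hb X)
      rw [reassoc_of% unit_map, unit_mul, Category.comp_id, tw])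
  twist X Y := by
    change F.tw S (X ⊗ Y) ≫ F.comul X Y = F.R X Y ≫ F.R (Z.obj Y) (Z.obj X) ≫
      ((F.mul X ≫ F.tw S (Z.obj X) ≫ F.mul X) ⊗ₘ (F.mul Y ≫ F.tw S (Z.obj Y) ≫ F.mul Y))
    -- Naturality at the comultiplication replaces the twist of the free object on `X ⊗ Y` by that
    -- of a tensor product of free objects.
    have h : F.comul X Y ≫ S.halfTwist (tensorBraiding (F.hb X) (F.hb Y)) =
      S.halfTwist (F.hb (X ⊗ Y)) ≫ F.comul X Y :=
        S.halfTwist_natural (b := F.hb (X ⊗ Y)) (c := tensorBraiding (F.hb X) (F.hb Y))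
          (F.comulHom X Y)
    have hR : F.R (Z.obj Y) (Z.obj X) ≫ (F.mul X ⊗ₘ F.mul Y) = _ := F.R_act (F.hb Y) (F.hb X)
    rw [tw_mul, tw_mul, ← tensorHom_comp_tensorHom, reassoc_of% hR, tw, Category.assoc, ← h,
      reassoc_of% unit_comul, S.halfTwist_tensor, R, Category.assoc]
  selfDual X := by
    change ldualMap (F.tw S X) = F.tw S (ldual (Z.obj X)) ≫ F.act (ldualHalfBraiding (F.hb X)) ≫
      ldualMap (F.unit X)
    rw [reassoc_of% tw_act, ← S.halfTwist_selfDual _ (hS _), ← ldualMap_comp, tw]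

end FreeCenter
end FreeCenter
end
end FusionCenter

namespace FusionCenter

noncomputable section

set_option linter.unusedSectionVars false

section FreeCenter

variable {C : Type u} [Category.{v} C] [MonoidalCategory C] [RigidCategory C]

namespace FreeCenter

variable {Z : C ⥤ C} (F : FreeCenter Z)

/-! #### The universal dinatural transformation -/

/-- The universal natural family `X ⊗ Y ⟶ Y ⊗ Z(X)`. -/
def half (X Y : C) : X ⊗ Y ⟶ Y ⊗ Z.obj X := F.unit X ▷ Y ≫ ((F.hb X).β Y).hom

/-- The universal dinatural transformation `∨Y ⊗ X ⊗ Y ⟶ Z(X)`. -/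
def univ (Y X : C) : (ldual Y ⊗ X) ⊗ Y ⟶ Z.obj X :=
  𝟙 _ ⊗≫ ldual Y ◁ F.half X Y ⊗≫ ev Y ▷ Z.obj X ⊗≫ 𝟙 _

lemma half_def (X Y : C) : F.half X Y = F.unit X ▷ Y ≫ ((F.hb X).β Y).hom := rfl

lemma univ_def (Y X : C) :
    F.univ Y X = 𝟙 _ ⊗≫ ldual Y ◁ F.half X Y ⊗≫ ev Y ▷ Z.obj X ⊗≫ 𝟙 _ := rfl

lemma half_natural {X Y Y' : C} (f : Y ⟶ Y') : X ◁ f ≫ F.half X Y' = F.half X Y ≫ f ▷ Z.obj X := by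
  rw [half, whisker_exchange_assoc, HalfBraiding.naturality, half, Category.assoc]

lemma half_act {M : C} (b : HalfBraiding M) (Y : C) : F.half M Y ≫ Y ◁ F.act b = (b.β Y).hom := by
  rw [half, Category.assoc, unit_braiding_act]

/-- `univ` and `half` are mates under the duality of `Y`, so facts about the half-braiding translate
into facts about the dinatural family. -/
lemma coev_univ (X Y : C) :
    𝟙 (X ⊗ Y) ⊗≫ coev Y ▷ (X ⊗ Y) ⊗≫ Y ◁ F.univ Y X = F.half X Y := by
  calc _ = 𝟙 (X ⊗ Y) ⊗≫ (coev Y ▷ (X ⊗ Y) ≫ (Y ⊗ ldual Y) ◁ F.half X Y) ⊗≫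
        Y ◁ ev Y ▷ Z.obj X ⊗≫ 𝟙 _ := by rw [univ]; monoidal
    _ = F.half X Y ⊗≫ (coev Y ▷ Y ⊗≫ Y ◁ ev Y) ▷ Z.obj X ⊗≫ 𝟙 _ := by
        rw [← whisker_exchange]; monoidal
    _ = _ := by rw [ev_coev]; monoidal

lemma univ_act {M : C} (b : HalfBraiding M) (Y : C) :
    F.univ Y M ≫ F.act b = 𝟙 _ ⊗≫ ldual Y ◁ (b.β Y).hom ⊗≫ ev Y ▷ M ⊗≫ 𝟙 _ := by
  calc _ = 𝟙 _ ⊗≫ ldual Y ◁ F.half M Y ⊗≫ (ev Y ▷ Z.obj M ≫ 𝟙_ C ◁ F.act b) ⊗≫ 𝟙 _ := by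
        rw [univ]; monoidal
    _ = 𝟙 _ ⊗≫ ldual Y ◁ (F.half M Y ≫ Y ◁ F.act b) ⊗≫ ev Y ▷ M ⊗≫ 𝟙 _ := by
        rw [← whisker_exchange]; monoidal
    _ = _ := by rw [half_act]

lemma univ_act_eq {M : C} (b : HalfBraiding M) (Y : C) :
    F.univ Y M ≫ F.act b = (α_ _ _ _).hom ≫ ldual Y ◁ (b.β Y).hom ≫ (α_ _ _ _).inv ≫
      ev Y ▷ M ≫ (λ_ M).hom := by
  rw [univ_act]; monoidal

/-- The half-braiding of a tensor product crosses the two factors one after the other; transposing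
each crossing separately inserts the `coev Y` in the middle. -/
lemma univ_comul (X X' Y : C) : F.univ Y (X ⊗ X') ≫ F.comul X X' =
    𝟙 ((ldual Y ⊗ (X ⊗ X')) ⊗ Y) ⊗≫ (ldual Y ⊗ X) ◁ coev Y ▷ (X' ⊗ Y) ⊗≫
      (F.univ Y X ⊗ₘ F.univ Y X') := by
  have h : F.half (X ⊗ X') Y ≫ Y ◁ F.comul X X' =
      𝟙 _ ⊗≫ X ◁ F.half X' Y ⊗≫ F.half X Y ▷ Z.obj X' ⊗≫ 𝟙 _ := by
    calc _ = (F.unit (X ⊗ X') ≫ F.comul X X') ▷ Y ≫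
          ((tensorBraiding (F.hb X) (F.hb X')).β Y).hom := by
          rw [half, Category.assoc, ← comul_comm, comp_whiskerRight_assoc]
      _ = 𝟙 _ ⊗≫ X ◁ F.unit X' ▷ Y ⊗≫ (F.unit X ▷ (Z.obj X' ⊗ Y) ≫
          Z.obj X ◁ ((F.hb X').β Y).hom) ⊗≫ ((F.hb X).β Y).hom ▷ Z.obj X' ⊗≫ 𝟙 _ := by
          rw [unit_comul, MonoidalCategory.tensorHom_def', tensorBraiding_hom]; monoidal
      _ = _ := by rw [← whisker_exchange, F.half_def X, F.half_def X']; monoidal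
  calc _ = 𝟙 _ ⊗≫ ldual Y ◁ F.half (X ⊗ X') Y ⊗≫ (ev Y ▷ Z.obj (X ⊗ X') ≫
        𝟙_ C ◁ F.comul X X') ⊗≫ 𝟙 _ := by rw [univ]; monoidal
    _ = 𝟙 _ ⊗≫ ldual Y ◁ (F.half (X ⊗ X') Y ≫ Y ◁ F.comul X X') ⊗≫
        ev Y ▷ (Z.obj X ⊗ Z.obj X') ⊗≫ 𝟙 _ := by rw [← whisker_exchange]; monoidal
    _ = 𝟙 _ ⊗≫ ldual Y ◁ X ◁ (𝟙 (X' ⊗ Y) ⊗≫ coev Y ▷ (X' ⊗ Y) ⊗≫ Y ◁ F.univ Y X') ⊗≫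
        ldual Y ◁ F.half X Y ▷ Z.obj X' ⊗≫ ev Y ▷ (Z.obj X ⊗ Z.obj X') ⊗≫ 𝟙 _ := by
        rw [h, coev_univ]; monoidal
    _ = 𝟙 _ ⊗≫ (ldual Y ⊗ X) ◁ coev Y ▷ (X' ⊗ Y) ⊗≫
        (((ldual Y ⊗ X) ⊗ Y) ◁ F.univ Y X' ≫ F.univ Y X ▷ Z.obj X') := by
        rw [F.univ_def Y X]; monoidal
    _ = _ := by rw [← MonoidalCategory.tensorHom_def']

lemma univ_counit (Y : C) : F.univ Y (𝟙_ C) ≫ F.counit = (ρ_ (ldual Y)).hom ▷ Y ≫ ev Y := by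
  rw [counit, univ_act]
  change 𝟙 _ ⊗≫ ldual Y ◁ ((λ_ Y).hom ≫ (ρ_ Y).inv) ⊗≫ ev Y ▷ 𝟙_ C ⊗≫ 𝟙 _ = _
  monoidal

/-- At `Y = 𝟙` the half-braiding is trivial, so `half` is the unit up to unitors. -/
lemma unit_eq_univ (X : C) : F.unit X =
    (λ_ X).inv ≫ toLdualUnit C ▷ X ≫ (ρ_ (ldual (𝟙_ C) ⊗ X)).inv ≫ F.univ (𝟙_ C) X := by
  have h : F.half X (𝟙_ C) = (ρ_ X).hom ≫ F.unit X ≫ (λ_ _).inv := by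
    rw [half, halfBraiding_unit, rightUnitor_naturality_assoc]
  rw [← cancel_epi (ρ_ X).hom, ← cancel_mono (λ_ _).inv, Category.assoc, ← h, ← coev_univ,
    toLdualUnit]
  monoidal

/-- Multiplicativity of the half-braiding of `Z(X)` at `W ⊗ Y`, transposed: the two evaluations
assemble into that of `W ⊗ Y`. -/
lemma univ_mul (Y W X : C) :
    (ldual Y ◁ F.univ W X) ▷ Y ≫ F.univ Y (Z.obj X) ≫ F.mul X =
      𝟙 ((ldual Y ⊗ ((ldual W ⊗ X) ⊗ W)) ⊗ Y) ⊗≫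
        ((ldualTensorIso W Y).inv ▷ X) ▷ (W ⊗ Y) ≫ F.univ (W ⊗ Y) X := by
  have hev : (ldualTensorIso W Y).inv ▷ (W ⊗ Y) ≫ ev (W ⊗ Y) =
      𝟙 _ ⊗≫ ldual Y ◁ (ev W ▷ Y) ⊗≫ ev Y := by
    rw [← ldualTensorIso_ev]
    calc _ = ((ldualTensorIso W Y).inv ≫ (ldualTensorIso W Y).hom) ▷ (W ⊗ Y) ⊗≫
          ldual Y ◁ (ev W ▷ Y) ⊗≫ ev Y := by monoidal
      _ = _ := by rw [Iso.inv_hom_id]; monoidal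
  have h : F.half X (W ⊗ Y) = 𝟙 _ ⊗≫ F.half X W ▷ Y ⊗≫ W ◁ ((F.hb X).β Y).hom ⊗≫ 𝟙 _ := by
    rw [half, half, HalfBraiding.monoidal]; monoidal
  symm
  calc _ = 𝟙 ((ldual Y ⊗ ((ldual W ⊗ X) ⊗ W)) ⊗ Y) ⊗≫
        ((ldualTensorIso W Y).inv ▷ (X ⊗ (W ⊗ Y)) ≫
        ldual (W ⊗ Y) ◁ F.half X (W ⊗ Y)) ⊗≫
        ev (W ⊗ Y) ▷ Z.obj X ⊗≫ 𝟙 _ := by rw [univ]; monoidal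
    _ = 𝟙 _ ⊗≫ (ldual Y ⊗ ldual W) ◁ F.half X (W ⊗ Y) ⊗≫
        ((ldualTensorIso W Y).inv ▷ (W ⊗ Y) ≫ ev (W ⊗ Y)) ▷ Z.obj X ⊗≫ 𝟙 _ := by
        rw [← whisker_exchange]; monoidal
    _ = 𝟙 _ ⊗≫ (ldual Y ⊗ ldual W) ◁ F.half X W ▷ Y ⊗≫
        ldual Y ◁ ((ldual W ⊗ W) ◁ ((F.hb X).β Y).hom ≫ ev W ▷ (Y ⊗ Z.obj X)) ⊗≫
        ev Y ▷ Z.obj X ⊗≫ 𝟙 _ := by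
        rw [hev, h]; monoidal
    _ = (ldual Y ◁ F.univ W X) ▷ Y ⊗≫
        (𝟙 ((ldual Y ⊗ Z.obj X) ⊗ Y) ⊗≫ ldual Y ◁ ((F.hb X).β Y).hom ⊗≫
        ev Y ▷ Z.obj X ⊗≫ 𝟙 (Z.obj X)) := by
        rw [whisker_exchange, univ]; monoidal
    _ = _ := by
        rw [← F.univ_act, mul]; monoidal

lemma R_eq_univ (X Y : C) : F.R X Y = (λ_ (X ⊗ Y)).inv ≫ coev Y ▷ (X ⊗ Y) ⊗≫
    Y ◁ F.univ Y X ≫ F.unit Y ▷ Z.obj X := by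
  have h := F.coev_univ X Y
  rw [half] at h
  rw [R_eq, ← Category.assoc (F.unit X ▷ Y), ← h]
  monoidal

end FreeCenter
end FreeCenter
end
end FusionCenter

/-! ### Formulas for the antipodes and the twist through the universal dinatural family -/

namespace FusionCenter

noncomputable section

set_option linter.unusedSectionVars false

section FreeCenter

variable {C : Type u} [Category.{v} C] [MonoidalCategory C] [RigidCategory C]

lemma rdualTensorIso_evr (X Y : C) : (X ⊗ Y) ◁ (rdualTensorIso X Y).hom ⊗≫
    (X ◁ evr Y) ▷ rdual X ⊗≫ evr X = evr (X ⊗ Y) := by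
  have h := @leftAdjointMate_comp_evaluation C _ _ (X ⊗ Y) (X ⊗ Y)
    ⟨rdual Y ⊗ rdual X⟩ (LeftRigidCategory.leftDual (X ⊗ Y)) (𝟙 _)
  rw [id_whiskerRight, Category.id_comp] at h
  refine Eq.trans ?_ h
  simp only [ExactPairing.tensor_evaluation]
  change _ = (X ⊗ Y) ◁ (rdualTensorIso X Y).hom ≫ _
  monoidal

lemma rdualLdualIso_ev (W : C) : ldual W ◁ (rdualLdualIso W).hom ≫ ev W = evr (ldual W) := by
  have h := @leftAdjointMate_comp_evaluation C _ _ (ldual W) (ldual W)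
    ⟨W⟩ (LeftRigidCategory.leftDual (ldual W)) (𝟙 _)
  rw [id_whiskerRight, Category.id_comp] at h
  exact h

namespace FreeCenter

variable {Z : C ⥤ C} (F : FreeCenter Z)

/-- Transposing the right-hand `W` instead of `∨W` gives the inverse half-braiding at `∨W`, the
ingredient from which the half-braiding of a left dual is built. -/
lemma univ_coev (W X : C) : 𝟙 (ldual W ⊗ X) ⊗≫ (ldual W ⊗ X) ◁ coev W ⊗≫ F.univ W X ▷ ldual W =
    ldual W ◁ F.unit X ≫ ((F.hb X).β (ldual W)).inv := by
  calc _ = 𝟙 _ ⊗≫ ldual W ◁ (X ◁ coev W ≫ F.unit X ▷ (W ⊗ ldual W)) ⊗≫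
        (ldual W ◁ ((F.hb X).β W).hom ⊗≫ ev W ▷ Z.obj X) ▷ ldual W ⊗≫ 𝟙 _ := by
        rw [univ_def, half]; monoidal
    _ = ldual W ◁ F.unit X ⊗≫ ((ldual W ⊗ Z.obj X) ◁ coev W ≫
        ((F.hb X).β (ldual W)).inv ▷ (W ⊗ ldual W)) ⊗≫ Z.obj X ◁ (ev W ▷ ldual W) ⊗≫ 𝟙 _ := by
        rw [whisker_exchange, ev_halfBraiding_natural]; monoidal
    _ = ldual W ◁ F.unit X ≫ ((F.hb X).β (ldual W)).inv ⊗≫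
        Z.obj X ◁ (ldual W ◁ coev W ⊗≫ ev W ▷ ldual W) ⊗≫ 𝟙 _ := by
        rw [whisker_exchange]; monoidal
    _ = _ := by rw [coev_ev]; monoidal

/-- The evaluation of `∨W ⊗ X ⊗ W` is three nested evaluations; a zigzag on `W` removes the factor
that the contraction does not contain. A general `T` covers the use with the dual of `univ`. -/
lemma contractLeft_ev {A W X : C} (T : A ⟶ ldual ((ldual W ⊗ X) ⊗ W)) :
    ((ldual (ldual W) ◁ T) ▷ ldual W ≫ contractLeft W X) ▷ X ≫ ev X =
      𝟙 _ ⊗≫ (ldual (ldual W) ⊗ A ⊗ ldual W ⊗ X) ◁ coev W ⊗≫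
        ldual (ldual W) ◁ (T ▷ ((ldual W ⊗ X) ⊗ W) ≫ ev ((ldual W ⊗ X) ⊗ W)) ▷ ldual W ⊗≫
        ev (ldual W) := by
  symm
  have hP : ev ((ldual W ⊗ X) ⊗ W) = ((ldualTensorIso (ldual W ⊗ X) W).hom ≫
      ldual W ◁ (ldualTensorIso (ldual W) X).hom) ▷ ((ldual W ⊗ X) ⊗ W) ⊗≫
      ldual W ◁ ((ldual X ◁ (ev (ldual W) ▷ X) ⊗≫ ev X) ▷ W) ⊗≫ ev W := by
    rw [← ldualTensorIso_ev, ← ldualTensorIso_ev (ldual W) X]; monoidal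
  obtain ⟨T', hT'⟩ : ∃ T' : A ⟶ ldual W ⊗ ldual X ⊗ ldual (ldual W), T' =
    T ≫ (ldualTensorIso (ldual W ⊗ X) W).hom ≫ ldual W ◁ (ldualTensorIso (ldual W) X).hom :=
      ⟨_, rfl⟩
  calc _ = 𝟙 _ ⊗≫ ((ldual (ldual W) ⊗ A ⊗ ldual W ⊗ X) ◁ coev W ≫
        (ldual (ldual W) ◁ (T' ▷ (ldual W ⊗ X) ⊗≫ ldual W ◁ (ldual X ◁ (ev (ldual W) ▷ X) ⊗≫
          ev X))) ▷ (W ⊗ ldual W)) ⊗≫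
        ldual (ldual W) ◁ (ev W ▷ ldual W) ⊗≫ ev (ldual W) := by
        rw [hP, hT']; monoidal
    _ = 𝟙 _ ⊗≫ ldual (ldual W) ◁ (T' ▷ (ldual W ⊗ X) ⊗≫
        ldual W ◁ (ldual X ◁ (ev (ldual W) ▷ X) ⊗≫ ev X)) ⊗≫
        ldual (ldual W) ◁ (ldual W ◁ coev W ⊗≫ ev W ▷ ldual W) ⊗≫ ev (ldual W) := by
        rw [whisker_exchange]; monoidal
    _ = 𝟙 _ ⊗≫ ldual (ldual W) ◁ (T' ▷ (ldual W ⊗ X)) ⊗≫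
        ((ldual (ldual W) ⊗ ldual W) ◁ (𝟙 ((ldual X ⊗ ldual (ldual W)) ⊗ (ldual W ⊗ X)) ⊗≫
          ldual X ◁ (ev (ldual W) ▷ X) ⊗≫ ev X) ≫ ev (ldual W) ▷ 𝟙_ C) ⊗≫ 𝟙 _ := by
        rw [coev_ev]; monoidal
    _ = _ := by
        rw [whisker_exchange, hT', contractLeft]; monoidal

/-- Paired with `X`, the right side produces by `univ_coev` an inverse half-braiding, and the left
side its mate `ldualBraiding`. -/
lemma univ_sl (W X : C) : F.univ (ldual W) (ldual (Z.obj X)) ≫ F.sl X =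
    (ldual (ldual W) ◁ ldualMap (F.univ W X)) ▷ ldual W ≫ contractLeft W X := by
  apply ldual_hom_ext
  rw [contractLeft_ev, ldualMap_ev]
  symm
  calc _ = 𝟙 _ ⊗≫ (ldual (ldual W) ⊗ ldual (Z.obj X)) ◁
        (𝟙 (ldual W ⊗ X) ⊗≫ (ldual W ⊗ X) ◁ coev W ⊗≫ F.univ W X ▷ ldual W) ⊗≫
        ldual (ldual W) ◁ ev (Z.obj X) ▷ ldual W ⊗≫ ev (ldual W) := by monoidal
    _ = 𝟙 _ ⊗≫ ((ldual (ldual W) ⊗ ldual (Z.obj X)) ⊗ ldual W) ◁ F.unit X ⊗≫ ldual (ldual W) ◁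
        (𝟙 ((ldual (Z.obj X) ⊗ ldual W) ⊗ Z.obj X) ⊗≫
          ldual (Z.obj X) ◁ ((F.hb X).β (ldual W)).inv ⊗≫
          ev (Z.obj X) ▷ ldual W ⊗≫ 𝟙 (ldual W ⊗ 𝟙_ C)) ⊗≫ ev (ldual W) := by
        rw [univ_coev]; monoidal
    _ = 𝟙 _ ⊗≫ ((ldual (ldual W) ⊗ ldual (Z.obj X) ⊗ ldual W) ◁ F.unit X ⊗≫
          ldual (ldual W) ◁ ldualBraiding (F.hb X) (ldual W) ▷ Z.obj X) ⊗≫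
          ((ldual (ldual W) ⊗ ldual W) ◁ ev (Z.obj X) ≫ ev (ldual W) ▷ 𝟙_ C) ⊗≫ 𝟙 _ := by
        rw [← ldualBraiding_ev]; monoidal
    _ = 𝟙 _ ⊗≫ ((ldual (ldual W) ⊗ ldual (Z.obj X) ⊗ ldual W) ◁ F.unit X ≫
          (ldual (ldual W) ◁ ldualBraiding (F.hb X) (ldual W) ⊗≫
            ev (ldual W) ▷ ldual (Z.obj X)) ▷ Z.obj X) ⊗≫ ev (Z.obj X) := by
        rw [whisker_exchange]; monoidal
    _ = 𝟙 _ ⊗≫ (ldual (ldual W) ◁ ldualBraiding (F.hb X) (ldual W) ⊗≫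
            ev (ldual W) ▷ ldual (Z.obj X)) ▷ X ⊗≫ (ldual (Z.obj X) ◁ F.unit X ≫
            ev (Z.obj X)) := by
        rw [whisker_exchange]; monoidal
    _ = (F.univ (ldual W) (ldual (Z.obj X)) ≫ F.act (ldualHalfBraiding (F.hb X))) ▷ X ⊗≫
          (ldualMap (F.unit X) ▷ X ≫ ev X) := by
        rw [univ_act, ldualHalfBraiding_hom, ldualMap_ev]; monoidal
    _ = _ := by rw [sl]; monoidal

/-- The objects `∨(W∨)` and `W` are both left duals of `W∨`; the morphism `e` compares them and is
pinned down by its compatibility with the evaluations. -/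
lemma contractRight_evr {A W X : C} (T : A ⟶ rdual ((ldual W ⊗ X) ⊗ W))
    (e : ldual (rdual W) ⟶ W) (he : e ▷ rdual W ≫ evr W = ev (rdual W)) :
    X ◁ ((ldual (rdual W) ◁ T) ▷ rdual W ≫ contractRight W X) ≫ evr X =
      𝟙 _ ⊗≫ X ◁ e ▷ (A ⊗ rdual W) ⊗≫ coev W ▷ (X ⊗ W ⊗ A ⊗ rdual W) ⊗≫
        W ◁ (((ldual W ⊗ X) ⊗ W) ◁ T ≫ evr ((ldual W ⊗ X) ⊗ W)) ▷ rdual W ⊗≫ evr W := by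
  symm
  have hP : evr ((ldual W ⊗ X) ⊗ W) = ((ldual W ⊗ X) ⊗ W) ◁
      ((rdualTensorIso (ldual W ⊗ X) W).hom ≫ rdual W ◁ ((rdualTensorIso (ldual W) X).hom ≫
        rdual X ◁ (rdualLdualIso W).hom)) ⊗≫ (ldual W ⊗ X) ◁ evr W ▷ (rdual X ⊗ W) ⊗≫
        ldual W ◁ evr X ▷ W ⊗≫ ev W := by
    calc _ = ((ldual W ⊗ X) ⊗ W) ◁ (rdualTensorIso (ldual W ⊗ X) W).hom ⊗≫
          (ldual W ⊗ X) ◁ (evr W ▷ rdual (ldual W ⊗ X) ≫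
            𝟙_ C ◁ (rdualTensorIso (ldual W) X).hom) ⊗≫
          ldual W ◁ (evr X ▷ rdual (ldual W) ≫ 𝟙_ C ◁ (rdualLdualIso W).hom) ⊗≫ ev W := by
          rw [← rdualTensorIso_evr, ← rdualTensorIso_evr (ldual W) X, ← rdualLdualIso_ev]
          monoidal
      _ = ((ldual W ⊗ X) ⊗ W) ◁ (rdualTensorIso (ldual W ⊗ X) W).hom ⊗≫
          (ldual W ⊗ X) ◁ ((W ⊗ rdual W) ◁ (rdualTensorIso (ldual W) X).hom ⊗≫
            (evr W ▷ (rdual X ⊗ rdual (ldual W)) ≫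
              𝟙_ C ◁ rdual X ◁ (rdualLdualIso W).hom)) ⊗≫ ldual W ◁ evr X ▷ W ⊗≫ ev W := by
          rw [← whisker_exchange, ← whisker_exchange]; monoidal
      _ = _ := by rw [← whisker_exchange]; monoidal
  obtain ⟨T', hT'⟩ : ∃ T' : A ⟶ rdual W ⊗ rdual X ⊗ W, T' =
    T ≫ (rdualTensorIso (ldual W ⊗ X) W).hom ≫ rdual W ◁ ((rdualTensorIso (ldual W) X).hom ≫
        rdual X ◁ (rdualLdualIso W).hom) :=
      ⟨_, rfl⟩
  calc _ = 𝟙 _ ⊗≫ X ◁ e ▷ (A ⊗ rdual W) ⊗≫ (coev W ▷ (X ⊗ W ⊗ A ⊗ rdual W) ≫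
        (W ⊗ ldual W) ◁ (𝟙 (X ⊗ W ⊗ A ⊗ rdual W) ⊗≫ (X ⊗ W) ◁ T' ▷ rdual W ⊗≫
          X ◁ evr W ▷ (rdual X ⊗ W ⊗ rdual W) ⊗≫ evr X ▷ (W ⊗ rdual W))) ⊗≫
        (W ◁ ev W) ▷ rdual W ⊗≫ evr W := by
        rw [hP, hT']; monoidal
    _ = 𝟙 _ ⊗≫ X ◁ (e ▷ A ≫ W ◁ T') ▷ rdual W ⊗≫
          X ◁ evr W ▷ (rdual X ⊗ W ⊗ rdual W) ⊗≫ evr X ▷ (W ⊗ rdual W) ⊗≫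
        (coev W ▷ W ⊗≫ W ◁ ev W) ▷ rdual W ⊗≫ evr W := by
        rw [← whisker_exchange]; monoidal
    _ = 𝟙 _ ⊗≫ X ◁ (ldual (rdual W) ◁ T') ▷ rdual W ⊗≫
          X ◁ (e ▷ rdual W ≫ evr W) ▷ (rdual X ⊗ W ⊗ rdual W) ⊗≫
          (evr X ▷ (W ⊗ rdual W) ≫ 𝟙_ C ◁ evr W) ⊗≫ 𝟙 _ := by
        rw [← whisker_exchange, ev_coev]; monoidal
    _ = _ := by
        rw [he, ← whisker_exchange, hT', contractRight]; monoidal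

lemma univ_sr (W X : C) : F.univ (rdual W) (rdual (Z.obj X)) ≫ F.sr X =
    (ldual (rdual W) ◁ rdualMap (F.univ W X)) ▷ rdual W ≫ contractRight W X := by
  apply rdual_hom_ext
  obtain ⟨e, he⟩ : ∃ e : ldual (rdual W) ⟶ W, e ▷ rdual W ≫ evr W = ev (rdual W) := by
    refine ⟨𝟙 _ ⊗≫ ldual (rdual W) ◁ coevr W ⊗≫ ev (rdual W) ▷ W ⊗≫ 𝟙 _, ?_⟩
    calc _ = 𝟙 _ ⊗≫ ldual (rdual W) ◁ (coevr W ▷ rdual W) ⊗≫ (ev (rdual W) ▷ (W ⊗ rdual W) ≫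
          𝟙_ C ◁ evr W) ⊗≫ 𝟙 _ := by monoidal
      _ = 𝟙 _ ⊗≫ ldual (rdual W) ◁ (coevr W ▷ rdual W ⊗≫ rdual W ◁ evr W) ⊗≫
          ev (rdual W) := by rw [← whisker_exchange]; monoidal
      _ = _ := by rw [evr_coevr]; monoidal
  rw [contractRight_evr _ e he, rdualMap_evr]
  calc _ = 𝟙 _ ⊗≫ X ◁ (𝟙 ((ldual (rdual W) ⊗ rdual (Z.obj X)) ⊗ rdual W) ⊗≫
        (ldual (rdual W) ◁ ((rdualHalfBraiding (F.hb X)).β (rdual W)).hom ⊗≫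
        ev (rdual W) ▷ rdual (Z.obj X)) ⊗≫ 𝟙 (rdual (Z.obj X))) ⊗≫ (X ◁ rdualMap (F.unit X) ≫
          evr X) := by
        have h := F.univ_act (rdualHalfBraiding (F.hb X)) (rdual W)
        rw [sr, ← Category.assoc, h]; monoidal
    _ = 𝟙 _ ⊗≫ (X ◁ (rdualBraiding (F.hb X) (ldual (rdual W)) ▷ rdual W ⊗≫
        rdual (Z.obj X) ◁ ev (rdual W) ⊗≫ 𝟙 (rdual (Z.obj X))) ≫
        F.unit X ▷ rdual (Z.obj X)) ⊗≫ evr (Z.obj X) := by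
        rw [ev_halfBraiding_natural, rdualHalfBraiding_inv, rdualMap_evr]; monoidal
    _ = 𝟙 _ ⊗≫ F.unit X ▷ (ldual (rdual W) ⊗ rdual (Z.obj X) ⊗ rdual W) ⊗≫
        Z.obj X ◁ rdualBraiding (F.hb X) (ldual (rdual W)) ▷ rdual W ⊗≫
        ((Z.obj X ⊗ rdual (Z.obj X)) ◁ ev (rdual W) ≫ evr (Z.obj X) ▷ 𝟙_ C) ⊗≫ 𝟙 _ := by
        rw [whisker_exchange]; monoidal
    _ = 𝟙 _ ⊗≫ F.unit X ▷ (ldual (rdual W) ⊗ rdual (Z.obj X) ⊗ rdual W) ⊗≫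
        (Z.obj X ◁ rdualBraiding (F.hb X) (ldual (rdual W)) ⊗≫
          evr (Z.obj X) ▷ ldual (rdual W)) ▷ rdual W ⊗≫ ev (rdual W) := by
        rw [whisker_exchange]; monoidal
    _ = 𝟙 _ ⊗≫ F.half X (ldual (rdual W)) ▷ (rdual (Z.obj X) ⊗ rdual W) ⊗≫
        (ldual (rdual W) ◁ evr (Z.obj X) ≫ e ▷ 𝟙_ C) ▷ rdual W ⊗≫ evr W := by
        rw [rdualBraiding_evr, ← he, half]; monoidal
    -- Naturality of `half` at `e` moves the family from `∨(W∨)` to `W`, where `coev_univ` applies.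
    _ = 𝟙 _ ⊗≫ (X ◁ e ≫ F.half X W) ▷ (rdual (Z.obj X) ⊗ rdual W) ⊗≫
        (W ◁ evr (Z.obj X)) ▷ rdual W ⊗≫ evr W := by
        rw [whisker_exchange, half_natural]; monoidal
    _ = _ := by
        rw [← coev_univ]; monoidal

section Sovereign

variable (S : SovereignStructure C)

/-- The unit is slid around the loop, which replaces the trace over `Z(X)` by a trace over `X`. -/
lemma tw_eq_univ (X : C) : F.tw S X = (λ_ X).inv ≫ S.coev' X ▷ X ≫ F.univ X X := by
  calc _ = 𝟙 _ ⊗≫ (𝟙_ C ◁ F.unit X ≫ S.coev' (Z.obj X) ▷ Z.obj X) ⊗≫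
        ldual (Z.obj X) ◁ ((F.hb X).β (Z.obj X)).hom ⊗≫ ev (Z.obj X) ▷ Z.obj X ⊗≫ 𝟙 _ := by
        rw [tw, SovereignStructure.halfTwist]; monoidal
    _ = 𝟙 _ ⊗≫ S.coev' (Z.obj X) ▷ X ⊗≫ ldual (Z.obj X) ◁ (Z.obj X ◁ F.unit X ≫
        ((F.hb X).β (Z.obj X)).hom) ⊗≫ ev (Z.obj X) ▷ Z.obj X ⊗≫ 𝟙 _ := by
        rw [whisker_exchange]; monoidal
    _ = 𝟙 _ ⊗≫ S.coev' (Z.obj X) ▷ X ⊗≫ ldual (Z.obj X) ◁ ((F.hb X).β X).hom ⊗≫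
        (ldual (Z.obj X) ◁ F.unit X ≫ ev (Z.obj X)) ▷ Z.obj X ⊗≫ 𝟙 _ := by
        rw [HalfBraiding.naturality]; monoidal
    _ = 𝟙 _ ⊗≫ S.coev' (Z.obj X) ▷ X ⊗≫ (ldual (Z.obj X) ◁ ((F.hb X).β X).hom ≫
        ldualMap (F.unit X) ▷ (X ⊗ Z.obj X)) ⊗≫ ev X ▷ Z.obj X ⊗≫ 𝟙 _ := by
        rw [← ldualMap_ev]; monoidal
    _ = 𝟙 _ ⊗≫ (S.coev' (Z.obj X) ≫ ldualMap (F.unit X) ▷ Z.obj X) ▷ X ⊗≫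
        ldual X ◁ ((F.hb X).β X).hom ⊗≫ ev X ▷ Z.obj X ⊗≫ 𝟙 _ := by
        rw [whisker_exchange]; monoidal
    _ = _ := by
        rw [← S.coev'_natural, univ, half]; monoidal

lemma twI_eq_univ (X : C) : F.twI S X = (ρ_ X).inv ≫ ((S.φ X).hom ⊗ₘ coev X) ≫
    (α_ _ _ _).inv ≫ F.univ (ldual X) X := by
  calc _ = 𝟙 _ ⊗≫ (F.unit X ▷ 𝟙_ C ≫ Z.obj X ◁ (coev (Z.obj X) ≫
        ((F.hb X).β (ldual (Z.obj X))).hom)) ⊗≫ S.ev' (Z.obj X) ▷ Z.obj X ⊗≫ 𝟙 _ := by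
        rw [twI, SovereignStructure.halfTwistInv]; monoidal
    _ = 𝟙 _ ⊗≫ X ◁ (coev (Z.obj X) ≫ ((F.hb X).β (ldual (Z.obj X))).hom) ⊗≫
        (F.unit X ▷ ldual (Z.obj X) ≫ S.ev' (Z.obj X)) ▷ Z.obj X ⊗≫ 𝟙 _ := by
        rw [← whisker_exchange]; monoidal
    _ = 𝟙 _ ⊗≫ X ◁ (coev (Z.obj X) ≫ ((F.hb X).β (ldual (Z.obj X))).hom ≫
        ldualMap (F.unit X) ▷ Z.obj X) ⊗≫ S.ev' X ▷ Z.obj X ⊗≫ 𝟙 _ := by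
        rw [← S.ev'_natural]; monoidal
    _ = 𝟙 _ ⊗≫ (X ◁ (coev X ≫ F.half X (ldual X)) ≫ (S.φ X).hom ▷ (ldual X ⊗ Z.obj X)) ⊗≫
        ev (ldual X) ▷ Z.obj X ⊗≫ 𝟙 _ := by
        rw [← HalfBraiding.naturality, reassoc_of% coev_ldualMap, ← half_def,
          SovereignStructure.ev']
        monoidal
    _ = 𝟙 _ ⊗≫ ((S.φ X).hom ▷ 𝟙_ C ≫ ldual (ldual X) ◁ coev X) ⊗≫
        (𝟙 ((ldual (ldual X) ⊗ X) ⊗ ldual X) ⊗≫ ldual (ldual X) ◁ F.half X (ldual X) ⊗≫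
          ev (ldual X) ▷ Z.obj X ⊗≫ 𝟙 (Z.obj X)) := by
        rw [whisker_exchange]; monoidal
    _ = _ := by
        rw [← univ_def, ← MonoidalCategory.tensorHom_def]; monoidal

end Sovereign

end FreeCenter
end FreeCenter
end
end FusionCenter

/-! ### Dinaturality in a fusion category and the coend as a finite direct sum -/

namespace FusionCenter

noncomputable section

set_option linter.unusedSectionVars false

section Linear

variable {k : Type*} [CommRing k] {C : Type u} [Category.{v} C] [Preadditive C]
    [Linear k C] [MonoidalCategory C] [MonoidalPreadditive C]
    [MonoidalLinear k C] [RigidCategory C]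

lemma ldualMap_zero (X Y : C) : ldualMap (0 : X ⟶ Y) = 0 := by
  apply ldual_hom_ext
  rw [ldualMap_ev]
  simp

lemma ldualMap_smul {X Y : C} (r : k) (f : X ⟶ Y) : ldualMap (r • f) = r • ldualMap f := by
  apply ldual_hom_ext
  rw [ldualMap_ev]
  simp only [MonoidalLinear.whiskerLeft_smul, MonoidalLinear.smul_whiskerRight, Linear.smul_comp,
    ldualMap_ev]

lemma ldualMap_sum {X Y : C} {J : Type*} (s : Finset J) (f : J → (X ⟶ Y)) :
    ldualMap (∑ j ∈ s, f j) = ∑ j ∈ s, ldualMap (f j) := by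
  apply ldual_hom_ext
  rw [ldualMap_ev]
  simp only [whiskerLeft_sum, sum_whiskerRight, Preadditive.sum_comp, ldualMap_ev]

variable {I : Type w} [Fintype I] {V : I → C}

/-- Morphisms out of the image of `Y` under an additive functor are determined by their
restrictions along the morphisms from the family `V`. -/
lemma Decomposition.map_ext {Y : C} (D : Decomposition V Y) {E : Type*} [Category* E]
    [Preadditive E] (T : C ⥤ E) [T.Additive] {A : E} {g h : T.obj Y ⟶ A}
    (w : ∀ i (a : V i ⟶ Y), T.map a ≫ g = T.map a ≫ h) : g = h := by
  rw [← Category.id_comp g, ← Category.id_comp h, ← T.map_id, ← D.total]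
  simp only [T.map_sum, T.map_comp, Preadditive.sum_comp, Category.assoc, w]

lemma Decomposition.whiskerLeft_ext {Y : C} (D : Decomposition V Y) {A B : C} {g h : A ⊗ Y ⟶ B}
    (w : ∀ i (a : V i ⟶ Y), A ◁ a ≫ g = A ◁ a ≫ h) : g = h :=
  D.map_ext (tensorLeft A) w

lemma Decomposition.whisker_ext {Y : C} (D : Decomposition V Y) {A B W : C}
    {g h : (A ⊗ Y) ⊗ W ⟶ B} (w : ∀ i (a : V i ⟶ Y), (A ◁ a) ▷ W ≫ g = (A ◁ a) ▷ W ≫ h) : g = h :=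
  D.map_ext (tensorLeft A ⋙ tensorRight W) w

variable [HasFiniteBiproducts C] (F : FusionStructure k C I)

/-- Dinaturality on the family `V`: a scalar can be moved from one side to the other, and every
other morphism is zero. -/
lemma FusionStructure.incl_comm (X : C) {i j : I} (g : F.V i ⟶ F.V j) :
    (ldualMap g ▷ X) ▷ F.V i ≫ incl F.V i X = (ldual (F.V j) ⊗ X) ◁ g ≫ incl F.V j X := by
  by_cases h : i = j
  · subst h
    obtain ⟨r, hr⟩ := (F.end_eq i).2 g
    simp only at hr
    rw [← hr, ldualMap_smul, ldualMap_id]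
    simp
  · rw [F.hom_eq_zero i j h g, ldualMap_zero]
    simp

lemma dinat_eq {Y : C} (D : Decomposition V Y) (X : C) : dinat D X =
    ∑ i, ∑ α, (ldual Y ⊗ X) ◁ D.p i α ≫ (ldualMap (D.q i α) ▷ X) ▷ V i ≫ incl V i X := by
  simp only [dinat, MonoidalCategory.tensorHom_def', MonoidalCategory.whiskerLeft_id,
    Category.id_comp, Category.assoc]

/-- The component `a ≫ p` lies between members of `V`, so `incl_comm` moves it to the dual side,
where it meets `q`; summing the `p ≫ q` leaves `a`. Dinaturality, independence of the decomposition
and universality all follow. -/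
lemma FusionStructure.comp_dinat {Y : C} (D : Decomposition F.V Y) (X : C) {i : I}
    (a : F.V i ⟶ Y) : (ldual Y ⊗ X) ◁ a ≫ dinat D X =
      (ldualMap a ▷ X) ▷ F.V i ≫ incl F.V i X := by
  have h : ∀ j (α : Fin (D.N j)), (ldual Y ⊗ X) ◁ a ≫ (ldual Y ⊗ X) ◁ D.p j α ≫
      (ldualMap (D.q j α) ▷ X) ▷ F.V j ≫ incl F.V j X =
      (ldualMap (a ≫ D.p j α ≫ D.q j α) ▷ X) ▷ F.V i ≫ incl F.V i X := fun j α => by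
    rw [← MonoidalCategory.whiskerLeft_comp_assoc, whisker_exchange_assoc, ← F.incl_comm,
      ← Category.assoc a, ldualMap_comp (a ≫ D.p j α)]
    simp only [comp_whiskerRight, Category.assoc]
  rw [dinat_eq]
  simp only [Preadditive.comp_sum, h]
  simp only [← Preadditive.sum_comp, ← sum_whiskerRight, ← ldualMap_sum, ← Preadditive.comp_sum,
    D.total, Category.comp_id]

lemma FusionStructure.dinat_dinatural {Y Y' : C} (D : Decomposition F.V Y)
    (D' : Decomposition F.V Y') (X : C) (f : Y ⟶ Y') :
    (ldualMap f ▷ X) ▷ Y ≫ dinat D X = (ldual Y' ⊗ X) ◁ f ≫ dinat D' X := by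
  refine D.whiskerLeft_ext fun i a => ?_
  rw [whisker_exchange_assoc, F.comp_dinat, ← MonoidalCategory.whiskerLeft_comp_assoc,
    F.comp_dinat, ldualMap_comp]
  simp only [comp_whiskerRight, Category.assoc]

lemma FusionStructure.dinat_unique {Y : C} (D D' : Decomposition F.V Y) (X : C) :
    dinat D X = dinat D' X := by
  have h := F.dinat_dinatural D D' X (𝟙 Y)
  rw [ldualMap_id] at h
  simpa using h

lemma FusionStructure.dinat_V {i : I} (D : Decomposition F.V (F.V i)) (X : C) :
    dinat D X = incl F.V i X := by
  have h := F.comp_dinat D X (𝟙 _)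
  rw [ldualMap_id] at h
  simpa using h

lemma incl_map (i : I) {X X' : C} (f : X ⟶ X') :
    incl V i X ≫ (centralizer V).map f = (ldual (V i) ◁ f) ▷ V i ≫ incl V i X' := by
  simp [incl, centralizer]

lemma dinat_natural {Y : C} (D : Decomposition V Y) {X X' : C} (f : X ⟶ X') :
    dinat D X ≫ (centralizer V).map f = (ldual Y ◁ f) ▷ Y ≫ dinat D X' := by
  simp only [dinat, Preadditive.comp_sum, Preadditive.sum_comp, Category.assoc, incl_map]
  refine Finset.sum_congr rfl fun i _ => Finset.sum_congr rfl fun α _ => ?_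
  simp only [← tensorHom_id, ← id_tensorHom, tensorHom_comp_tensorHom_assoc,
    tensorHom_comp_tensorHom, Category.id_comp, Category.comp_id]

variable (V) in
/-- The projection to the `i`-th summand of `Z(X)`. -/
def proj (i : I) (X : C) : (centralizer V).obj X ⟶ (ldual (V i) ⊗ X) ⊗ V i :=
  biproduct.π (fun i => (ldual (V i) ⊗ X) ⊗ V i) i

lemma incl_proj_same (i : I) (X : C) : incl V i X ≫ proj V i X = 𝟙 _ := by
  classical exact biproduct.ι_π_self _ _

lemma incl_proj_ne {i j : I} (h : i ≠ j) (X : C) : incl V i X ≫ proj V j X = 0 := by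
  classical exact biproduct.ι_π_ne _ h

lemma centralizer_ext {X A : C} {g h : (centralizer V).obj X ⟶ A}
    (w : ∀ i, incl V i X ≫ g = incl V i X ≫ h) : g = h :=
  biproduct.hom_ext' _ _ w

lemma sum_proj_incl (X : C) : ∑ i, proj V i X ≫ incl V i X = 𝟙 ((centralizer V).obj X) := by
  refine centralizer_ext fun i => ?_
  rw [Preadditive.comp_sum, Finset.sum_eq_single i, reassoc_of% incl_proj_same, Category.comp_id]
  · intro j _ hj
    rw [reassoc_of% incl_proj_ne hj.symm, zero_comp]
  · simp

/-- A morphism out of `Z(X)` from morphisms out of its summands. -/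
def centralizerDesc {X A : C} (t : ∀ i, (ldual (V i) ⊗ X) ⊗ V i ⟶ A) :
    (centralizer V).obj X ⟶ A := biproduct.desc t

lemma incl_centralizerDesc {X A : C} (t : ∀ i, (ldual (V i) ⊗ X) ⊗ V i ⟶ A) (i : I) :
    incl V i X ≫ centralizerDesc t = t i := biproduct.ι_desc _ _

/-- A morphism out of `Z(X) ⊗ W` from morphisms out of its summands. -/
def whiskerDesc (X W : C) {A : C} (t : ∀ i, ((ldual (V i) ⊗ X) ⊗ V i) ⊗ W ⟶ A) :
    (centralizer V).obj X ⊗ W ⟶ A :=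
  ∑ i, proj V i X ▷ W ≫ t i

lemma incl_whiskerDesc (X W : C) {A : C} (t : ∀ i, ((ldual (V i) ⊗ X) ⊗ V i) ⊗ W ⟶ A) (i : I) :
    incl V i X ▷ W ≫ whiskerDesc X W t = t i := by
  rw [whiskerDesc, Preadditive.comp_sum, Finset.sum_eq_single i]
  · rw [← comp_whiskerRight_assoc, incl_proj_same]
    simp
  · intro j _ hj
    rw [← comp_whiskerRight_assoc, incl_proj_ne hj.symm]
    simp
  · simp

/-- Tensoring with `W` preserves the direct sum, so the coend is universal also with a parameter;
this is needed to construct morphisms out of `Z(X) ⊗ W`. -/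
lemma whisker_centralizer_ext {X W A : C} {g h : (centralizer V).obj X ⊗ W ⟶ A}
    (w : ∀ i, incl V i X ▷ W ≫ g = incl V i X ▷ W ≫ h) : g = h := by
  have e' : ∀ g : (centralizer V).obj X ⊗ W ⟶ A, g =
      ∑ i, proj V i X ▷ W ≫ incl V i X ▷ W ≫ g := fun g => by
    conv_lhs => rw [← Category.id_comp g, ← id_whiskerRight, ← sum_proj_incl, sum_whiskerRight,
      Preadditive.sum_comp]
    simp only [comp_whiskerRight, Category.assoc]
  rw [e' g, e' h]
  simp only [w]

/-- A dinatural family is determined by its members at the `V i`, since both sides restrict alike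
along every `V i ⟶ Y`. -/
lemma FusionStructure.dinat_whiskerDesc (D : ∀ Y, Decomposition F.V Y) {X W A : C}
    (t : ∀ Y : C, ((ldual Y ⊗ X) ⊗ Y) ⊗ W ⟶ A)
    (ht : ∀ {Y Y' : C} (f : Y ⟶ Y'),
      ((ldualMap f ▷ X) ▷ Y) ▷ W ≫ t Y = ((ldual Y' ⊗ X) ◁ f) ▷ W ≫ t Y') (Y : C) :
    dinat (D Y) X ▷ W ≫ whiskerDesc X W (fun i => t (F.V i)) = t Y := by
  refine (D Y).whisker_ext fun i a => ?_
  rw [← comp_whiskerRight_assoc, F.comp_dinat, comp_whiskerRight_assoc, incl_whiskerDesc, ht]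

/-- The cowedge of the maps `dinat`. -/
def FusionStructure.cowedge (D : ∀ Y, Decomposition F.V Y) (X : C) :
    Cowedge (centralizerDiagram (𝟭 C) X) :=
  Cowedge.mk ((centralizer F.V).obj X) (fun Y => dinat (D Y) X)
    (fun {Y Y'} f => F.dinat_dinatural (D Y) (D Y') X f)

lemma FusionStructure.dinat_desc (D : ∀ Y, Decomposition F.V Y) {X A : C}
    (t : ∀ Y : C, (ldual Y ⊗ X) ⊗ Y ⟶ A)
    (ht : ∀ {Y Y' : C} (f : Y ⟶ Y'), (ldualMap f ▷ X) ▷ Y ≫ t Y = (ldual Y' ⊗ X) ◁ f ≫ t Y')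
    (Y : C) : dinat (D Y) X ≫ centralizerDesc (fun i => t (F.V i)) = t Y := by
  refine (D Y).whiskerLeft_ext fun i a => ?_
  rw [← Category.assoc, F.comp_dinat, Category.assoc, incl_centralizerDesc, ht]

/-- The cowedge of the maps `dinat` is universal. -/
def FusionStructure.isColimit (D : ∀ Y, Decomposition F.V Y) (X : C) :
    IsColimit (F.cowedge D X) :=
  Multicofork.IsColimit.mk _ (fun s => centralizerDesc (fun i => s.π (F.V i)))
    (fun s Y => F.dinat_desc D (X := X) (fun Y => s.π Y) (fun f => Cowedge.condition s f) Y)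
    (fun s m hm => centralizer_ext fun i =>
      ((congrArg (fun g => g ≫ m) (F.dinat_V (D (F.V i)) X).symm).trans (hm (F.V i))).trans
        (incl_centralizerDesc (fun i => s.π (F.V i)) i).symm)

lemma FusionStructure.isCentralizable (F : FusionStructure k C I) : IsCentralizable (𝟭 C) :=
    fun X =>
  ⟨⟨⟨_, F.isColimit (fun Y => (F.exists_decomposition Y).some) X⟩⟩⟩

end Linear
end
end FusionCenter

namespace FusionCenter

noncomputable section

set_option linter.unusedSectionVars false

/-! ### Half-braidings from a universal natural family -/

section Universal

variable {C : Type u} [Category.{v} C] [MonoidalCategory C] [RigidCategory C]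

/-- A universal family of morphisms `X ⊗ Y ⟶ Y ⊗ Z(X)`, natural in `Y`, with parameters. -/
structure UniversalFamily (Z : C ⥤ C) where
  h : ∀ X Y, X ⊗ Y ⟶ Y ⊗ Z.obj X
  nat : ∀ {X Y Y' : C} (f : Y ⟶ Y'), X ◁ f ≫ h X Y' = h X Y ≫ f ▷ Z.obj X
  map : ∀ {X X' : C} (f : X ⟶ X') (Y : C), h X Y ≫ Y ◁ Z.map f = f ▷ Y ≫ h X' Y
  hom_ext : ∀ {X W A : C} {g g' : Z.obj X ⊗ W ⟶ A},
    (∀ Y, h X Y ▷ W ≫ (α_ _ _ _).hom ≫ Y ◁ g = h X Y ▷ W ≫ (α_ _ _ _).hom ≫ Y ◁ g') → g = g'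
  exists_lift : ∀ {X W A : C} (t : ∀ Y, (X ⊗ Y) ⊗ W ⟶ Y ⊗ A),
    (∀ {Y Y' : C} (f : Y ⟶ Y'), (X ◁ f) ▷ W ≫ t Y' = t Y ≫ f ▷ A) →
      ∃ g : Z.obj X ⊗ W ⟶ A, ∀ Y, h X Y ▷ W ≫ (α_ _ _ _).hom ≫ Y ◁ g = t Y

namespace UniversalFamily

variable {Z : C ⥤ C} (H : UniversalFamily Z)

lemma hom_ext' {X A : C} {g g' : Z.obj X ⟶ A}
    (w : ∀ Y, H.h X Y ≫ Y ◁ g = H.h X Y ≫ Y ◁ g') : g = g' := by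
  rw [← cancel_epi (ρ_ (Z.obj X)).hom]
  refine H.hom_ext fun Y => ?_
  have e : ∀ g : Z.obj X ⟶ A, H.h X Y ▷ 𝟙_ C ≫ (α_ _ _ _).hom ≫ Y ◁ ((ρ_ (Z.obj X)).hom ≫ g) =
      (ρ_ _).hom ≫ H.h X Y ≫ Y ◁ g := fun g => by monoidal
  rw [e, e, w]

lemma exists_lift' {X A : C} (t : ∀ Y, X ⊗ Y ⟶ Y ⊗ A)
    (ht : ∀ {Y Y' : C} (f : Y ⟶ Y'), X ◁ f ≫ t Y' = t Y ≫ f ▷ A) :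
    ∃ g : Z.obj X ⟶ A, ∀ Y, H.h X Y ≫ Y ◁ g = t Y := by
  obtain ⟨g, hg⟩ := H.exists_lift (W := 𝟙_ C) (fun Y => (ρ_ _).hom ≫ t Y) (fun f => by
    rw [rightUnitor_naturality_assoc, ht, Category.assoc])
  refine ⟨(ρ_ _).inv ≫ g, fun Y => ?_⟩
  rw [← cancel_epi (ρ_ (X ⊗ Y)).hom, ← hg]
  monoidal

/-- The half-braiding is defined by requiring that `h` at `Y` followed by it be `h` at `Y ⊗ W`. -/
lemma exists_braiding (X W : C) : ∃ g : Z.obj X ⊗ W ⟶ W ⊗ Z.obj X, ∀ Y,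
    H.h X Y ▷ W ≫ (α_ _ _ _).hom ≫ Y ◁ g = (α_ _ _ _).hom ≫ H.h X (Y ⊗ W) ≫ (α_ _ _ _).hom :=
  H.exists_lift _ (fun {Y Y'} f => by
    have h := H.nat (X := X) (f ▷ W)
    calc _ = (α_ X Y W).hom ≫ (X ◁ f ▷ W ≫ H.h X (Y' ⊗ W)) ≫ (α_ _ _ _).hom := by monoidal
      _ = _ := by rw [h]; monoidal)

/-- The half-braiding, as a family of morphisms. -/
def σ (X W : C) : Z.obj X ⊗ W ⟶ W ⊗ Z.obj X := (H.exists_braiding X W).choose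

lemma h_σ (X W Y : C) : H.h X Y ▷ W ≫ (α_ _ _ _).hom ≫ Y ◁ H.σ X W =
    (α_ _ _ _).hom ≫ H.h X (Y ⊗ W) ≫ (α_ _ _ _).hom :=
  (H.exists_braiding X W).choose_spec Y

/-- The half-braiding of `Z(X)`. -/
def braiding (X : C) : HalfBraiding (Z.obj X) :=
  HalfBraiding.ofLax (H.σ X)
    (fun {U U'} f => H.hom_ext fun Y => by
      calc _ = (X ⊗ Y) ◁ f ≫ (H.h X Y ▷ U' ≫ (α_ _ _ _).hom ≫ Y ◁ H.σ X U') := by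
            rw [whisker_exchange_assoc]; monoidal
        _ = (α_ _ _ _).hom ≫ (X ◁ (Y ◁ f) ≫ H.h X (Y ⊗ U')) ≫ (α_ _ _ _).hom := by
            rw [h_σ]; monoidal
        _ = ((α_ _ _ _).hom ≫ H.h X (Y ⊗ U) ≫ (α_ _ _ _).hom) ≫ Y ◁ f ▷ Z.obj X := by
            rw [H.nat]; monoidal
        _ = _ := by rw [← H.h_σ]; monoidal)
    (fun U U' => H.hom_ext fun Y => by
      rw [h_σ]
      symm
      calc _ = 𝟙 _ ⊗≫ (H.h X Y ▷ U ≫ (α_ _ _ _).hom ≫ Y ◁ H.σ X U) ▷ U' ⊗≫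
            Y ◁ U ◁ H.σ X U' ⊗≫ 𝟙 _ := by monoidal
        _ = 𝟙 _ ⊗≫ (H.h X (Y ⊗ U) ▷ U' ≫ (α_ _ _ _).hom ≫ (Y ⊗ U) ◁ H.σ X U') ⊗≫ 𝟙 _ := by
            rw [h_σ]; monoidal
        _ = 𝟙 _ ⊗≫ X ◁ (α_ Y U U').hom ⊗≫ X ◁ (α_ Y U U').inv ⊗≫
              H.h X ((Y ⊗ U) ⊗ U') ⊗≫ 𝟙 _ := by rw [h_σ]; monoidal
        _ = 𝟙 _ ⊗≫ X ◁ (α_ Y U U').hom ⊗≫ (X ◁ (α_ Y U U').inv ≫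
              H.h X ((Y ⊗ U) ⊗ U')) ⊗≫ 𝟙 _ := by monoidal
        _ = _ := by rw [H.nat]; monoidal)
    (H.hom_ext fun Y => by
      rw [h_σ]
      calc _ = 𝟙 _ ⊗≫ X ◁ (ρ_ Y).inv ⊗≫ (X ◁ (ρ_ Y).hom ≫ H.h X Y) ⊗≫ 𝟙 _ := by
            rw [H.nat]; monoidal
        _ = _ := by monoidal)

lemma braiding_hom (X W : C) : ((H.braiding X).β W).hom = H.σ X W := rfl

/-- The unit. -/
def η (X : C) : X ⟶ Z.obj X := (ρ_ X).inv ≫ H.h X (𝟙_ C) ≫ (λ_ _).hom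

lemma η_σ (X Y : C) : H.η X ▷ Y ≫ H.σ X Y = H.h X Y := by
  have h := H.h_σ X Y (𝟙_ C)
  calc _ = 𝟙 _ ⊗≫ (H.h X (𝟙_ C) ▷ Y ≫ (α_ _ _ _).hom ≫ 𝟙_ C ◁ H.σ X Y) ⊗≫ 𝟙 _ := by
        rw [η]; monoidal
    _ = 𝟙 _ ⊗≫ (H.h X (𝟙_ C ⊗ Y) ≫ (λ_ Y).hom ▷ Z.obj X) := by rw [h]; monoidal
    _ = _ := by rw [← H.nat]; monoidal

lemma η_comp {X A : C} (g : Z.obj X ⟶ A) :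
    H.η X ≫ g = (ρ_ X).inv ≫ (H.h X (𝟙_ C) ≫ 𝟙_ C ◁ g) ≫ (λ_ _).hom := by
  rw [η]; monoidal

lemma exists_desc {X M : C} (b : HalfBraiding M) (f : X ⟶ M) :
    ∃ g : Z.obj X ⟶ M, ∀ Y, H.h X Y ≫ Y ◁ g = f ▷ Y ≫ (b.β Y).hom :=
  H.exists_lift' (fun Y => f ▷ Y ≫ (b.β Y).hom) (fun g => by
    rw [whisker_exchange_assoc, b.naturality, Category.assoc])

/-- The morphism out of `Z(X)` attached to a morphism to an object with a half-braiding. -/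
def desc {X M : C} (b : HalfBraiding M) (f : X ⟶ M) : Z.obj X ⟶ M := (H.exists_desc b f).choose

lemma h_desc {X M : C} (b : HalfBraiding M) (f : X ⟶ M) (Y : C) :
    H.h X Y ≫ Y ◁ H.desc b f = f ▷ Y ≫ (b.β Y).hom := (H.exists_desc b f).choose_spec Y

/-- Tested against the universal family, both sides become `f` followed by `b` at `Y ⊗ U`, by
multiplicativity of `b`. -/
lemma desc_comm {X M : C} (b : HalfBraiding M) (f : X ⟶ M) (U : C) :
    H.desc b f ▷ U ≫ (b.β U).hom = H.σ X U ≫ U ◁ H.desc b f := by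
  refine H.hom_ext fun Y => ?_
  calc _ = (H.h X Y ≫ Y ◁ H.desc b f) ▷ U ≫ (α_ _ _ _).hom ≫ Y ◁ (b.β U).hom := by monoidal
    _ = (α_ _ _ _).hom ≫ (f ▷ (Y ⊗ U) ≫ (b.β (Y ⊗ U)).hom) ≫ (α_ _ _ _).hom := by
        rw [h_desc, b.monoidal]; monoidal
    _ = ((α_ _ _ _).hom ≫ H.h X (Y ⊗ U) ≫ (α_ _ _ _).hom) ≫ Y ◁ U ◁ H.desc b f := by
        rw [← H.h_desc]; monoidal
    _ = _ := by rw [← H.h_σ]; monoidal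

lemma η_desc {X M : C} (b : HalfBraiding M) (f : X ⟶ M) : H.η X ≫ H.desc b f = f := by
  rw [η_comp, h_desc, halfBraiding_unit]
  simp

/-- The left adjoint of the forgetful functor from the center given by a universal family. -/
def freeCenter : FreeCenter Z where
  hb := H.braiding
  η :=
    { app := H.η
      naturality := fun X Y f => by
        change f ≫ H.η Y = H.η X ≫ Z.map f
        rw [η_comp, H.map, η]
        simp }
  map_comm {X Y} f U := H.hom_ext fun V => by
    change _ ≫ _ ≫ V ◁ (Z.map f ▷ U ≫ H.σ Y U) = _ ≫ _ ≫ V ◁ (H.σ X U ≫ U ◁ Z.map f)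
    calc _ = (H.h X V ≫ V ◁ Z.map f) ▷ U ≫ (α_ _ _ _).hom ≫ V ◁ H.σ Y U := by monoidal
      _ = (f ▷ V) ▷ U ≫ (H.h Y V ▷ U ≫ (α_ _ _ _).hom ≫ V ◁ H.σ Y U) := by
          rw [H.map]; monoidal
      _ = (α_ _ _ _).hom ≫ (f ▷ (V ⊗ U) ≫ H.h Y (V ⊗ U)) ≫ (α_ _ _ _).hom := by
          rw [h_σ]; monoidal
      _ = ((α_ _ _ _).hom ≫ H.h X (V ⊗ U) ≫ (α_ _ _ _).hom) ≫ V ◁ U ◁ Z.map f := by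
          rw [← H.map]; monoidal
      _ = _ := by rw [← H.h_σ]; monoidal
  desc {X A} f := ⟨H.desc A.2 f, H.desc_comm A.2 f⟩
  η_desc {X A} f := H.η_desc A.2 f
  hom_ext {X A} g g' w := by
    obtain ⟨M, b⟩ := A
    refine Center.ext _ _ (H.hom_ext' fun Y => ?_)
    -- A morphism of the center commutes with the half-braidings, and `h` is the unit followed by
    -- the half-braiding, so `g` is determined by its restriction to the unit.
    have e : ∀ g : centerMk (H.braiding X) ⟶ centerMk b,
        H.h X Y ≫ Y ◁ centerHom g = (H.η X ≫ centerHom g) ▷ Y ≫ (b.β Y).hom := fun g => by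
      rw [comp_whiskerRight, Category.assoc, centerHom_comm g Y, braiding_hom, ← η_σ,
        Category.assoc]
    refine (e g).trans (Eq.trans ?_ (e g').symm)
    exact congrArg (fun z : X ⟶ M => z ▷ Y ≫ (b.β Y).hom) w

lemma freeCenter_half (X Y : C) : H.freeCenter.half X Y = H.h X Y := H.η_σ X Y

end UniversalFamily
end Universal

/-! ### The universal family of a fusion category -/

section Fusion

variable {k : Type*} [CommRing k] {C : Type u} [Category.{v} C] [Preadditive C]
    [Linear k C] [MonoidalCategory C] [MonoidalPreadditive C] [HasFiniteBiproducts C]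
    [MonoidalLinear k C] [RigidCategory C] {I : Type w} [Fintype I]

namespace FusionStructure

variable (F : FusionStructure k C I) (D : ∀ Y, Decomposition F.V Y)

/-- The universal natural family of a fusion category. -/
def half (X Y : C) : X ⊗ Y ⟶ Y ⊗ (centralizer F.V).obj X :=
  𝟙 (X ⊗ Y) ⊗≫ coev Y ▷ (X ⊗ Y) ⊗≫ Y ◁ dinat (D Y) X

lemma dinat_half (X Y : C) : dinat (D Y) X =
    𝟙 _ ⊗≫ ldual Y ◁ F.half D X Y ⊗≫ ev Y ▷ (centralizer F.V).obj X ⊗≫ 𝟙 _ := by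
  symm
  calc _ = 𝟙 _ ⊗≫ ldual Y ◁ coev Y ▷ (X ⊗ Y) ⊗≫ ((ldual Y ⊗ Y) ◁ dinat (D Y) X ≫
        ev Y ▷ (centralizer F.V).obj X) ⊗≫ 𝟙 _ := by rw [half]; monoidal
    _ = 𝟙 _ ⊗≫ (ldual Y ◁ coev Y ⊗≫ ev Y ▷ ldual Y) ▷ (X ⊗ Y) ⊗≫ dinat (D Y) X ⊗≫ 𝟙 _ := by
        rw [whisker_exchange]; monoidal
    _ = _ := by rw [coev_ev]; monoidal

/-- The universal family of a fusion category. -/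
def universalFamily : UniversalFamily (centralizer F.V) where
  h := F.half D
  nat {X Y Y'} f := by
    symm
    calc _ = 𝟙 (X ⊗ Y) ⊗≫ coev Y ▷ (X ⊗ Y) ⊗≫ (Y ◁ dinat (D Y) X ≫
          f ▷ (centralizer F.V).obj X) := by rw [half]; monoidal
      _ = 𝟙 (X ⊗ Y) ⊗≫ (coev Y ≫ f ▷ ldual Y) ▷ (X ⊗ Y) ⊗≫ Y' ◁ dinat (D Y) X := by
          rw [whisker_exchange]; monoidal
      _ = 𝟙 (X ⊗ Y) ⊗≫ coev Y' ▷ (X ⊗ Y) ⊗≫ Y' ◁ ((ldualMap f ▷ X) ▷ Y ≫ dinat (D Y) X) := by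
          rw [← coev_ldualMap]; monoidal
      _ = 𝟙 (X ⊗ Y) ⊗≫ (coev Y' ▷ (X ⊗ Y) ≫ (Y' ⊗ ldual Y') ◁ (X ◁ f)) ⊗≫
          Y' ◁ dinat (D Y') X := by
          rw [F.dinat_dinatural (D Y) (D Y')]; monoidal
      _ = _ := by
          rw [← whisker_exchange, half]; monoidal
  map {X X'} f Y := by
    calc _ = 𝟙 (X ⊗ Y) ⊗≫ coev Y ▷ (X ⊗ Y) ⊗≫ Y ◁ (dinat (D Y) X ≫ (centralizer F.V).map f) := by
          rw [half]; monoidal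
      _ = 𝟙 (X ⊗ Y) ⊗≫ (coev Y ▷ (X ⊗ Y) ≫ (Y ⊗ ldual Y) ◁ (f ▷ Y)) ⊗≫ Y ◁ dinat (D Y) X' := by
          rw [dinat_natural]; monoidal
      _ = _ := by rw [← whisker_exchange, half]; monoidal
  hom_ext {X W A g g'} w := by
    have e : ∀ (g : (centralizer F.V).obj X ⊗ W ⟶ A) Y, dinat (D Y) X ▷ W ≫ g =
        𝟙 _ ⊗≫ ldual Y ◁ (F.half D X Y ▷ W ≫ (α_ _ _ _).hom ≫ Y ◁ g) ⊗≫ ev Y ▷ A ⊗≫ 𝟙 _ :=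
      fun g Y => by
        symm
        calc _ = 𝟙 _ ⊗≫ ldual Y ◁ F.half D X Y ▷ W ⊗≫ ((ldual Y ⊗ Y) ◁ g ≫ ev Y ▷ A) ⊗≫ 𝟙 _ := by
              monoidal
          _ = (𝟙 ((ldual Y ⊗ X) ⊗ Y) ⊗≫ ldual Y ◁ F.half D X Y ⊗≫
                ev Y ▷ (centralizer F.V).obj X ⊗≫ 𝟙 ((centralizer F.V).obj X)) ▷ W ≫ g := by
              rw [whisker_exchange]; monoidal
          _ = _ := by rw [← dinat_half]
    refine whisker_centralizer_ext fun i => ?_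
    rw [← F.dinat_V (D (F.V i)), e, e, w]
  exists_lift {X W A} t ht := by
    -- The natural family `t` is transposed to a dinatural one, factored through the direct sum, and
    -- transposed back below.
    refine ⟨whiskerDesc X W (fun i =>
      𝟙 _ ⊗≫ ldual (F.V i) ◁ t (F.V i) ⊗≫ ev (F.V i) ▷ A ⊗≫ 𝟙 A), fun Y => ?_⟩
    have h := F.dinat_whiskerDesc D (X := X) (W := W) (A := A)
      (fun Y => 𝟙 _ ⊗≫ ldual Y ◁ t Y ⊗≫ ev Y ▷ A ⊗≫ 𝟙 A) (fun {Y Y'} f => by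
        calc _ = 𝟙 _ ⊗≫ (ldualMap f ▷ ((X ⊗ Y) ⊗ W) ≫ ldual Y ◁ t Y) ⊗≫ ev Y ▷ A ⊗≫ 𝟙 A := by
              monoidal
          _ = 𝟙 _ ⊗≫ ldual Y' ◁ t Y ⊗≫ (ldualMap f ▷ Y ≫ ev Y) ▷ A ⊗≫ 𝟙 A := by
              rw [← whisker_exchange]; monoidal
          _ = 𝟙 _ ⊗≫ ldual Y' ◁ (t Y ≫ f ▷ A) ⊗≫ ev Y' ▷ A ⊗≫ 𝟙 A := by
              rw [ldualMap_ev]; monoidal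
          _ = _ := by rw [← ht]; monoidal) Y
    calc _ = 𝟙 _ ⊗≫ coev Y ▷ ((X ⊗ Y) ⊗ W) ⊗≫ Y ◁ (dinat (D Y) X ▷ W ≫ whiskerDesc X W (fun i =>
          𝟙 _ ⊗≫ ldual (F.V i) ◁ t (F.V i) ⊗≫ ev (F.V i) ▷ A ⊗≫ 𝟙 A)) := by
          rw [half]; monoidal
      _ = 𝟙 _ ⊗≫ (coev Y ▷ ((X ⊗ Y) ⊗ W) ≫ (Y ⊗ ldual Y) ◁ t Y) ⊗≫ Y ◁ (ev Y ▷ A) ⊗≫ 𝟙 _ := by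
          rw [h]; monoidal
      _ = t Y ⊗≫ (coev Y ▷ Y ⊗≫ Y ◁ ev Y) ▷ A ⊗≫ 𝟙 _ := by
          rw [← whisker_exchange]; monoidal
      _ = _ := by rw [ev_coev]; monoidal

/-- The left adjoint of the forgetful functor from the center of a fusion category. -/
def freeCenter : FreeCenter (centralizer F.V) :=
  (F.universalFamily fun Y => (F.exists_decomposition Y).some).freeCenter

lemma freeCenter_univ {Y : C} (D : Decomposition F.V Y) (X : C) :
    F.freeCenter.univ Y X = dinat D X := by
  rw [F.dinat_unique D (F.exists_decomposition Y).some, FreeCenter.univ, freeCenter,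
    UniversalFamily.freeCenter_half]
  exact (F.dinat_half (fun Y => (F.exists_decomposition Y).some) X Y).symm

lemma freeCenter_univ_V (i : I) (X : C) : F.freeCenter.univ (F.V i) X = incl F.V i X := by
  rw [F.freeCenter_univ (F.exists_decomposition (F.V i)).some, F.dinat_V]

lemma hasCentralizerFormulas (D : ∀ Y, Decomposition F.V Y) :
    HasCentralizerFormulas F.V F.freeCenter.quasitriangular D where
  T₂_eq i X Y := by
    have h := F.freeCenter.univ_comul X Y (F.V i)
    simp only [freeCenter_univ_V] at h
    exact h
  T₀_eq i := by
    have h := F.freeCenter.univ_counit (F.V i)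
    simp only [freeCenter_univ_V] at h
    exact h
  μ_eq i j X := by
    have h := F.freeCenter.univ_mul (F.V j) (F.V i) X
    simp only [freeCenter_univ_V] at h
    rw [F.freeCenter_univ (D _)] at h
    exact h
  η_eq X := by
    have h := F.freeCenter.unit_eq_univ X
    rw [F.freeCenter_univ (D _)] at h
    exact h
  sl_eq i X := by
    have h := F.freeCenter.univ_sl (F.V i) X
    rw [freeCenter_univ_V, F.freeCenter_univ (D _)] at h
    exact h
  sr_eq i X := by
    have h := F.freeCenter.univ_sr (F.V i) X
    rw [freeCenter_univ_V, F.freeCenter_univ (D _)] at h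
    exact h
  R_eq X Y := by
    have h := F.freeCenter.R_eq_univ X Y
    rw [F.freeCenter_univ (D _)] at h
    exact h

end FusionStructure
end Fusion
end
end FusionCenter

/-! ### Traces and the equality of the two partial traces -/

namespace FusionCenter

noncomputable section

set_option linter.unusedSectionVars false

section Trace

variable {C : Type u} [Category.{v} C] [MonoidalCategory C] [RigidCategory C]

namespace SovereignStructure

variable (S : SovereignStructure C)

lemma trl_comp_comm {X Y : C} (f : X ⟶ Y) (g : Y ⟶ X) : S.trl (f ≫ g) = S.trl (g ≫ f) := by
  simp only [trl, MonoidalCategory.whiskerLeft_comp, Category.assoc]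
  rw [reassoc_of% coev'_natural, ← whisker_exchange_assoc, ldualMap_ev]

lemma trl_tensor {X Y : C} (g : X ⊗ Y ⟶ X ⊗ Y) : S.trl g =
    S.coev' Y ⊗≫ ldual Y ◁ (S.coev' X ▷ Y ⊗≫ ldual X ◁ g ⊗≫ ev X ▷ Y) ⊗≫ ev Y := by
  calc _ = S.coev' (X ⊗ Y) ≫ (ldual (X ⊗ Y) ◁ g ≫ (ldualTensorIso X Y).hom ▷ (X ⊗ Y)) ⊗≫
        ldual Y ◁ (ev X ▷ Y) ⊗≫ ev Y := by
        rw [trl, ← ldualTensorIso_ev]; monoidal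
    _ = (S.coev' (X ⊗ Y) ≫ (ldualTensorIso X Y).hom ▷ (X ⊗ Y)) ≫ (ldual Y ⊗ ldual X) ◁ g ⊗≫
        ldual Y ◁ (ev X ▷ Y) ⊗≫ ev Y := by rw [whisker_exchange]; monoidal
    _ = _ := by rw [coev'_tensor]; monoidal

lemma trr_tensor {X Y : C} (g : X ⊗ Y ⟶ X ⊗ Y) : S.trr g =
    coev X ⊗≫ (X ◁ coev Y ⊗≫ g ▷ ldual Y ⊗≫ X ◁ S.ev' Y) ▷ ldual X ⊗≫ S.ev' X := by
  have h : (X ⊗ Y) ◁ (ldualTensorIso X Y).hom ≫ (X ⊗ Y) ◁ (ldualTensorIso X Y).inv = 𝟙 _ := by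
    rw [← MonoidalCategory.whiskerLeft_comp, Iso.hom_inv_id, MonoidalCategory.whiskerLeft_id]
  calc _ = coev (X ⊗ Y) ≫ (g ▷ ldual (X ⊗ Y) ≫ (X ⊗ Y) ◁ (ldualTensorIso X Y).hom) ≫
        (X ⊗ Y) ◁ (ldualTensorIso X Y).inv ≫ S.ev' (X ⊗ Y) := by
        rw [trr, Category.assoc, reassoc_of% h]
    _ = (coev (X ⊗ Y) ≫ (X ⊗ Y) ◁ (ldualTensorIso X Y).hom) ≫ g ▷ (ldual Y ⊗ ldual X) ≫
        (X ⊗ Y) ◁ (ldualTensorIso X Y).inv ≫ S.ev' (X ⊗ Y) := by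
        rw [← whisker_exchange]; simp only [Category.assoc]
    _ = _ := by rw [coev_ldualTensorIso, tensor_ev']; monoidal

variable {M : C} (b : HalfBraiding M)

/-- A trace of a partial trace is the full trace over `M ⊗ M`. -/
lemma trl_halfTwist (f : M ⟶ M) : S.trl (S.halfTwist b ≫ f) = S.trl ((b.β M).hom ≫ M ◁ f) := by
  rw [trl_tensor]
  calc _ = S.coev' M ⊗≫ ldual M ◁ (S.coev' M ▷ M ⊗≫ ldual M ◁ (b.β M).hom ⊗≫
        (ev M ▷ M ≫ 𝟙_ C ◁ f)) ⊗≫ ev M := by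
        simp only [trl, halfTwist]; monoidal
    _ = _ := by rw [← whisker_exchange]; monoidal

lemma trr_halfTwist' (f : M ⟶ M) :
    S.trr (S.halfTwist' b ≫ f) = S.trr ((b.β M).hom ≫ f ▷ M) := by
  rw [trr_tensor]
  calc _ = coev M ⊗≫ (M ◁ coev M ⊗≫ (b.β M).hom ▷ ldual M ⊗≫
        (M ◁ S.ev' M ≫ f ▷ 𝟙_ C)) ▷ ldual M ⊗≫ S.ev' M := by
        simp only [trr, halfTwist']; monoidal
    _ = _ := by rw [whisker_exchange]; monoidal

variable {S}

/-- Both sides become traces of the half-braiding with `f` on one strand. Cyclicity and naturality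
move `f` to the other strand, and sphericity exchanges left and right traces. -/
lemma IsSpherical.trl_halfTwist_eq (hS : S.IsSpherical) (f : M ⟶ M) :
    S.trl (S.halfTwist b ≫ f) = S.trl (S.halfTwist' b ≫ f) := by
  rw [trl_halfTwist, hS _ (S.halfTwist' b ≫ f), trr_halfTwist', trl_comp_comm, b.naturality,
    hS]

/-- In a category where morphisms out of the unit are detected by morphisms to the unit, the trace
form is nondegenerate. -/
lemma ext_of_trl
    (hC : ∀ (W : C) (g g' : 𝟙_ C ⟶ W), (∀ h : W ⟶ 𝟙_ C, g ≫ h = g' ≫ h) → g = g')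
    {a a' : M ⟶ M} (h : ∀ f : M ⟶ M, S.trl (a ≫ f) = S.trl (a' ≫ f)) : a = a' := by
  refine S.coev'_injective (hC _ _ _ fun t => ?_)
  -- By duality every `t : ∨M ⊗ M ⟶ 𝟙` is `ev M` preceded by an endomorphism of `M`, so testing with
  -- all `t` amounts to testing with all traces.
  have ht : t = ldual M ◁ ((λ_ M).inv ≫ coev M ▷ M ≫ (α_ _ _ _).hom ≫ M ◁ t ≫ (ρ_ M).hom) ≫
      ev M := by
    symm
    calc _ = 𝟙 _ ⊗≫ ldual M ◁ coev M ▷ M ⊗≫ ((ldual M ⊗ M) ◁ t ≫ ev M ▷ 𝟙_ C) ⊗≫ 𝟙 _ := by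
          monoidal
      _ = 𝟙 _ ⊗≫ (ldual M ◁ coev M ⊗≫ ev M ▷ ldual M) ▷ M ⊗≫ t := by
          rw [whisker_exchange]; monoidal
      _ = _ := by rw [coev_ev]; monoidal
  have h' := h ((λ_ M).inv ≫ coev M ▷ M ≫ (α_ _ _ _).hom ≫ M ◁ t ≫ (ρ_ M).hom)
  rw [ht]
  simpa only [trl, MonoidalCategory.whiskerLeft_comp, Category.assoc] using h'

end SovereignStructure

end Trace

section Fusion

variable {k : Type*} [CommRing k] {C : Type u} [Category.{v} C] [Preadditive C] [Linear k C]
  [HasFiniteBiproducts C] [MonoidalCategory C] [MonoidalPreadditive C] [MonoidalLinear k C]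
  [RigidCategory C] {I : Type w} [Fintype I]

namespace FusionStructure

/-- The unit is isomorphic to one `V i₀`: components into copies of `V i₀` are seen by morphisms to
the unit, and all other components vanish. -/
lemma unit_hom_ext (F : FusionStructure k C I) (W : C) (g g' : 𝟙_ C ⟶ W) (h : ∀ t : W ⟶ 𝟙_ C, g ≫
    t = g' ≫ t) : g = g' := by
  obtain ⟨D⟩ := F.exists_decomposition W
  obtain ⟨i₀, ⟨e⟩⟩ := F.exists_unit
  rw [← Category.comp_id g, ← Category.comp_id g', ← D.total]
  simp only [Preadditive.comp_sum, ← Category.assoc]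
  refine Finset.sum_congr rfl fun i _ => Finset.sum_congr rfl fun α _ => ?_
  congr 1
  by_cases hi : i₀ = i
  · subst hi
    rw [← cancel_mono e.inv, Category.assoc, Category.assoc, h]
  · have hz (t : 𝟙_ C ⟶ F.V i) : t = 0 := by
      rw [← cancel_epi e.inv, F.hom_eq_zero i₀ i hi (e.inv ≫ t), comp_zero]
    rw [hz (g ≫ _), hz (g' ≫ _)]

lemma halfTwist_eq_halfTwist' (F : FusionStructure k C I) {S : SovereignStructure C} (hS :
    S.IsSpherical) {M : C}
    (b : HalfBraiding M) : S.halfTwist b = S.halfTwist' b :=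
  SovereignStructure.ext_of_trl F.unit_hom_ext (hS.trl_halfTwist_eq b)

end FusionStructure

end Fusion
end
end FusionCenter

/-! ### Assembly of the theorem -/

theorem mainTheorem3 {k : Type*} [CommRing k] {C : Type u} [Category.{v} C] [Preadditive C]
    [Linear k C] [HasFiniteBiproducts C] [MonoidalCategory C] [MonoidalPreadditive C]
    [MonoidalLinear k C] [RigidCategory C] {I : Type w} [Fintype I]
    (F : FusionCenter.FusionStructure k C I) :
    -- the trivial Hopf monad is centralizable, with centralizer `Z` and the given dinatural maps
    FusionCenter.IsCentralizable (𝟭 C) ∧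
    (∀ (D : ∀ Y : C, FusionCenter.Decomposition F.V Y),
      (∀ X : C, ∃ h, Nonempty (IsColimit
        (Cowedge.mk (F := FusionCenter.centralizerDiagram (𝟭 C) X)
          ((FusionCenter.centralizer F.V).obj X) (fun Y => FusionCenter.dinat (D Y) X) h))) ∧
      (∀ (X X' Y : C) (f : X ⟶ X'),
        FusionCenter.dinat (D Y) X ≫ (FusionCenter.centralizer F.V).map f =
          (FusionCenter.ldual Y ◁ f) ▷ Y ≫ FusionCenter.dinat (D Y) X')) ∧
    -- `Z` is a quasitriangular Hopf monad with explicit structural morphisms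
    ∃ Q : FusionCenter.QuasitriangularHopfMonadStructure (FusionCenter.centralizer F.V),
      (∀ D, FusionCenter.HasCentralizerFormulas F.V Q D) ∧
      -- the isomorphism `Center C ≅ Z-C` of braided categories over `C`
      ∃ ρ : Q.ActionOn (Center.forget C),
        (∀ (A : Center C) (i : I), FusionCenter.incl F.V i A.1 ≫ ρ.act A =
          (α_ _ _ _).hom ≫ FusionCenter.ldual (F.V i) ◁ (A.2.β (F.V i)).hom ≫ (α_ _ _ _).inv ≫
            FusionCenter.ev (F.V i) ▷ A.1 ≫ (λ_ A.1).hom) ∧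
        (∃ G : Q.Modules ⥤ Center C, ρ.lift ⋙ G = 𝟭 _ ∧ G ⋙ ρ.lift = 𝟭 _) ∧
        (∃ _ : BraidedCategory Q.Modules,
          (∀ M N : Q.Modules, (β_ M N).hom.f = Q.R M.A N.A ≫ (N.a ⊗ₘ M.a)) ∧
          ∃ _ : ρ.lift.Braided,
            (Functor.LaxMonoidal.ε ρ.lift).f = 𝟙 (𝟙_ C) ∧
            ∀ A B : Center C, (Functor.LaxMonoidal.μ ρ.lift A B).f = 𝟙 (A.1 ⊗ B.1)) ∧
        -- the spherical case
        ∀ S : FusionCenter.SovereignStructure C, S.IsSpherical →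
          ∃ t : Q.SelfDualTwist,
            (∀ (X : C) (D : FusionCenter.Decomposition F.V X),
              t.θ.app X = (λ_ X).inv ≫ S.coev' X ▷ X ≫ FusionCenter.dinat D X) ∧
            (∀ (X : C) (D : FusionCenter.Decomposition F.V (FusionCenter.ldual X)),
              t.θinv.app X = (ρ_ X).inv ≫ ((S.φ X).hom ⊗ₘ FusionCenter.coev X) ≫
                (α_ _ _ _).inv ≫ FusionCenter.dinat D X) ∧
            ∃ (_ : RigidCategory (Center C)) (r : FusionCenter.RibbonStructure (Center C)),
              ∀ A : Center C, (r.twist.hom.app A).f = t.θ.app A.1 ≫ ρ.act A := by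
  refine ⟨F.isCentralizable, fun D => ⟨fun X =>
      ⟨fun Y Y' f => F.dinat_dinatural (D Y) (D Y') X f, ⟨F.isColimit D X⟩⟩,
    fun X X' Y f => FusionCenter.dinat_natural (D Y) f⟩, F.freeCenter.quasitriangular,
    -- One structure serves every `D`, because `dinat` does not depend on the decomposition.
    fun D => F.hasCentralizerFormulas D, F.freeCenter.actionOn, fun A i => ?_,
    ⟨F.freeCenter.toCenter, F.freeCenter.lift_toCenter, F.freeCenter.toCenter_lift⟩,
    ⟨F.freeCenter.modulesBraided, F.freeCenter.modulesBraiding_eq, F.freeCenter.liftBraided,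
      -- Strictness holds by definition, the structure isomorphisms in `liftCore` being identities.
      rfl, fun _ _ => rfl⟩, fun S hS => ?_⟩
  · rw [← F.freeCenter_univ_V]
    exact F.freeCenter.univ_act_eq A.2 (F.V i)
  · refine ⟨F.freeCenter.selfDualTwist S fun b => F.halfTwist_eq_halfTwist' hS b,
      fun X D => ?_, fun X D => ?_, FusionCenter.centerRigid,
      S.centerRibbon fun b => F.halfTwist_eq_halfTwist' hS b,
      fun A => (S.twistHom_f A.2).trans (F.freeCenter.tw_act S A.2).symm⟩
    · rw [← F.freeCenter_univ D]
      exact F.freeCenter.tw_eq_univ S X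
    · rw [← F.freeCenter_univ D]
      exact F.freeCenter.twI_eq_univ S X
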